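/- **Conventions.** Let $R$ be a commutative ring. A directed graph $G$ may have loops but no parallel edges; a map of directed graphs $G\to G'$ is a function $f$ on vertices such that for every edge $x\to y$ of $G$ either $f(x)=f(y)$ or $f(x)\to f(y)$ is an edge of $G'$. Let $d(x,y)\in\mathbb{N}\cup\{\infty\}$ be the least number of edges of a directed path from $x$ to $y$. The reachability complex $\mathrm{RC}_*(G)$ is the complex of $R$-modules in which $\mathrm{RC}_k(G)$ is free on the tuples $(x_0,\dots,x_k)$ of vertices with $x_{i}\neq x_{i+1}$ and $d(x_i,x_{i+1})<\infty$ for all $0\le i<k$, with differential $\partial(x_0,\dots,x_k)=\sum_i(-1)^i(x_0,\dots,\widehat{x_i},\dots,x_k)$, where terms with repeated consecutive entries are omitted. It is filtered by the subcomplexes $F_\ell\mathrm{RC}_*(G)$ spanned by the tuples of length $d(x_0,x_1)+\dots+d(x_{k-1},x_k)\le\ell$. The magnitude-path spectral sequence $E^r_{pq}(G)$, $r\ge0$, $p,q\in\mathbb{Z}$, is the spectral sequence of this filtered complex, so that $E^0_{pq}(G)=F_p\mathrm{RC}_{p+q}(G)/F_{p-1}\mathrm{RC}_{p+q}(G)$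 and $d^r$ has bidegree $(-r,r-1)$. The box product $G\square H$ has vertex set $V(G)\times V(H)$ and an edge $(g_1,h_1)\to(g_2,h_2)$ whenever $g_1=g_2$ and $h_1\to h_2$ is an edge of $H$, or $h_1=h_2$ and $g_1\to g_2$ is an edge of $G$. The Eilenberg–Zilber (shuffle) map $\nabla\colon\mathrm{RC}(G)\otimes\mathrm{RC}(H)\to\mathrm{RC}(G\square H)$, $$\nabla\big((g_0,\dots,g_k)\otimes(h_0,\dots,h_{k'})\big)=\sum_\sigma(-1)^{n(\sigma)}\big((g_{i_0},h_{j_0}),\dots,(g_{i_{k+k'}},h_{j_{k+k'}})\big),$$ where $\sigma=((i_0,j_0),\dots,(i_{k+k'},j_{k+k'}))$ runs over the lattice paths from $(0,0)$ to $(k,k')$ whose steps increase exactly one coordinate by $1$ and $n(\sigma)$ is the number of lattice points on or above the $x$-axis and strictly below $\sigma$, is a filtered chain map; for every $r\ge 0$ it induces maps $$\nabla^r\colon\bigoplus_{\substack{m+u=p\\ n+v=q}}E^r_{mn}(G)\otimes E^r_{uv}(H)\to E^r_{pq}(G\square H),\qquad [a]\otimes[b]\mapsto[\nabla(a\otimes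 b)].$$ **Theorem (Künneth theorem for the magnitude-path spectral sequence over a P.I.D.).** Let $R$ be a principal ideal domain, let $G$ and $H$ be directed graphs, and suppose that there is $s\ge1$ such that for each $0\le r<s$ every term $E^r_{pq}(G)$ is a flat $R$-module. Then for $1\le r<s$ and all $p,q$ the map $\nabla^r$ is an isomorphism $$\bigoplus_{\substack{m+u=p\\ n+v=q}}E^r_{mn}(G)\otimes E^r_{uv}(H)\xrightarrow{\ \cong\ }E^r_{pq}(G\square H),$$ while for all $p,q$ the map $\nabla^s$ fits into a short exact sequence $$0\to\bigoplus_{\substack{m+u=p\\ n+v=q}}E^s_{mn}(G)\otimes E^s_{uv}(H)\xrightarrow{\ \nabla^s\ }E^s_{pq}(G\square H)\to\bigoplus_{\substack{m+u=p\\ n+v=q}}\mathrm{Tor}_1^R\big(E^s_{mn}(G),E^s_{u-s+1,\,v+s-2}(H)\big)\to0$$ which is natural in $H$ and with respect to maps $G\to G'$ where $G'$ satisfies the same flatness property as $G$. -/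

import Mathlib

open TensorProduct DirectSum CategoryTheory

universe u

namespace MPSS

noncomputable section

section Graphs

variable {V W V' W' : Type*}

/-- `HasPath G n x y`: there is a directed path with exactly `n` edges from `x` to `y` in `G`. -/
inductive HasPath (G : Digraph V) : ℕ → V → V → Prop
  | nil (x : V) : HasPath G 0 x x
  | cons {n : ℕ} {x y z : V} (hxy : G.Adj x y) (hyz : HasPath G n y z) : HasPath G (n + 1) x z

/-- There is a directed path from `x` to `y`. -/
def Reachable (G : Digraph V) (x y : V) : Prop := ∃ n, HasPath G n x y

/-- The shortest path metric: the least number of edges of a directed path from `x` to `y`, and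
`⊤` if there is no such path. -/
def dist (G : Digraph V) (x y : V) : ℕ∞ := ⨅ (n : ℕ) (_ : HasPath G n x y), (n : ℕ∞)

/-- The length `d(x₀,x₁) + ⋯ + d(xₖ₋₁,xₖ)` of a tuple of vertices. -/
def len (G : Digraph V) : List V → ℕ∞
  | [] => 0
  | [_] => 0
  | x :: y :: l => dist G x y + len G (y :: l)

/-- Maps of directed graphs: an edge is sent to an edge or collapsed to a vertex. -/
structure GraphMap (G : Digraph V) (H : Digraph W) where
  toFun : V → W
  map_adj : ∀ x y, G.Adj x y → toFun x = toFun y ∨ H.Adj (toFun x) (toFun y)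

/-- The box product of directed graphs. -/
def box (G : Digraph V) (H : Digraph W) : Digraph (V × W) where
  Adj x y := (x.1 = y.1 ∧ H.Adj x.2 y.2) ∨ (x.2 = y.2 ∧ G.Adj x.1 y.1)

/-- The box product is functorial. -/
def GraphMap.box {G : Digraph V} {G' : Digraph V'} {H : Digraph W} {H' : Digraph W'}
    (f : GraphMap G G') (g : GraphMap H H') : GraphMap (MPSS.box G H) (MPSS.box G' H') where
  toFun x := (f.toFun x.1, g.toFun x.2)
  map_adj := by
    rintro ⟨x, y⟩ ⟨x', y'⟩ (⟨h, h'⟩ | ⟨h, h'⟩)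
    · have := g.map_adj _ _ h'
      simp only at h
      subst h
      simp only [MPSS.box, Prod.mk.injEq]
      tauto
    · have := f.map_adj _ _ h'
      simp only at h
      subst h
      simp only [MPSS.box, Prod.mk.injEq]
      tauto

theorem HasPath.map {G : Digraph V} {H : Digraph W} (f : GraphMap G H) {n : ℕ} {x y : V}
    (h : HasPath G n x y) : ∃ m ≤ n, HasPath H m (f.toFun x) (f.toFun y) := by
  induction h with
  | nil x => exact ⟨0, le_rfl, .nil _⟩
  | cons hxy _ ih =>
    obtain ⟨m, hm, h⟩ := ih
    rcases f.map_adj _ _ hxy with e | e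
    · exact ⟨m, by omega, e ▸ h⟩
    · exact ⟨m + 1, by omega, .cons e h⟩

theorem HasPath.trans {G : Digraph V} {n m : ℕ} {x y z : V}
    (h : HasPath G n x y) (h' : HasPath G m y z) : HasPath G (n + m) x z := by
  induction h with
  | nil x => simpa using h'
  | cons hxy _ ih => rw [Nat.add_right_comm]; exact .cons hxy (ih h')

theorem Reachable.trans {G : Digraph V} {x y z : V}
    (h : Reachable G x y) (h' : Reachable G y z) : Reachable G x z :=
  let ⟨_, a⟩ := h
  let ⟨_, b⟩ := h'
  ⟨_, a.trans b⟩

instance (G : Digraph V) : Trans (Reachable G) (Reachable G) (Reachable G) := ⟨Reachable.trans⟩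

theorem Reachable.map {G : Digraph V} {H : Digraph W} (f : GraphMap G H) {x y : V}
    (h : Reachable G x y) : Reachable H (f.toFun x) (f.toFun y) :=
  let ⟨_, a⟩ := h
  let ⟨m, _, b⟩ := a.map f
  ⟨m, b⟩

theorem dist_map_le {G : Digraph V} {H : Digraph W} (f : GraphMap G H) (x y : V) :
    dist H (f.toFun x) (f.toFun y) ≤ dist G x y := by
  refine le_iInf₂ fun n h => ?_
  obtain ⟨m, hm, h'⟩ := h.map f
  exact (iInf₂_le m h').trans (by exact_mod_cast hm)

theorem len_map_le {G : Digraph V} {H : Digraph W} (f : GraphMap G H) :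
    ∀ l : List V, len H (l.map f.toFun) ≤ len G l
  | [] => le_rfl
  | [_] => le_rfl
  | x :: y :: l => add_le_add (dist_map_le f x y) (len_map_le f (y :: l))

/-- The inclusion of a copy of `G` in the box product. -/
def inlMap (G : Digraph V) (H : Digraph W) (h : W) : GraphMap G (box G H) :=
  ⟨fun g => (g, h), fun _ _ e => .inr (.inr ⟨rfl, e⟩)⟩

/-- The inclusion of a copy of `H` in the box product. -/
def inrMap (G : Digraph V) (H : Digraph W) (g : V) : GraphMap H (box G H) :=
  ⟨fun h => (g, h), fun _ _ e => .inr (.inl ⟨rfl, e⟩)⟩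

end Graphs

section Tuples

variable (R : Type*) [CommRing R] {V W : Type*}

/-- The alternating sum of the faces of a tuple, as a formal combination of tuples. -/
def faces (l : List V) : List V →₀ R :=
  ∑ i ∈ Finset.range l.length, (-1 : R) ^ i • Finsupp.single (l.eraseIdx i) 1

/-- The signed sum over the lattice paths `σ` from `(0,0)` to `(k,k')`, in which each step increases
exactly one coordinate by `1`, of the tuples `((g_{i₀},h_{j₀}),…,(g_{iᵣ},h_{jᵣ}))` of vertices that
`σ` visits, where the sign is `(-1)ⁿ` for `n` the number of lattice points on or above the `x`-axis
and strictly below `σ`. It is computed by splitting off the first step; when that step goes up,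
precisely the points `(1,0),…,(k,0)` of the bottom row are strictly below the path. -/
def shuffle : List V → List W → (List (V × W) →₀ R)
  | [], _ => 0
  | _ :: _, [] => 0
  | [g], [h] => Finsupp.single [(g, h)] 1
  | g :: gs, h :: hs =>
    Finsupp.mapDomain (List.cons (g, h))
      (shuffle gs (h :: hs) + (-1 : R) ^ gs.length • shuffle (g :: gs) hs)
termination_by a b => a.length + b.length

variable {R}

/-- Prepending a vertex, extended linearly. -/
def consL (v : V) : (List V →₀ R) →ₗ[R] (List V →₀ R) := Finsupp.lmapDomain R R (List.cons v)

@[simp] theorem consL_single (v : V) (l : List V) (c : R) :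
    consL v (Finsupp.single l c) = Finsupp.single (v :: l) c := by
  simp [consL, Finsupp.mapDomain_single]

theorem faces_nil : faces R ([] : List V) = 0 := by simp [faces]

theorem faces_cons (v : V) (l : List V) :
    faces R (v :: l) = Finsupp.single l 1 - consL v (faces R l) := by
  simp only [faces, List.length_cons, Finset.sum_range_succ', map_sum, map_smul, consL_single]
  simp [pow_succ, Finset.sum_neg_distrib, sub_eq_add_neg, add_comm]

variable (R) in
/-- `faces`, extended linearly. -/
def facesL : (List V →₀ R) →ₗ[R] (List V →₀ R) := Finsupp.linearCombination R (faces R)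

@[simp] theorem facesL_single (l : List V) : facesL R (Finsupp.single l 1) = faces R l := by
  simp [facesL]

theorem facesL_consL (v : V) (x : List V →₀ R) :
    facesL R (consL v x) = x - consL v (facesL R x) := by
  have : (facesL R).comp (consL v) = LinearMap.id - (consL v).comp (facesL R) := by
    ext1 l
    ext1
    simp [faces_cons]
  exact LinearMap.congr_fun this x

theorem facesL_faces (l : List V) : facesL R (faces R l) = 0 := by
  induction l with
  | nil => simp [faces_nil]
  | cons v l ih => rw [faces_cons, map_sub, facesL_consL, ih]; simp

variable (R) in
/-- `shuffle`, extended bilinearly. -/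
def shuffleL : (List V →₀ R) →ₗ[R] (List W →₀ R) →ₗ[R] (List (V × W) →₀ R) :=
  Finsupp.linearCombination R fun a => Finsupp.linearCombination R (shuffle R a)

@[simp] theorem shuffleL_single (a : List V) (b : List W) :
    shuffleL R (Finsupp.single a 1) (Finsupp.single b 1) = shuffle R a b := by
  simp [shuffleL]

theorem shuffle_nil (a : List V) : shuffle R a ([] : List W) = 0 := by
  cases a <;> simp [shuffle]

theorem nil_shuffle (b : List W) : shuffle R ([] : List V) b = 0 := by
  simp [shuffle]

theorem shuffle_cons (g : V) (gs : List V) (h : W) (hs : List W) :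
    shuffle R (g :: gs) (h :: hs) = consL (g, h)
      ((if gs = [] ∧ hs = [] then Finsupp.single [] 1 else 0) +
        (shuffle R gs (h :: hs) + (-1 : R) ^ gs.length • shuffle R (g :: gs) hs)) := by
  cases gs with
  | nil =>
    cases hs with
    | nil => simp [shuffle]
    | cons h' hs => conv_lhs => rw [shuffle.eq_4 _ _ _ _ _ (by simp)]
                    simp [consL, nil_shuffle]
  | cons g' gs => rw [shuffle] <;> simp [consL]

theorem nil_shuffleL (y : List W →₀ R) :
    shuffleL R (Finsupp.single ([] : List V) 1) y = 0 := by
  have : shuffleL R (Finsupp.single ([] : List V) 1) = (0 : (List W →₀ R) →ₗ[R] _) := by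
    ext1 l
    ext1
    simp [nil_shuffle]
  rw [this, LinearMap.zero_apply]

theorem shuffleL_nil (x : List V →₀ R) :
    shuffleL R x (Finsupp.single ([] : List W) 1) = 0 := by
  have : (shuffleL R).flip (Finsupp.single ([] : List W) 1) = (0 : (List V →₀ R) →ₗ[R] _) := by
    ext1 l
    ext1
    simp [shuffle_nil]
  exact LinearMap.congr_fun this x

theorem shuffleL_consL_left (g : V) (h : W) (n : ℕ) (hs : List W) (x : List V →₀ R)
    (hx : x ∈ Finsupp.supported R R {l : List V | l.length = n}) :
    shuffleL R (consL g x) (Finsupp.single (h :: hs) 1) = consL (g, h)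
      ((if hs = [] then Finsupp.single [] (x []) else 0) +
      (shuffleL R x (Finsupp.single (h :: hs) 1) +
        (-1 : R) ^ n • shuffleL R (consL g x) (Finsupp.single hs 1))) := by
  rw [Finsupp.supported_eq_span_single] at hx
  induction hx using Submodule.span_induction with
  | mem x hx =>
    obtain ⟨l, hl, rfl⟩ := hx
    have hl : l.length = n := hl
    simp only [consL_single, shuffleL_single, shuffle_cons,
      hl, Finsupp.single_apply]
    congr 2
    split_ifs <;> simp_all
  | zero => simp
  | add x y _ _ hx hy =>
    simp only [map_add, LinearMap.add_apply, hx, hy, smul_add, Finsupp.add_apply]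
    split_ifs <;> simp only [Finsupp.single_add, map_add, map_zero] <;> abel
  | smul c x _ hx =>
    simp only [map_smul, LinearMap.smul_apply, hx, map_add, smul_add, smul_comm c,
      Finsupp.smul_apply]
    split_ifs <;> simp only [← Finsupp.smul_single, map_smul, map_zero, smul_zero]

theorem shuffleL_consL_right (g : V) (h : W) (gs : List V) (x : List W →₀ R) :
    shuffleL R (Finsupp.single (g :: gs) 1) (consL h x) = consL (g, h)
      ((if gs = [] then Finsupp.single [] (x []) else 0) +
      (shuffleL R (Finsupp.single gs 1) (consL h x) +
        (-1 : R) ^ gs.length • shuffleL R (Finsupp.single (g :: gs) 1) x)) := by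
  have hx : x ∈ Finsupp.supported R R (Set.univ : Set (List W)) := by simp
  rw [Finsupp.supported_eq_span_single] at hx
  induction hx using Submodule.span_induction with
  | mem x hx =>
    obtain ⟨l, -, rfl⟩ := hx
    simp only [consL_single, shuffleL_single, shuffle_cons, Finsupp.single_apply]
    congr 2
    split_ifs <;> simp_all
  | zero => simp
  | add x y _ _ hx hy =>
    simp only [map_add, hx, hy, smul_add, Finsupp.add_apply]
    split_ifs <;> simp only [Finsupp.single_add, map_add, map_zero] <;> abel
  | smul c x _ hx =>
    simp only [map_smul, hx, map_add, smul_add, smul_comm c, Finsupp.smul_apply]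
    split_ifs <;> simp only [← Finsupp.smul_single, map_smul, map_zero, smul_zero]

theorem faces_apply_nil (v : V) (l : List V) :
    faces R (v :: l) [] = if l = [] then 1 else 0 := by
  rw [faces_cons, Finsupp.sub_apply, consL, Finsupp.lmapDomain_apply,
    Finsupp.mapDomain_of_notMem_range,
    sub_zero, Finsupp.single_apply]
  simp

theorem faces_mem_length (l : List V) :
    faces R l ∈ Finsupp.supported R R {l' : List V | l'.length + 1 = l.length} := by
  refine Submodule.sum_mem _ fun i hi => Submodule.smul_mem _ _ (Finsupp.single_mem_supported _ _ ?_)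
  have := Finset.mem_range.1 hi
  simp [List.length_eraseIdx, this]
  omega

theorem faces_shuffle : ∀ (a : List V) (b : List W), a ≠ [] → b ≠ [] →
    facesL R (shuffle R a b) = shuffleL R (faces R a) (Finsupp.single b 1) +
      (-1 : R) ^ (a.length + 1) • shuffleL R (Finsupp.single a 1) (faces R b) +
        (if a.length = 1 ∧ b.length = 1 then Finsupp.single [] 1 else 0)
  | [], _, h, _ => absurd rfl h
  | _, [], _, h => absurd rfl h
  | [g], [h], _, _ => by
    simp [shuffle, faces_cons, faces_nil, nil_shuffle, shuffle_nil]
  | [g], h :: h' :: hs, _, _ => by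
    have ih := faces_shuffle [g] (h' :: hs) (by simp) (by simp)
    rw [shuffle_cons, faces_cons h]
    simp only [facesL_consL, map_sub, shuffleL_consL_right, faces_apply_nil]
    simp only [nil_shuffle, reduceCtorEq, and_false, if_false, zero_add, List.length_nil, pow_zero,
      one_smul, ih, nil_shuffleL]
    simp only [faces_cons g, faces_nil, map_zero, sub_zero, shuffleL_single, nil_shuffle]
    by_cases hh : hs = [] <;> simp [hh, add_comm]
  | g :: g' :: gs, [h], _, _ => by
    have ih := faces_shuffle (g' :: gs) [h] (by simp) (by simp)
    rw [shuffle_cons, faces_cons g]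
    simp only [facesL_consL, map_sub, LinearMap.sub_apply,
      shuffleL_consL_left g h gs.length _ _ (by simpa using faces_mem_length (R := R) (g' :: gs)),
      faces_apply_nil]
    simp only [shuffle_nil, reduceCtorEq, false_and, if_false, zero_add, smul_zero, add_zero,
      ih, shuffleL_nil]
    simp only [faces_cons h, faces_nil, map_zero, sub_zero, shuffleL_single, shuffle_nil]
    by_cases hh : gs = [] <;> simp [hh, add_comm]
  | g :: g' :: gs, h :: h' :: hs, _, _ => by
    have ih := faces_shuffle (g' :: gs) (h :: h' :: hs) (by simp) (by simp)
    have ih' := faces_shuffle (g :: g' :: gs) (h' :: hs) (by simp) (by simp)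
    rw [shuffle_cons, faces_cons g, faces_cons h]
    rw [faces_cons h] at ih
    rw [faces_cons g] at ih'
    simp only [facesL_consL, map_sub, LinearMap.sub_apply, shuffleL_consL_right g h (g' :: gs),
      shuffleL_consL_left g h gs.length _ _ (by simpa using faces_mem_length (R := R) (g' :: gs))]
    simp only [reduceCtorEq, false_and, and_false, if_false, zero_add, map_add, map_smul, ih, ih',
      map_sub, LinearMap.sub_apply, List.length_cons, Nat.add_eq_right, add_zero,
      shuffleL_single, pow_succ, smul_add, smul_sub, smul_smul]
    have e : ((-1 : R) ^ gs.length) * (-1 : R) ^ gs.length = 1 := by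
      rw [← mul_pow]; simp
    simp only [mul_neg, mul_one, neg_mul, neg_neg, e, one_smul, neg_smul]
    generalize shuffle R (g' :: gs) (h :: h' :: hs) = x₁
    generalize (-1 : R) ^ gs.length • shuffle R (g :: g' :: gs) (h' :: hs) = x₂
    generalize consL (g, h) (shuffleL R (faces R (g' :: gs)) (Finsupp.single (h :: h' :: hs) 1)) = x₃
    generalize (-1 : R) ^ gs.length • consL (g, h) (shuffle R (g' :: gs) (h' :: hs)) = x₄
    generalize (-1 : R) ^ gs.length • consL (g, h)
      (shuffleL R (Finsupp.single (g' :: gs) 1) (consL h (faces R (h' :: hs)))) = x₅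
    generalize (-1 : R) ^ gs.length • consL (g, h)
      (shuffleL R (consL g (faces R (g' :: gs))) (Finsupp.single (h' :: hs) 1)) = x₆
    generalize consL (g, h)
      (shuffleL R (Finsupp.single (g :: g' :: gs) 1) (faces R (h' :: hs))) = x₇
    abel
termination_by a b => a.length + b.length

end Tuples

section Subquotient

variable {R M N P : Type*} [CommRing R] [AddCommGroup M] [Module R M] [AddCommGroup N] [Module R N]
  [AddCommGroup P] [Module R P]

/-- The quotient `A / (A ∩ B)` of a submodule `A` by a submodule `B` (below, `B ≤ A`). -/
def Subquot (A B : Submodule R M) := A ⧸ B.submoduleOf A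

instance (A B : Submodule R M) : AddCommGroup (Subquot A B) :=
  inferInstanceAs (AddCommGroup (A ⧸ B.submoduleOf A))

instance (A B : Submodule R M) : Module R (Subquot A B) :=
  inferInstanceAs (Module R (A ⧸ B.submoduleOf A))

/-- The class of an element of `A`. -/
def Subquot.mk (A B : Submodule R M) : A →ₗ[R] Subquot A B := (B.submoduleOf A).mkQ

/-- The map of subquotients induced by a linear map: `[a] ↦ [f a]`. -/
def Subquot.map {A B : Submodule R M} {A' B' : Submodule R N} (f : M →ₗ[R] N)
    (hA : ∀ a ∈ A, f a ∈ A') (hB : ∀ b ∈ B, f b ∈ B') : Subquot A B →ₗ[R] Subquot A' B' :=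
  Submodule.mapQ _ _ (f.restrict hA) fun b hb => hB b hb

/-- The bilinear map of subquotients induced by a bilinear map: `([a], [a']) ↦ [f a a']`. -/
def Subquot.map₂ {A B : Submodule R M} {A' B' : Submodule R N} {A'' B'' : Submodule R P}
    (f : M →ₗ[R] N →ₗ[R] P) (hA : ∀ a ∈ A, ∀ a' ∈ A', f a a' ∈ A'')
    (hB : ∀ b ∈ A, b ∈ B → ∀ a' ∈ A', f b a' ∈ B'')
    (hB' : ∀ a ∈ A, ∀ b' ∈ A', b' ∈ B' → f a b' ∈ B'') :
    Subquot A B →ₗ[R] Subquot A' B' →ₗ[R] Subquot A'' B'' :=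
  let μ : A →ₗ[R] A' →ₗ[R] Subquot A'' B'' :=
    LinearMap.mk₂ R (fun a a' => Subquot.mk A'' B'' ⟨f a a', hA a a.2 a' a'.2⟩)
      (fun a b c => by rw [← map_add]; congr 1; ext1; simp)
      (fun r a b => by rw [← map_smul]; congr 1; ext1; simp)
      (fun a b c => by rw [← map_add]; congr 1; ext1; simp)
      (fun r a b => by rw [← map_smul]; congr 1; ext1; simp)
  let ν : Subquot A B →ₗ[R] A' →ₗ[R] Subquot A'' B'' :=
    (B.submoduleOf A).liftQ μ fun b hb => LinearMap.ext fun a' =>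
      (Submodule.Quotient.mk_eq_zero _).2 (hB b b.2 hb a' a'.2)
  LinearMap.flip ((B'.submoduleOf A').liftQ ν.flip fun b' hb' => LinearMap.ext fun x =>
    Submodule.Quotient.induction_on _ x fun a =>
      (Submodule.Quotient.mk_eq_zero _).2 (hB' a a.2 b' b'.2 hb'))

theorem Subquot.map_mk {A B : Submodule R M} {A' B' : Submodule R N} (f : M →ₗ[R] N)
    (hA : ∀ a ∈ A, f a ∈ A') (hB : ∀ b ∈ B, f b ∈ B') (a : A) :
    Subquot.map f hA hB (Subquot.mk A B a) = Subquot.mk A' B' ⟨f a, hA a a.2⟩ := rfl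

theorem Subquot.map₂_mk {A B : Submodule R M} {A' B' : Submodule R N} {A'' B'' : Submodule R P}
    (f : M →ₗ[R] N →ₗ[R] P) (hA : ∀ a ∈ A, ∀ a' ∈ A', f a a' ∈ A'')
    (hB : ∀ b ∈ A, b ∈ B → ∀ a' ∈ A', f b a' ∈ B'')
    (hB' : ∀ a ∈ A, ∀ b' ∈ A', b' ∈ B' → f a b' ∈ B'') (a : A) (a' : A') :
    Subquot.map₂ f hA hB hB' (Subquot.mk A B a) (Subquot.mk A' B' a') =
      Subquot.mk A'' B'' ⟨f a a', hA a a.2 a' a'.2⟩ := rfl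

end Subquotient

section Chains

variable (R : Type*) [CommRing R] {V W V' W' : Type*}

/-- The generators of the reachability chains: the (non-empty) tuples `(x₀,…,xₖ)` of vertices in
which consecutive entries are distinct and there is a directed path from each entry to the next. -/
def IsGen (G : Digraph V) (l : List V) : Prop :=
  l ≠ [] ∧ l.IsChain fun x y => x ≠ y ∧ Reachable G x y

/-- The generators, in all degrees; a generator `(x₀,…,xₖ)` has degree `k`. -/
abbrev Gen (G : Digraph V) := {l : List V // IsGen G l}

/-- The reachability chains, as the direct sum over all degrees. -/
abbrev RC (G : Digraph V) := Gen G →₀ R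

open Classical in
/-- The basis element of a tuple, and `0` for a tuple that is not a generator. -/
def gen (G : Digraph V) (l : List V) : RC R G :=
  if h : IsGen G l then Finsupp.single ⟨l, h⟩ 1 else 0

/-- Omits, from a formal combination of tuples, the tuples that are not generators. -/
def proj (G : Digraph V) : (List V →₀ R) →ₗ[R] RC R G := Finsupp.linearCombination R (gen R G)

/-- The differential `∂(x₀,…,xₖ) = ∑ᵢ (-1)ⁱ (x₀,…,x̂ᵢ,…,xₖ)`, where terms with repeated consecutive
entries are omitted (and `∂ = 0` in degree `0`). -/
def bd (G : Digraph V) : RC R G →ₗ[R] RC R G :=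
  Finsupp.linearCombination R fun x => proj R G (faces R x.1)

/-- The map of reachability chains induced by a map of graphs. -/
def GraphMap.chain {G : Digraph V} {H : Digraph W} (f : GraphMap G H) : RC R G →ₗ[R] RC R H :=
  Finsupp.linearCombination R fun x => gen R H (x.1.map f.toFun)

/-- The Eilenberg–Zilber map `∇ : RC(G) ⊗ RC(H) → RC(G □ H)`, as a bilinear map. -/
def cross (G : Digraph V) (H : Digraph W) : RC R G →ₗ[R] RC R H →ₗ[R] RC R (box G H) :=
  Finsupp.linearCombination R fun x =>
    Finsupp.linearCombination R fun y => proj R (box G H) (shuffle R x.1 y.1)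

/-- The length filtration `F_p RC(G)`, spanned by the generators of length at most `p`. -/
def filt (G : Digraph V) (p : ℤ) : Submodule R (RC R G) :=
  Finsupp.supported R R {x | ∃ k : ℕ, len G x.1 ≤ k ∧ (k : ℤ) ≤ p}

/-- The part `RC_n(G)` of degree `n`, spanned by the tuples `(x₀,…,xₙ)`. -/
def degPart (G : Digraph V) (n : ℤ) : Submodule R (RC R G) :=
  Finsupp.supported R R {x | (x.1.length : ℤ) = n + 1}

/-- `A^r_{pq} = {c ∈ F_p RC_{p+q} : ∂c ∈ F_{p-r}}`. -/
def A (G : Digraph V) (r p q : ℤ) : Submodule R (RC R G) :=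
  filt R G p ⊓ degPart R G (p + q) ⊓ (filt R G (p - r)).comap (bd R G)

/-- `A^{r-1}_{p-1,q+1} + ∂ A^{r-1}_{p+r-1,q-r+2}`. -/
def B (G : Digraph V) (r p q : ℤ) : Submodule R (RC R G) :=
  A R G (r - 1) (p - 1) (q + 1) ⊔ (A R G (r - 1) (p + r - 1) (q - r + 2)).map (bd R G)

/-- The term `E^r_{pq}(G)` of the magnitude-path spectral sequence, the spectral sequence of the
filtered complex `RC(G)`:
`E^r_{pq} = A^r_{pq} / (A^{r-1}_{p-1,q+1} + ∂ A^{r-1}_{p+r-1,q-r+2})`. -/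
abbrev E (G : Digraph V) (r : ℕ) (p q : ℤ) := Subquot (A R G r p q) (B R G r p q)

variable {R}

theorem eq_of_supported {α M : Type*} [AddCommGroup M] [Module R M] {S : Set α}
    {f g : (α →₀ R) →ₗ[R] M} (h : ∀ a ∈ S, f (Finsupp.single a 1) = g (Finsupp.single a 1))
    {x : α →₀ R} (hx : x ∈ Finsupp.supported R R S) : f x = g x := by
  rw [Finsupp.supported_eq_span_single] at hx
  refine LinearMap.eqOn_span (f := f) (g := g) ?_ hx
  rintro _ ⟨a, ha, rfl⟩
  exact h a ha

theorem mem_of_supported {α M : Type*} [AddCommGroup M] [Module R M] {S : Set α}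
    {f : (α →₀ R) →ₗ[R] M} {P : Submodule R M} (h : ∀ a ∈ S, f (Finsupp.single a 1) ∈ P)
    {x : α →₀ R} (hx : x ∈ Finsupp.supported R R S) : f x ∈ P := by
  rw [Finsupp.supported_eq_span_single] at hx
  refine (Submodule.span_le (p := P.comap f)).2 ?_ hx
  rintro _ ⟨a, ha, rfl⟩
  exact h a ha

theorem gen_of {G : Digraph V} {l : List V} (h : IsGen G l) :
    gen R G l = Finsupp.single ⟨l, h⟩ 1 := dif_pos h

theorem gen_coe {G : Digraph V} (x : Gen G) : gen R G x.1 = Finsupp.single x 1 := gen_of x.2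

theorem gen_nil (G : Digraph V) : gen R G [] = 0 := dif_neg fun h => h.1 rfl

theorem gen_degenerate (G : Digraph V) {l : List V} (h : ¬ l.IsChain (· ≠ ·)) : gen R G l = 0 :=
  dif_neg fun h' => h (h'.2.imp fun _ _ => And.left)

@[simp] theorem proj_single (G : Digraph V) (l : List V) :
    proj R G (Finsupp.single l 1) = gen R G l := by simp [proj]

@[simp] theorem bd_single (G : Digraph V) (x : Gen G) :
    bd R G (Finsupp.single x 1) = proj R G (faces R x.1) := by simp [bd]

@[simp] theorem chain_single {G : Digraph V} {H : Digraph W} (f : GraphMap G H) (x : Gen G) :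
    f.chain R (Finsupp.single x 1) = gen R H (x.1.map f.toFun) := by simp [GraphMap.chain]

@[simp] theorem cross_single (G : Digraph V) (H : Digraph W) (x : Gen G) (y : Gen H) :
    cross R G H (Finsupp.single x 1) (Finsupp.single y 1) =
      proj R (box G H) (shuffle R x.1 y.1) := by simp [cross]

theorem proj_degenerate (G : Digraph V) {x : List V →₀ R}
    (hx : x ∈ Finsupp.supported R R {l | ¬ l.IsChain (· ≠ ·)}) : proj R G x = 0 :=
  eq_of_supported (g := 0) (fun l hl => by simp [gen_degenerate G hl]) hx

theorem not_isChain_cons (v : V) {l : List V} (h : ¬ l.IsChain (· ≠ ·)) :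
    ¬ (v :: l).IsChain (· ≠ ·) := fun h' => h h'.tail

theorem consL_degenerate (v : V) {x : List V →₀ R}
    (hx : x ∈ Finsupp.supported R R {l | ¬ l.IsChain (· ≠ ·)}) :
    consL v x ∈ Finsupp.supported R R {l | ¬ l.IsChain (· ≠ ·)} :=
  mem_of_supported (fun l hl => by
    rw [consL_single]
    exact Finsupp.single_mem_supported _ _ (not_isChain_cons v hl)) hx

theorem consL_head_degenerate (v : V) {x : List V →₀ R}
    (hx : x ∈ Finsupp.supported R R {l | ∃ l', l = v :: l'}) :
    consL v x ∈ Finsupp.supported R R {l | ¬ l.IsChain (· ≠ ·)} :=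
  mem_of_supported (fun l hl => by
    obtain ⟨l', rfl⟩ := hl
    rw [consL_single]
    exact Finsupp.single_mem_supported _ _ (by simp)) hx

theorem faces_degenerate : ∀ l : List V, ¬ l.IsChain (· ≠ ·) →
    faces R l ∈ Finsupp.supported R R {l : List V | ¬ l.IsChain (· ≠ ·)}
  | [], h => absurd .nil h
  | [_], h => absurd (.singleton _) h
  | x :: y :: l, h => by
    by_cases h' : (y :: l).IsChain (· ≠ ·)
    · have e : x = y := by
        by_contra hxy
        exact h (.cons_cons hxy h')
      subst e
      rw [faces_cons, faces_cons, map_sub, consL_single, sub_sub_cancel]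
      refine consL_head_degenerate x ?_
      refine mem_of_supported (S := Set.univ) (fun l _ => ?_) (by simp)
      rw [consL_single]
      exact Finsupp.single_mem_supported _ _ ⟨l, rfl⟩
    · rw [faces_cons]
      exact Submodule.sub_mem _ (Finsupp.single_mem_supported _ _ h')
        (consL_degenerate x (faces_degenerate _ h'))

/-- The tuples with a path from each entry to the next. -/
def reachSet (G : Digraph V) : Set (List V) := {l | l.IsChain (Reachable G)}

theorem Gen.mem_reachSet {G : Digraph V} (x : Gen G) : x.1 ∈ reachSet G :=
  x.2.2.imp fun _ _ => And.right

theorem isGen_or {G : Digraph V} {l : List V} (h : l ∈ reachSet G) :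
    IsGen G l ∨ l = [] ∨ ¬ l.IsChain (· ≠ ·) := by
  by_cases h₁ : l = []
  · exact .inr (.inl h₁)
  · by_cases h₂ : l.IsChain (· ≠ ·)
    · refine .inl ⟨h₁, ?_⟩
      rw [List.isChain_iff_getElem]
      intro i hi
      exact ⟨List.isChain_iff_getElem.1 h₂ i hi, List.isChain_iff_getElem.1 h i hi⟩
    · exact .inr (.inr h₂)

theorem faces_mem_reach {G : Digraph V} {l : List V} (h : l ∈ reachSet G) :
    faces R l ∈ Finsupp.supported R R (reachSet G) :=
  Submodule.sum_mem _ fun i _ => Submodule.smul_mem _ _ (Finsupp.single_mem_supported _ _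
    (List.IsChain.sublist h (List.eraseIdx_sublist l i)))

theorem bd_proj (G : Digraph V) {x : List V →₀ R}
    (hx : x ∈ Finsupp.supported R R (reachSet G)) :
    bd R G (proj R G x) = proj R G (facesL R x) := by
  refine eq_of_supported (f := (bd R G).comp (proj R G)) (g := (proj R G).comp (facesL R))
    (fun l hl => ?_) hx
  simp only [LinearMap.comp_apply, proj_single, facesL_single]
  rcases isGen_or hl with h | rfl | h
  · rw [gen_of h, bd_single]
  · simp [gen_nil, faces_nil]
  · rw [gen_degenerate G h, proj_degenerate G (faces_degenerate l h), map_zero]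

theorem bd_bd (G : Digraph V) (c : RC R G) : bd R G (bd R G c) = 0 := by
  refine eq_of_supported (S := Set.univ) (f := (bd R G).comp (bd R G)) (g := 0)
    (fun x _ => ?_) (by simp)
  simp only [LinearMap.comp_apply, bd_single, LinearMap.zero_apply]
  rw [bd_proj G (faces_mem_reach x.mem_reachSet), facesL_faces, map_zero]

theorem faces_map (f : V → W) (l : List V) :
    faces R (l.map f) = Finsupp.lmapDomain R R (List.map f) (faces R l) := by
  simp [faces, Finsupp.mapDomain_single, List.eraseIdx_map]

theorem map_mem_reachSet {G : Digraph V} {H : Digraph W} (f : GraphMap G H) {l : List V}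
    (h : l ∈ reachSet G) : l.map f.toFun ∈ reachSet H :=
  List.isChain_map_of_isChain f.toFun (fun _ _ => Reachable.map f) h

theorem chain_proj {G : Digraph V} {H : Digraph W} (f : GraphMap G H) {x : List V →₀ R}
    (hx : x ∈ Finsupp.supported R R (reachSet G)) :
    f.chain R (proj R G x) = proj R H (Finsupp.lmapDomain R R (List.map f.toFun) x) := by
  refine eq_of_supported (f := (f.chain R).comp (proj R G))
    (g := (proj R H).comp (Finsupp.lmapDomain R R (List.map f.toFun))) (fun l hl => ?_) hx
  simp only [LinearMap.comp_apply, proj_single, Finsupp.lmapDomain_apply, Finsupp.mapDomain_single]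
  rcases isGen_or hl with h | rfl | h
  · rw [gen_of h, chain_single]
  · simp [gen_nil]
  · rw [gen_degenerate G h, gen_degenerate H, map_zero]
    exact fun h' => h (List.isChain_of_isChain_map _ (fun a b => mt (congrArg f.toFun)) h')

theorem bd_chain {G : Digraph V} {H : Digraph W} (f : GraphMap G H) (c : RC R G) :
    bd R H (f.chain R c) = f.chain R (bd R G c) := by
  refine eq_of_supported (S := Set.univ) (f := (bd R H).comp (f.chain R))
    (g := (f.chain R).comp (bd R G)) (fun x _ => ?_) (by simp)
  simp only [LinearMap.comp_apply, bd_single, chain_single]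
  rw [chain_proj f (faces_mem_reach x.mem_reachSet), ← faces_map, ← proj_single, bd_proj,
    facesL_single]
  exact Finsupp.single_mem_supported _ _ (map_mem_reachSet f x.mem_reachSet)

theorem gen_mem_filt {G : Digraph V} {l : List V} {p : ℤ} {k : ℕ} (h : len G l ≤ k)
    (hk : (k : ℤ) ≤ p) : gen R G l ∈ filt R G p := by
  by_cases hl : IsGen G l
  · rw [gen_of hl]
    exact Finsupp.single_mem_supported _ _ ⟨k, h, hk⟩
  · rw [gen, dif_neg hl]
    exact Submodule.zero_mem _

theorem gen_mem_degPart {G : Digraph V} {l : List V} {n : ℤ} (h : (l.length : ℤ) = n + 1) :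
    gen R G l ∈ degPart R G n := by
  by_cases hl : IsGen G l
  · rw [gen_of hl]
    exact Finsupp.single_mem_supported _ _ h
  · rw [gen, dif_neg hl]
    exact Submodule.zero_mem _

theorem chain_mem_filt {G : Digraph V} {H : Digraph W} (f : GraphMap G H) {p : ℤ} {c : RC R G}
    (hc : c ∈ filt R G p) : f.chain R c ∈ filt R H p :=
  mem_of_supported (fun x hx => by
    obtain ⟨k, h, hk⟩ := hx
    rw [chain_single]
    exact gen_mem_filt ((len_map_le f _).trans h) hk) hc

theorem chain_mem_degPart {G : Digraph V} {H : Digraph W} (f : GraphMap G H) {n : ℤ} {c : RC R G}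
    (hc : c ∈ degPart R G n) : f.chain R c ∈ degPart R H n :=
  mem_of_supported (fun x hx => by
    rw [chain_single]
    exact gen_mem_degPart (by simpa using hx)) hc

theorem chain_mem_A {G : Digraph V} {H : Digraph W} (f : GraphMap G H) {r p q : ℤ} {c : RC R G}
    (hc : c ∈ A R G r p q) : f.chain R c ∈ A R H r p q :=
  ⟨⟨chain_mem_filt f hc.1.1, chain_mem_degPart f hc.1.2⟩, by
    change bd R H (f.chain R c) ∈ filt R H (p - r)
    rw [bd_chain]
    exact chain_mem_filt f hc.2⟩

theorem chain_mem_B {G : Digraph V} {H : Digraph W} (f : GraphMap G H) {r p q : ℤ} {c : RC R G}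
    (hc : c ∈ B R G r p q) : f.chain R c ∈ B R H r p q := by
  obtain ⟨a, ha, _, ⟨b, hb, rfl⟩, rfl⟩ := Submodule.mem_sup.1 hc
  rw [map_add, ← bd_chain]
  exact Submodule.add_mem_sup (chain_mem_A f ha) ⟨_, chain_mem_A f hb, rfl⟩

variable (R) in
/-- The map `E^r_{pq}(G) → E^r_{pq}(H)` induced by a map of graphs. -/
def GraphMap.page {G : Digraph V} {H : Digraph W} (f : GraphMap G H) (r : ℕ) (p q : ℤ) :
    E R G r p q →ₗ[R] E R H r p q :=
  Subquot.map (f.chain R) (fun _ => chain_mem_A f) fun _ => chain_mem_B f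

theorem bd_mem_degPart {G : Digraph V} {n : ℤ} {c : RC R G} (hc : c ∈ degPart R G n) :
    bd R G c ∈ degPart R G (n - 1) :=
  mem_of_supported (fun x hx => by
    have hx : (x.1.length : ℤ) = n + 1 := hx
    rw [bd_single]
    refine mem_of_supported (fun l hl => ?_) (faces_mem_length x.1)
    rw [proj_single]
    have hl : l.length + 1 = x.1.length := hl
    exact gen_mem_degPart (by omega)) hc

theorem shuffle_mem (G : Digraph V) (H : Digraph W) : ∀ (g : V) (gs : List V) (h : W) (hs : List W),
    g :: gs ∈ reachSet G → h :: hs ∈ reachSet H →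
    shuffle R (g :: gs) (h :: hs) ∈ Finsupp.supported R R {l | ∃ l', l = (g, h) :: l' ∧
      l ∈ reachSet (box G H) ∧ len (box G H) l ≤ len G (g :: gs) + len H (h :: hs) ∧
      l'.length = gs.length + hs.length}
  | g, [], h, [], _, _ => by
    rw [shuffle]
    exact Finsupp.single_mem_supported _ _ ⟨[], rfl, .singleton _, by simp [len], rfl⟩
  | g, [], h, h' :: hs, hg, hh => by
    have ih := shuffle_mem G H g [] h' hs hg (List.IsChain.tail hh)
    rw [shuffle_cons, nil_shuffle, zero_add, if_neg (by simp), zero_add, List.length_nil, pow_zero,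
      one_smul]
    refine mem_of_supported (fun l hl => ?_) ih
    obtain ⟨l', rfl, h₁, h₂, h₃⟩ := hl
    rw [consL_single]
    refine Finsupp.single_mem_supported _ _ ⟨_, rfl, ?_, ?_, ?_⟩
    · exact .cons_cons ((List.isChain_cons_cons.1 hh).1.map (inrMap G H g)) h₁
    · have := dist_map_le (inrMap G H g) h h'
      rw [len, len.eq_3 H, add_left_comm]
      exact add_le_add this h₂
    · simp only [List.length_cons, List.length_nil, h₃]; omega
  | g, g' :: gs, h, [], hg, hh => by
    have ih := shuffle_mem G H g' gs h [] (List.IsChain.tail hg) hh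
    rw [shuffle_cons, shuffle_nil, smul_zero, add_zero, if_neg (by simp), zero_add]
    refine mem_of_supported (fun l hl => ?_) ih
    obtain ⟨l', rfl, h₁, h₂, h₃⟩ := hl
    rw [consL_single]
    refine Finsupp.single_mem_supported _ _ ⟨_, rfl, ?_, ?_, ?_⟩
    · exact .cons_cons ((List.isChain_cons_cons.1 hg).1.map (inlMap G H h)) h₁
    · have := dist_map_le (inlMap G H h) g g'
      simp only [len]
      rw [add_assoc]
      exact add_le_add this h₂
    · simp only [List.length_cons, h₃]; omega
  | g, g' :: gs, h, h' :: hs, hg, hh => by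
    have ih := shuffle_mem G H g' gs h (h' :: hs) (List.IsChain.tail hg) hh
    have ih' := shuffle_mem G H g (g' :: gs) h' hs hg (List.IsChain.tail hh)
    rw [shuffle_cons, if_neg (by simp), zero_add, map_add, map_smul]
    refine Submodule.add_mem _ ?_ (Submodule.smul_mem _ _ ?_)
    · refine mem_of_supported (fun l hl => ?_) ih
      obtain ⟨l', rfl, h₁, h₂, h₃⟩ := hl
      rw [consL_single]
      refine Finsupp.single_mem_supported _ _ ⟨_, rfl, ?_, ?_, ?_⟩
      · exact .cons_cons ((List.isChain_cons_cons.1 hg).1.map (inlMap G H h)) h₁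
      · have := dist_map_le (inlMap G H h) g g'
        rw [len, len, add_assoc]
        exact add_le_add this h₂
      · simp only [List.length_cons, h₃]; omega
    · refine mem_of_supported (fun l hl => ?_) ih'
      obtain ⟨l', rfl, h₁, h₂, h₃⟩ := hl
      rw [consL_single]
      refine Finsupp.single_mem_supported _ _ ⟨_, rfl, ?_, ?_, ?_⟩
      · exact .cons_cons ((List.isChain_cons_cons.1 hh).1.map (inrMap G H g)) h₁
      · have := dist_map_le (inrMap G H g) h h'
        rw [len, len.eq_3 H, add_left_comm]
        exact add_le_add this h₂
      · simp only [List.length_cons, h₃]; omega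
termination_by _ gs _ hs => gs.length + hs.length

theorem shuffle_head : ∀ (g : V) (gs : List V) (h : W) (hs : List W),
    shuffle R (g :: gs) (h :: hs) ∈ Finsupp.supported R R {l | ∃ l', l = (g, h) :: l'} := by
  intro g gs h hs
  rw [shuffle_cons]
  refine mem_of_supported (S := Set.univ) (fun l _ => ?_) (by simp)
  rw [consL_single]
  exact Finsupp.single_mem_supported _ _ ⟨_, rfl⟩

theorem shuffle_degenerate : ∀ (a : List V) (b : List W),
    (¬ a.IsChain (· ≠ ·) ∨ ¬ b.IsChain (· ≠ ·)) →
    shuffle R a b ∈ Finsupp.supported R R {l | ¬ l.IsChain (· ≠ ·)}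
  | [], b, _ => by rw [nil_shuffle]; exact Submodule.zero_mem _
  | a, [], _ => by rw [shuffle_nil]; exact Submodule.zero_mem _
  | g :: gs, h :: hs, hd => by
    have h₀ : ¬ (gs = [] ∧ hs = []) := by
      rintro ⟨rfl, rfl⟩
      simp at hd
    rw [shuffle_cons, if_neg h₀, zero_add, map_add, map_smul]
    refine Submodule.add_mem _ ?_ (Submodule.smul_mem _ _ ?_)
    · by_cases hg : ¬ gs.IsChain (· ≠ ·) ∨ ¬ (h :: hs).IsChain (· ≠ ·)
      · exact consL_degenerate _ (shuffle_degenerate gs (h :: hs) hg)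
      · rcases gs with _ | ⟨g', gs⟩
        · simp [nil_shuffle]
        · have e : g = g' := by
            by_contra hne
            simp_all
          subst e
          exact consL_head_degenerate _ (shuffle_head _ _ _ _)
    · by_cases hg : ¬ (g :: gs).IsChain (· ≠ ·) ∨ ¬ hs.IsChain (· ≠ ·)
      · exact consL_degenerate _ (shuffle_degenerate (g :: gs) hs hg)
      · rcases hs with _ | ⟨h', hs⟩
        · simp [shuffle_nil]
        · have e : h = h' := by
            by_contra hne
            simp_all
          subst e
          exact consL_head_degenerate _ (shuffle_head _ _ _ _)
termination_by a b => a.length + b.length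

theorem shuffle_mem_reach {G : Digraph V} {H : Digraph W} {a : List V} {b : List W}
    (ha : a ∈ reachSet G) (hb : b ∈ reachSet H) :
    shuffle R a b ∈ Finsupp.supported R R {l | l ∈ reachSet (box G H) ∧
      len (box G H) l ≤ len G a + len H b ∧ l.length + 1 = a.length + b.length} := by
  rcases a with _ | ⟨g, gs⟩
  · rw [nil_shuffle]; exact Submodule.zero_mem _
  rcases b with _ | ⟨h, hs⟩
  · rw [shuffle_nil]; exact Submodule.zero_mem _
  refine Finsupp.supported_mono ?_ (shuffle_mem G H g gs h hs ha hb)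
  rintro _ ⟨l', rfl, h₁, h₂, h₃⟩
  exact ⟨h₁, h₂, by simp only [List.length_cons]; omega⟩

theorem cross_proj (G : Digraph V) (H : Digraph W) {x : List V →₀ R} {y : List W →₀ R}
    (hx : x ∈ Finsupp.supported R R (reachSet G)) (hy : y ∈ Finsupp.supported R R (reachSet H)) :
    cross R G H (proj R G x) (proj R H y) = proj R (box G H) (shuffleL R x y) := by
  refine eq_of_supported (f := ((cross R G H).flip (proj R H y)).comp (proj R G))
    (g := (proj R (box G H)).comp ((shuffleL R).flip y)) (fun a ha => ?_) hx
  refine eq_of_supported (f := (cross R G H (proj R G (Finsupp.single a 1))).comp (proj R H))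
    (g := (proj R (box G H)).comp (shuffleL R (Finsupp.single a 1))) (fun b hb => ?_) hy
  simp only [LinearMap.comp_apply, proj_single, shuffleL_single]
  rcases isGen_or ha with h | rfl | h
  · rcases isGen_or hb with h' | rfl | h'
    · rw [gen_of h, gen_of h', cross_single]
    · simp [gen_nil, shuffle_nil]
    · rw [gen_degenerate H h', proj_degenerate _ (shuffle_degenerate a b (.inr h')), map_zero]
  · simp [gen_nil, nil_shuffle]
  · rw [gen_degenerate G h, proj_degenerate _ (shuffle_degenerate a b (.inl h)), map_zero,
      LinearMap.zero_apply]

theorem bd_cross_single (G : Digraph V) (H : Digraph W) (x : Gen G) (y : Gen H) :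
    bd R (box G H) (cross R G H (Finsupp.single x 1) (Finsupp.single y 1)) =
      cross R G H (bd R G (Finsupp.single x 1)) (Finsupp.single y 1) +
        (-1 : R) ^ (x.1.length + 1) •
          cross R G H (Finsupp.single x 1) (bd R H (Finsupp.single y 1)) := by
  have hx := x.mem_reachSet
  have hy := y.mem_reachSet
  rw [cross_single, bd_proj, faces_shuffle _ _ x.2.1 y.2.1, bd_single, bd_single, ← gen_coe x,
    ← gen_coe y, ← proj_single, ← proj_single,
    cross_proj G H (faces_mem_reach hx) (Finsupp.single_mem_supported _ _ hy),
    cross_proj G H (Finsupp.single_mem_supported _ _ hx) (faces_mem_reach hy)]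
  · rw [map_add, map_add, map_smul]
    split_ifs <;> simp [gen_nil]
  · exact Finsupp.supported_mono (fun _ h => h.1) (shuffle_mem_reach hx hy)

/-- `∇` is a chain map. -/
theorem bd_cross (G : Digraph V) (H : Digraph W) (n : ℤ) : ∃ ε : R, ε * ε = 1 ∧
    ∀ a ∈ degPart R G n, ∀ b, bd R (box G H) (cross R G H a b) =
      cross R G H (bd R G a) b + ε • cross R G H a (bd R H b) := by
  refine ⟨(-1) ^ ((n + 1).toNat + 1), by rw [← mul_pow]; simp, fun a ha b => ?_⟩
  refine eq_of_supported (f := (bd R (box G H)).comp ((cross R G H).flip b))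
    (g := ((cross R G H).flip b).comp (bd R G) +
      ((-1 : R) ^ ((n + 1).toNat + 1)) • (cross R G H).flip (bd R H b)) (fun x hx => ?_) ha
  have hx : (x.1.length : ℤ) = n + 1 := hx
  have e : (n + 1).toNat = x.1.length := by omega
  refine eq_of_supported (S := Set.univ)
    (f := (bd R (box G H)).comp (cross R G H (Finsupp.single x 1)))
    (g := cross R G H (bd R G (Finsupp.single x 1)) +
      ((-1 : R) ^ ((n + 1).toNat + 1)) • (cross R G H (Finsupp.single x 1)).comp (bd R H))
    (fun y _ => ?_) (by simp)
  rw [e]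
  exact bd_cross_single G H x y

theorem cross_mem_filt {G : Digraph V} {H : Digraph W} {p u : ℤ} {a : RC R G} {b : RC R H}
    (ha : a ∈ filt R G p) (hb : b ∈ filt R H u) : cross R G H a b ∈ filt R (box G H) (p + u) := by
  refine mem_of_supported (f := (cross R G H).flip b) (fun x hx => ?_) ha
  refine mem_of_supported (f := cross R G H (Finsupp.single x 1)) (fun y hy => ?_) hb
  obtain ⟨k, hk, hk'⟩ := hx
  obtain ⟨m, hm, hm'⟩ := hy
  rw [cross_single]
  refine mem_of_supported (fun l hl => ?_) (shuffle_mem_reach x.mem_reachSet y.mem_reachSet)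
  rw [proj_single]
  exact gen_mem_filt (k := k + m) (hl.2.1.trans (by push_cast; exact add_le_add hk hm))
    (by push_cast; omega)

theorem cross_mem_degPart {G : Digraph V} {H : Digraph W} {n m : ℤ} {a : RC R G} {b : RC R H}
    (ha : a ∈ degPart R G n) (hb : b ∈ degPart R H m) :
    cross R G H a b ∈ degPart R (box G H) (n + m) := by
  refine mem_of_supported (f := (cross R G H).flip b) (fun x hx => ?_) ha
  refine mem_of_supported (f := cross R G H (Finsupp.single x 1)) (fun y hy => ?_) hb
  have hx : (x.1.length : ℤ) = n + 1 := hx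
  have hy : (y.1.length : ℤ) = m + 1 := hy
  rw [cross_single]
  refine mem_of_supported (fun l hl => ?_) (shuffle_mem_reach x.mem_reachSet y.mem_reachSet)
  rw [proj_single]
  have := hl.2.2
  exact gen_mem_degPart (by omega)

theorem mem_A {G : Digraph V} {r p q : ℤ} {c : RC R G} : c ∈ A R G r p q ↔
    (c ∈ filt R G p ∧ c ∈ degPart R G (p + q)) ∧ bd R G c ∈ filt R G (p - r) := Iff.rfl

theorem filt_mono (G : Digraph V) {p p' : ℤ} (h : p ≤ p') : filt R G p ≤ filt R G p' :=
  Finsupp.supported_mono fun _ ⟨k, hk, hk'⟩ => ⟨k, hk, hk'.trans h⟩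

/-- A common bound for the products of elements of two different `A`s. -/
theorem cross_mem_A {G : Digraph V} {H : Digraph W} {r r' t m n u v p q : ℤ}
    {a : RC R G} {b : RC R H} (ha : a ∈ A R G r m n) (hb : b ∈ A R H r' u v)
    (hp : m + u = p) (hq : n + v = q) (h₁ : t ≤ r) (h₂ : t ≤ r') :
    cross R G H a b ∈ A R (box G H) t p q := by
  subst hp hq
  rw [mem_A] at ha hb ⊢
  obtain ⟨ε, -, hε⟩ := bd_cross (R := R) G H (m + n)
  refine ⟨⟨cross_mem_filt ha.1.1 hb.1.1, ?_⟩, ?_⟩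
  · have := cross_mem_degPart ha.1.2 hb.1.2
    rwa [show m + n + (u + v) = m + u + (n + v) by ring] at this
  · rw [hε _ ha.1.2]
    exact Submodule.add_mem _
      (filt_mono _ (by omega) (cross_mem_filt ha.2 hb.1.1))
      (Submodule.smul_mem _ _ (filt_mono _ (by omega) (cross_mem_filt ha.1.1 hb.2)))

theorem bd_mem_A {G : Digraph V} {r m n : ℤ} (t : ℤ) {a : RC R G} (ha : a ∈ A R G r m n) :
    bd R G a ∈ A R G t (m - r) (n + r - 1) := by
  rw [mem_A] at ha ⊢
  refine ⟨⟨ha.2, ?_⟩, by rw [bd_bd]; exact Submodule.zero_mem _⟩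
  have := bd_mem_degPart ha.1.2
  rwa [show m + n - 1 = m - r + (n + r - 1) by ring] at this

theorem cross_mem_B_left {G : Digraph V} {H : Digraph W} {r m n u v p q : ℤ}
    {a : RC R G} {b : RC R H} (ha : a ∈ B R G r m n) (hb : b ∈ A R H r u v)
    (hp : m + u = p) (hq : n + v = q) : cross R G H a b ∈ B R (box G H) r p q := by
  obtain ⟨a, h, _, ⟨a', ha', rfl⟩, rfl⟩ := Submodule.mem_sup.1 ha
  obtain ⟨ε, -, hε⟩ := bd_cross (R := R) G H (m + r - 1 + (n - r + 2))
  have e := hε a' ha'.1.2 b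
  have : cross R G H (a + bd R G a') b = (cross R G H a b - ε • cross R G H a' (bd R H b)) +
      bd R (box G H) (cross R G H a' b) := by
    rw [e, map_add, LinearMap.add_apply]
    abel
  rw [this]
  refine Submodule.add_mem_sup (Submodule.sub_mem _ ?_ (Submodule.smul_mem _ _ ?_)) ⟨_, ?_, rfl⟩
  · exact cross_mem_A h hb (by omega) (by omega) le_rfl (by omega)
  · exact cross_mem_A ha' (bd_mem_A (r - 1) hb) (by omega) (by omega) le_rfl le_rfl
  · exact cross_mem_A ha' hb (by omega) (by omega) le_rfl (by omega)

theorem cross_mem_B_right {G : Digraph V} {H : Digraph W} {r m n u v p q : ℤ}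
    {a : RC R G} {b : RC R H} (ha : a ∈ A R G r m n) (hb : b ∈ B R H r u v)
    (hp : m + u = p) (hq : n + v = q) : cross R G H a b ∈ B R (box G H) r p q := by
  obtain ⟨b, h, _, ⟨b', hb', rfl⟩, rfl⟩ := Submodule.mem_sup.1 hb
  obtain ⟨ε, h₁, hε⟩ := bd_cross (R := R) G H (m + n)
  have e := hε a ha.1.2 b'
  have : cross R G H a (b + bd R H b') = (cross R G H a b - ε • cross R G H (bd R G a) b') +
      bd R (box G H) (ε • cross R G H a b') := by
    rw [map_smul, e, map_add, smul_add, smul_smul, h₁, one_smul]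
    abel
  rw [this]
  refine Submodule.add_mem_sup (Submodule.sub_mem _ ?_ (Submodule.smul_mem _ _ ?_))
    ⟨_, Submodule.smul_mem _ _ ?_, rfl⟩
  · exact cross_mem_A ha h (by omega) (by omega) (by omega) le_rfl
  · exact cross_mem_A (bd_mem_A (r - 1) ha) hb' (by omega) (by omega) le_rfl le_rfl
  · exact cross_mem_A ha hb' (by omega) (by omega) (by omega) le_rfl

end Chains

section Kunneth

/-- The ways to write a bidegree as a sum: `m + u = p` and `n + v = q`. -/
@[ext] structure Split (p q : ℤ) where
  m : ℤ
  n : ℤ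
  u : ℤ
  v : ℤ
  hp : m + u = p
  hq : n + v = q

instance (p q : ℤ) : DecidableEq (Split p q) := Classical.decEq _

section

variable (R : Type*) [CommRing R] {V W V' W' : Type*}

/-- `(E^r(G) ⊗ E^r(H))_{pq}`, the sum of the `E^r_{mn}(G) ⊗ E^r_{uv}(H)` over `m + u = p` and
`n + v = q`. -/
abbrev TensorPage (G : Digraph V) (H : Digraph W) (r : ℕ) (p q : ℤ) :=
  ⨁ i : Split p q, E R G r i.m i.n ⊗[R] E R H r i.u i.v

/-- The map `∇^r : (E^r(G) ⊗ E^r(H))_{pq} → E^r_{pq}(G □ H)` induced by `∇`, that is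
`[a] ⊗ [b] ↦ [∇(a ⊗ b)]`. -/
def nabla (G : Digraph V) (H : Digraph W) (r : ℕ) (p q : ℤ) :
    TensorPage R G H r p q →ₗ[R] E R (box G H) r p q :=
  DirectSum.toModule R _ _ fun i => TensorProduct.lift <|
    Subquot.map₂ (cross R G H) (fun _ ha _ hb => cross_mem_A ha hb i.hp i.hq le_rfl le_rfl)
      (fun _ _ ha _ hb => cross_mem_B_left ha hb i.hp i.hq)
      (fun _ ha _ _ hb => cross_mem_B_right ha hb i.hp i.hq)

/-- The map `E^r(f) ⊗ E^r(g)` in bidegree `(p,q)`. -/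
def tensorPageMap {G : Digraph V} {G' : Digraph V'} {H : Digraph W} {H' : Digraph W'}
    (f : GraphMap G G') (g : GraphMap H H') (r : ℕ) (p q : ℤ) :
    TensorPage R G H r p q →ₗ[R] TensorPage R G' H' r p q :=
  DirectSum.lmap fun i => TensorProduct.map (f.page R r i.m i.n) (g.page R r i.u i.v)

/-- All terms of the pages `E^r(G)`, `0 ≤ r < s`, are flat. -/
def FlatBelow (G : Digraph V) (s : ℕ) : Prop :=
  ∀ r < s, ∀ p q : ℤ, Module.Flat R (E R G r p q)

end

variable (R : Type u) [CommRing R] {V W V' W' : Type u}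

/-- The sum of the `Tor₁(E^s_{mn}(G), E^s_{u-s+1,v+s-2}(H))` over `m + u = p` and `n + v = q`. -/
abbrev TorPage (G : Digraph V) (H : Digraph W) (s : ℕ) (p q : ℤ) :=
  ⨁ i : Split p q, (((Tor (ModuleCat.{u} R) 1).obj (ModuleCat.of R (E R G s i.m i.n))).obj
    (ModuleCat.of R (E R H s (i.u - s + 1) (i.v + s - 2))))

/-- The map `Tor₁(E^s(f), E^s(g))` in bidegree `(p,q)`. -/
def torPageMap {G : Digraph V} {G' : Digraph V'} {H : Digraph W} {H' : Digraph W'}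
    (f : GraphMap G G') (g : GraphMap H H') (s : ℕ) (p q : ℤ) :
    TorPage R G H s p q →ₗ[R] TorPage R G' H' s p q :=
  DirectSum.lmap fun i =>
    (((Tor (ModuleCat.{u} R) 1).map (ModuleCat.ofHom (f.page R s i.m i.n))).app _ ≫
      ((Tor (ModuleCat.{u} R) 1).obj _).map
        (ModuleCat.ofHom (g.page R s (i.u - s + 1) (i.v + s - 2)))).hom

end Kunneth
end
end MPSS

/-! The proof applies the algebraic Künneth theorem one page at a time. The page E^{r+1} is the
homology of (E^r, d^r) (`pageHomology`), and ∇^r is a chain map for the tensor product differential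
(`pageD_nabla`). Once ∇^r identifies E^{r+1}(G □ H) with the homology of E^r(G) ⊗ E^r(H), Künneth
gives a short exact sequence with first map ∇^{r+1} and with Tor₁ of the pages E^{r+1}(G) and
E^{r+1}(H) as third term. If E^{r+1}(G) is flat, the Tor terms vanish, so ∇^{r+1} is an isomorphism
of complexes and identifies the next page (`tensorHomologyOfBijective`). This induction
(`FlatBelow.nabla_bijective`) runs up to page s - 1; on page s the Tor terms may survive.

The induction starts at r = 0, where ∇^0 need not be bijective but is a homotopy equivalence. The
inverse is the Alexander–Whitney map. It respects the length filtration because distances in the box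
product are at least the sum of the distances in the factors (`dist_add_dist_le_box`). On tuples
without repetitions it is a strict left inverse of ∇ (`awL_shuffle`). The other composite is
homotopic to the identity by an explicit recursive homotopy (`ezHtpy_faces`), which preserves the
length filtration as well (`ezHtpy_mem`). Hence `tensorHomologyZero`.

The Künneth step takes complexes X, Y with X flat and Y arbitrary. Over a principal ideal domain the
cycles Z and boundaries B of X are flat too. For a cycle t of X ⊗ Y, the element (d ⊗ 1)t of B ⊗ Y
is killed by 1 ⊗ d, hence comes from B ⊗ Z(Y); its class in B ⊗ H(Y) depends only on the class of t.
This defines `TensorHomology.connect`, and diagram chases give exactness of 0 → H(X) ⊗ H(Y) → H(X ⊗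
Y) → B ⊗ H(Y) → Z ⊗ H(Y). As Z is flat, the kernel of the last map is Tor₁(H(X), H(Y)): it is the
image of the connecting map for 0 → B → Z → H(X) → 0 (`torToTensor_injective`, `torToTensor_exact`).
Naturality is checked after embedding the Tor terms in B ⊗ H(Y), where every map has a formula on
representatives. -/

namespace MPSS

noncomputable section

/-! ### The Alexander–Whitney map and the Eilenberg–Zilber homotopy on arbitrary tuples. -/

section AlexanderWhitney

variable {R : Type*} [CommRing R] {V W : Type*}

/-- Prepending a vertex to the first entry of a pair of tuples, extended linearly. -/
def consFst (x : V) : (List V × List W →₀ R) →ₗ[R] (List V × List W →₀ R) :=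
  Finsupp.lmapDomain R R fun c => (x :: c.1, c.2)

@[simp] theorem consFst_single (x : V) (c : List V × List W) (t : R) :
    consFst x (Finsupp.single c t) = Finsupp.single (x :: c.1, c.2) t := by
  simp [consFst, Finsupp.mapDomain_single]

/-- Pairing with a fixed second tuple. -/
def pairL (b : List W) : (List V →₀ R) →ₗ[R] (List V × List W →₀ R) :=
  Finsupp.lmapDomain R R fun a => (a, b)

/-- Pairing with a fixed first tuple. -/
def pairR (a : List V) : (List W →₀ R) →ₗ[R] (List V × List W →₀ R) :=
  Finsupp.lmapDomain R R fun b => (a, b)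

@[simp] theorem pairL_single (b : List W) (a : List V) (t : R) :
    pairL b (Finsupp.single a t) = Finsupp.single (a, b) t := by
  simp [pairL, Finsupp.mapDomain_single]

@[simp] theorem pairR_single (a : List V) (b : List W) (t : R) :
    pairR a (Finsupp.single b t) = Finsupp.single (a, b) t := by
  simp [pairR, Finsupp.mapDomain_single]

theorem pairL_consL (b : List W) (x : V) (z : List V →₀ R) :
    pairL b (consL x z) = consFst x (pairL b z) := by
  refine eq_of_supported (R := R) (S := Set.univ) (f := (pairL b).comp (consL x))
    (g := (consFst x).comp (pairL b)) (fun a _ => ?_) (by simp)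
  simp

theorem pairR_cons (x : V) (a : List V) (z : List W →₀ R) :
    pairR (x :: a) z = consFst x (pairR a z) := by
  refine eq_of_supported (R := R) (S := Set.univ) (f := pairR (x :: a))
    (g := (consFst x).comp (pairR a)) (fun b _ => ?_) (by simp)
  simp

variable (R) in
/-- The differential of the tensor product of two complexes of tuples. -/
def pairBd : (List V × List W →₀ R) →ₗ[R] (List V × List W →₀ R) :=
  Finsupp.linearCombination R fun c => pairL c.2 (faces R c.1) +
    (-1 : R) ^ (c.1.length + 1) • pairR c.1 (faces R c.2)

@[simp] theorem pairBd_single (c : List V × List W) :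
    pairBd R (Finsupp.single c 1) = pairL c.2 (faces R c.1) +
    (-1 : R) ^ (c.1.length + 1) • pairR c.1 (faces R c.2) := by simp [pairBd]

/-- The empty tuple counts as a face, so these complexes are augmented and prepending a fixed vertex
is a contraction. The lengthened first tuple flips the Koszul sign, which merges both parts of the
differential into one formula. -/
theorem pairBd_consFst (x : V) (z : List V × List W →₀ R) :
    pairBd R (consFst x z) = z - consFst x (pairBd R z) := by
  refine eq_of_supported (R := R) (S := Set.univ) (f := (pairBd R).comp (consFst x))
    (g := LinearMap.id - (consFst x).comp (pairBd R)) (fun c _ => ?_) (by simp)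
  obtain ⟨a, b⟩ := c
  simp only [LinearMap.comp_apply, consFst_single, pairBd_single, faces_cons, map_sub,
    pairL_single, pairL_consL, List.length_cons, LinearMap.sub_apply, LinearMap.id_apply, map_add,
    map_smul, pairR_cons]
  rw [pow_succ (-1 : R) (a.length + 1), mul_neg_one, neg_smul]
  abel

/-- Projection of tuples of pairs to tuples of second entries. -/
def sndL : (List (V × W) →₀ R) →ₗ[R] (List W →₀ R) := Finsupp.lmapDomain R R (List.map Prod.snd)

@[simp] theorem sndL_single (l : List (V × W)) (t : R) :
    sndL (Finsupp.single l t) = Finsupp.single (l.map Prod.snd) t := by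
  simp [sndL, Finsupp.mapDomain_single]

theorem sndL_consL (v : V × W) (z : List (V × W) →₀ R) :
    sndL (consL v z) = consL v.2 (sndL z) := by
  refine eq_of_supported (R := R) (S := Set.univ) (f := sndL.comp (consL v))
    (g := (consL v.2).comp sndL) (fun b _ => ?_) (by simp)
  simp

theorem sndL_faces (l : List (V × W)) : sndL (faces R l) = faces R (l.map Prod.snd) :=
  (faces_map _ l).symm

variable (R) in
/-- The Alexander–Whitney map `∑ᵢ (x₀,…,xᵢ) ⊗ (yᵢ,…,yₙ)` on tuples. -/
def aw : List (V × W) → (List V × List W →₀ R)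
  | [] => 0
  | v :: l => Finsupp.single ([v.1], v.2 :: l.map Prod.snd) 1 + consFst v.1 (aw l)

variable (R) in
/-- `aw`, extended linearly. -/
def awL : (List (V × W) →₀ R) →ₗ[R] (List V × List W →₀ R) := Finsupp.linearCombination R (aw R)

@[simp] theorem awL_single (l : List (V × W)) : awL R (Finsupp.single l 1) = aw R l := by
  simp [awL]

theorem awL_consL (v : V × W) (z : List (V × W) →₀ R) :
    awL R (consL v z) = pairR [v.1] (consL v.2 (sndL z)) + consFst v.1 (awL R z) := by
  refine eq_of_supported (R := R) (S := Set.univ) (f := (awL R).comp (consL v))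
    (g := (pairR [v.1]).comp ((consL v.2).comp sndL) + (consFst v.1).comp (awL R))
    (fun b _ => ?_) (by simp)
  simp [aw]

/-- The faces that remove the cut vertex cancel between neighbouring cuts. The two uncancelled end
terms have an empty tuple on one side; they vanish under the shuffle map and in the reachability
chains. -/
theorem pairBd_aw : ∀ l : List (V × W), l ≠ [] → pairBd R (aw R l) = awL R (faces R l) +
    Finsupp.single ([], l.map Prod.snd) 1 +
      (-1 : R) ^ (l.length + 1) • Finsupp.single (l.map Prod.fst, []) 1
  | [], h => absurd rfl h
  | [v], _ => by
    simp [aw, faces_cons, faces_nil]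
  | v :: w :: l, _ => by
    have ih := pairBd_aw (w :: l) (by simp)
    rw [aw, map_add, pairBd_consFst, ih, faces_cons v, map_sub, awL_consL, awL_single, sndL_faces,
      pairBd_single]
    simp only [faces_cons v.2, faces_cons v.1, faces_nil, map_sub, map_add, map_smul, map_zero,
      pairL_single, pairR_single, consFst_single, List.length_cons, List.map_cons, List.length_nil,
      sub_zero]
    rw [pow_succ (-1 : R) (l.length + 1 + 1), mul_neg_one, neg_smul]
    simp only [zero_add, one_add_one_eq_two, even_two, Even.neg_pow, one_pow, one_smul]
    abel

variable (R) in
/-- `shuffle`, extended linearly to combinations of pairs of tuples. -/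
def shufL : (List V × List W →₀ R) →ₗ[R] (List (V × W) →₀ R) :=
  Finsupp.linearCombination R fun c => shuffle R c.1 c.2

@[simp] theorem shufL_single (c : List V × List W) :
    shufL R (Finsupp.single c 1) = shuffle R c.1 c.2 := by simp [shufL]

theorem shufL_pairL (b : List W) (z : List V →₀ R) :
    shufL R (pairL b z) = shuffleL R z (Finsupp.single b 1) := by
  refine eq_of_supported (R := R) (S := Set.univ) (f := (shufL R).comp (pairL b))
    (g := (shuffleL R).flip (Finsupp.single b 1)) (fun b _ => ?_) (by simp)
  simp

theorem shufL_pairR (a : List V) (z : List W →₀ R) :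
    shufL R (pairR a z) = shuffleL R (Finsupp.single a 1) z := by
  refine eq_of_supported (R := R) (S := Set.univ) (f := (shufL R).comp (pairR a))
    (g := shuffleL R (Finsupp.single a 1)) (fun b _ => ?_) (by simp)
  simp

/-- The bound `3` excludes pairs of one-vertex tuples, the only non-empty pairs for which
`faces_shuffle` has an augmentation term. Pairs with an empty tuple give zero on both sides. -/
theorem facesL_shufL {z : List V × List W →₀ R}
    (hz : z ∈ Finsupp.supported R R {c | 3 ≤ c.1.length + c.2.length}) :
    facesL R (shufL R z) = shufL R (pairBd R z) := by
  refine eq_of_supported (f := (facesL R).comp (shufL R))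
    (g := (shufL R).comp (pairBd R)) (fun c hc => ?_) hz
  obtain ⟨a, b⟩ := c
  have hc : 3 ≤ a.length + b.length := hc
  simp only [LinearMap.comp_apply, shufL_single, pairBd_single, map_add, map_smul, shufL_pairL,
    shufL_pairR]
  by_cases ha : a = []
  · subst ha
    simp [nil_shuffle, faces_nil, nil_shuffleL]
  by_cases hb : b = []
  · subst hb
    simp [shuffle_nil, faces_nil, shuffleL_nil]
  rw [faces_shuffle a b ha hb, if_neg (by omega), add_zero]

theorem aw_length (l : List (V × W)) : aw R l ∈ Finsupp.supported R R
    {c | c.1.length + c.2.length = l.length + 1} := by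
  induction l with
  | nil => exact Submodule.zero_mem _
  | cons v l ih =>
    rw [aw]
    refine Submodule.add_mem _ (Finsupp.single_mem_supported _ _ ?_)
      (mem_of_supported (fun c hc => ?_) ih)
    · simp; omega
    · rw [consFst_single]
      have hc : c.1.length + c.2.length = l.length + 1 := hc
      refine Finsupp.single_mem_supported _ _ ?_
      simp; omega

variable (R) in
/-- The composite of the Alexander–Whitney map and the shuffle map. -/
def awShuf (l : List (V × W)) : List (V × W) →₀ R := shufL R (aw R l)

variable (R) in
/-- `awShuf`, extended linearly. -/
def awShufL : (List (V × W) →₀ R) →ₗ[R] (List (V × W) →₀ R) := (shufL R).comp (awL R)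

@[simp] theorem awShufL_single (l : List (V × W)) :
    awShufL R (Finsupp.single l 1) = awShuf R l := by simp [awShufL, awShuf]

theorem facesL_awShuf {l : List (V × W)} (h : 2 ≤ l.length) :
    facesL R (awShuf R l) = awShufL R (faces R l) := by
  have hl : l ≠ [] := by rintro rfl; simp at h
  rw [awShuf, facesL_shufL, pairBd_aw l hl]
  · rw [map_add, map_add, map_smul, shufL_single, shufL_single]
    simp [awShufL, nil_shuffle, shuffle_nil]
  -- The two halves share the cut vertex, so their lengths sum to one more than that of `l`, hence
  -- to at least three.
  · exact Finsupp.supported_mono (fun c (hc : _ = _) => by change 3 ≤ _; omega) (aw_length l)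

variable (R) in
/-- The recursive chain homotopy between `awShuf` and the identity. -/
def ezHtpy : List (V × W) → (List (V × W) →₀ R)
  | [] => 0
  | v :: l => consL v (awShuf R (v :: l) - ezHtpy l)

variable (R) in
/-- `ezHtpy`, extended linearly. -/
def ezHtpyL : (List (V × W) →₀ R) →ₗ[R] (List (V × W) →₀ R) :=
  Finsupp.linearCombination R (ezHtpy R)

@[simp] theorem ezHtpyL_single (l : List (V × W)) :
    ezHtpyL R (Finsupp.single l 1) = ezHtpy R l := by simp [ezHtpyL]

theorem ezHtpyL_consL (v : V × W) (z : List (V × W) →₀ R) :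
    ezHtpyL R (consL v z) = consL v (awShufL R (consL v z) - ezHtpyL R z) := by
  refine eq_of_supported (R := R) (S := Set.univ) (f := (ezHtpyL R).comp (consL v))
    (g := (consL v).comp ((awShufL R).comp (consL v) - ezHtpyL R)) (fun b _ => ?_) (by simp)
  simp [ezHtpy]

theorem awShuf_singleton (v : V × W) : awShuf R [v] = Finsupp.single [v] 1 := by
  simp [awShuf, aw, shuffle]

variable (R) in
/-- The combinations of tuples with repeated consecutive entries. -/
abbrev degen (V : Type*) : Submodule R (List V →₀ R) :=
  Finsupp.supported R R {l : List V | ¬ l.IsChain (· ≠ ·)}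

/-- Write φ for `awShuf` and h for `ezHtpy`, so that h(v,l) = v·(φ(v,l) - h(l)). Prepending v
satisfies ∂(v·x) = x - v·∂x and φ commutes with ∂, so in ∂h + h∂ everything telescopes except φ(v,l)
and v·(∂h + h∂ - φ)(l). The induction hypothesis then applies. -/
theorem ezHtpy_faces : ∀ l : List (V × W), l ≠ [] →
    facesL R (ezHtpy R l) + ezHtpyL R (faces R l) - (awShuf R l - Finsupp.single l 1) ∈
      degen R (V × W)
  | [], h => absurd rfl h
  | [v], _ => by
    simp [ezHtpy, awShuf_singleton, faces_cons, faces_nil]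
  | v :: w :: l, _ => by
    have ih := ezHtpy_faces (w :: l) (by simp)
    have e := facesL_awShuf (R := R) (l := v :: w :: l) (by simp)
    rw [faces_cons, map_sub, awShufL_single] at e
    rw [ezHtpy, facesL_consL, faces_cons, map_sub (ezHtpyL R), ezHtpyL_single, ezHtpyL_consL,
      map_sub (facesL R), e]
    -- The error at `v :: w :: l` is exactly `v` prepended to the error at `w :: l`.
    have := consL_degenerate v ih
    simp only [map_sub, map_add, consL_single] at this ⊢
    convert this using 1
    abel

end AlexanderWhitney

/-! ### Compatibility with degenerate tuples, and Alexander–Whitney as a left inverse of the shuffle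
map. -/

section Degenerate

variable {R : Type*} [CommRing R] {V W : Type*}

variable (R) in
/-- The combinations of pairs of tuples one of which has repeated consecutive entries. -/
abbrev degenPair (V W : Type*) : Submodule R (List V × List W →₀ R) :=
  Finsupp.supported R R {c | ¬ c.1.IsChain (· ≠ ·) ∨ ¬ c.2.IsChain (· ≠ ·)}

theorem aw_head (v : V × W) (l : List (V × W)) :
    aw R (v :: l) ∈ Finsupp.supported R R {c | ∃ a, c.1 = v.1 :: a} := by
  rw [aw]
  refine Submodule.add_mem _ (Finsupp.single_mem_supported _ _ ⟨_, rfl⟩)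
    (mem_of_supported (S := Set.univ) (fun c _ => ?_) (by simp))
  rw [consFst_single]
  exact Finsupp.single_mem_supported _ _ ⟨_, rfl⟩

theorem consFst_degenerate (x : V) {z : List V × List W →₀ R} (hz : z ∈ degenPair R V W) :
    consFst x z ∈ degenPair R V W :=
  mem_of_supported (fun c hc => by
    rw [consFst_single]
    exact Finsupp.single_mem_supported _ _ (hc.imp_left (not_isChain_cons x))) hz

theorem pairR_degenerate (a : List V) {z : List W →₀ R} (hz : z ∈ degen R W) :
    pairR a z ∈ degenPair R V W :=
  mem_of_supported (fun c hc => by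
    rw [pairR_single]
    exact Finsupp.single_mem_supported _ _ (.inr hc)) hz

theorem not_isChain_map {f : V → W} {l : List V} (h : ¬ l.IsChain (· ≠ ·)) :
    ¬ (l.map f).IsChain (· ≠ ·) :=
  fun h₁ => h (List.isChain_of_isChain_map _ (fun _ _ => mt (congrArg f)) h₁)

/-- A degenerate tuple has a degenerate tail, or its first two entries agree. -/
theorem not_isChain_cons_cases {v : V} {l : List V} (h : ¬ (v :: l).IsChain (· ≠ ·)) :
    ¬ l.IsChain (· ≠ ·) ∨ ∃ l', l = v :: l' := by
  by_cases hl : l.IsChain (· ≠ ·)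
  · rcases l with _ | ⟨w, l⟩
    · simp at h
    · refine .inr ⟨l, ?_⟩
      by_contra hne
      exact h (.cons_cons (fun e => hne (by rw [e])) hl)
  · exact .inl hl

/-- A repeated vertex repeats in both coordinates, and the two halves overlap in the cut vertex, so
the repetition survives whole in one of them. -/
theorem aw_degenerate : ∀ l : List (V × W), ¬ l.IsChain (· ≠ ·) → aw R l ∈ degenPair R V W
  | [], h => absurd .nil h
  | v :: l, h => by
    rw [aw]
    refine Submodule.add_mem _ (Finsupp.single_mem_supported _ _
      (.inr (not_isChain_map (f := Prod.snd) h))) ?_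
    rcases not_isChain_cons_cases h with hl | ⟨l', rfl⟩
    · exact consFst_degenerate _ (aw_degenerate l hl)
    · refine mem_of_supported (fun c hc => ?_) (aw_head v l')
      obtain ⟨a, ha⟩ := hc
      rw [consFst_single, ha]
      exact Finsupp.single_mem_supported _ _ (.inl (by simp))

theorem shufL_degenerate {z : List V × List W →₀ R} (hz : z ∈ degenPair R V W) :
    shufL R z ∈ degen R (V × W) :=
  mem_of_supported (fun c hc => by
    rw [shufL_single]
    exact shuffle_degenerate _ _ hc) hz

theorem ezHtpy_degenerate : ∀ l : List (V × W), ¬ l.IsChain (· ≠ ·) →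
    ezHtpy R l ∈ degen R (V × W)
  | [], h => absurd .nil h
  | v :: l, h => by
    rw [ezHtpy, map_sub]
    refine Submodule.sub_mem _ (consL_degenerate v (shufL_degenerate (aw_degenerate _ h))) ?_
    rcases not_isChain_cons_cases h with hl | ⟨l', rfl⟩
    · exact consL_degenerate v (ezHtpy_degenerate l hl)
    -- All tuples in `ezHtpy` of a tuple starting with `v` start with `v` again, so another `v` in
    -- front makes a repetition.
    · refine consL_head_degenerate v ?_
      rw [ezHtpy]
      refine mem_of_supported (S := Set.univ) (fun m _ => ?_) (by simp)
      rw [consL_single]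
      exact Finsupp.single_mem_supported _ _ ⟨_, rfl⟩

/-- This is the case of a lattice path whose first step is horizontal: the second coordinate stays
at `h`. -/
theorem consL_sndL_shuffle (h : W) (gs : List V) (hs : List W) :
    consL h (sndL (shuffle R gs (h :: hs))) ∈ degen R W := by
  rcases gs with _ | ⟨g, gs⟩
  · simp [nil_shuffle]
  · refine consL_head_degenerate h (mem_of_supported (fun m hm => ?_) (shuffle_head g gs h hs))
    obtain ⟨l', rfl⟩ := hm
    rw [sndL_single]
    exact Finsupp.single_mem_supported _ _ ⟨_, rfl⟩

/-- With at least two vertices in the first tuple each lattice path has a horizontal step, along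
which the second coordinate repeats. -/
theorem sndL_shuffle_degenerate (g g' : V) (gs : List V) : ∀ hs : List W,
    sndL (shuffle R (g :: g' :: gs) hs) ∈ degen R W
  | [] => by simp [shuffle_nil]
  | h :: hs => by
    rw [shuffle_cons, if_neg (by simp), zero_add, sndL_consL, map_add, map_add, map_smul, map_smul]
    exact Submodule.add_mem _ (consL_sndL_shuffle h _ hs)
      (Submodule.smul_mem _ _ (consL_degenerate h (sndL_shuffle_degenerate g g' gs hs)))

theorem sndL_shuffle_singleton (g : V) : ∀ (h : W) (hs : List W),
    sndL (shuffle R [g] (h :: hs)) = Finsupp.single (h :: hs) 1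
  | h, [] => by simp [shuffle]
  | h, h' :: hs => by
    rw [shuffle_cons, if_neg (by simp), zero_add, nil_shuffle, zero_add, sndL_consL]
    have := sndL_shuffle_singleton g h' hs
    simp [this]

/-- The Alexander–Whitney map is a left inverse of the shuffle map, up to degenerate tuples. -/
theorem awL_shuffle : ∀ (a : List V) (b : List W), a ≠ [] → b ≠ [] →
    awL R (shuffle R a b) - Finsupp.single (a, b) 1 ∈ degenPair R V W
  | [], _, h, _ => absurd rfl h
  | _, [], _, h => absurd rfl h
  | [g], [h], _, _ => by simp [shuffle, aw]
  | [g], h :: h' :: hs, _, _ => by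
    have ih := awL_shuffle [g] (h' :: hs) (by simp) (by simp)
    rw [shuffle_cons, if_neg (by simp), zero_add, nil_shuffle, zero_add, awL_consL]
    simp only [List.length_nil, pow_zero, one_smul, sndL_shuffle_singleton, consL_single,
      pairR_single, add_sub_cancel_left]
    -- Prepending `g` to the induction hypothesis leaves the pair with first tuple `[g, g]`, which
    -- is degenerate and may be added back.
    have := Submodule.add_mem _ (consFst_degenerate g ih)
      (Finsupp.single_mem_supported R (s := {c : List V × List W |
        ¬ c.1.IsChain (· ≠ ·) ∨ ¬ c.2.IsChain (· ≠ ·)}) (a := ([g, g], h' :: hs)) 1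
        (.inl (by simp)))
    simpa using this
  | g :: g' :: gs, h :: hs, _, _ => by
    have ih := awL_shuffle (g' :: gs) (h :: hs) (by simp) (by simp)
    have ih' := fun hh => awL_shuffle (g :: g' :: gs) hs (by simp) hh
    rw [shuffle_cons, if_neg (by simp), zero_add, map_add, map_smul, map_add, map_smul, awL_consL,
      awL_consL]
    -- Only `h₁`, a first step to the right with a later cut, contributes the pair itself. In `h₂`
    -- and `h₃` the cut is at the first vertex, so the second half is the projection of a path with
    -- a horizontal step; in `h₄` the first step goes up and the first half starts with `g` twice.
    have h₁ := consFst_degenerate g ih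
    have h₂ := pairR_degenerate [g] (consL_sndL_shuffle (R := R) h (g' :: gs) hs)
    have h₃ := pairR_degenerate [g] (consL_degenerate h
      (sndL_shuffle_degenerate (R := R) g g' gs hs))
    have h₄ : consFst g (awL R (shuffle R (g :: g' :: gs) hs)) ∈ degenPair R V W := by
      rcases hs with _ | ⟨h', hs⟩
      · simp [shuffle_nil]
      have := Submodule.add_mem _ (consFst_degenerate g (ih' (by simp)))
        (Finsupp.single_mem_supported R (s := {c : List V × List W |
          ¬ c.1.IsChain (· ≠ ·) ∨ ¬ c.2.IsChain (· ≠ ·)}) (a := (g :: g :: g' :: gs, h' :: hs)) 1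
            (.inl (by simp)))
      simpa using this
    rw [map_sub, consFst_single] at h₁
    have := Submodule.add_mem _ (Submodule.add_mem _ h₁ h₂)
      (Submodule.smul_mem _ ((-1 : R) ^ (g' :: gs).length) (Submodule.add_mem _ h₃ h₄))
    convert this using 1
    abel
termination_by a b => a.length + b.length

end Degenerate

/-! ### Distances in the box product and the length filtration. -/

section Lengths

variable {R : Type*} [CommRing R] {V W : Type*}

theorem dist_self (G : Digraph V) (x : V) : dist G x x = 0 :=
  le_antisymm (iInf₂_le_of_le 0 (.nil x) (by simp)) bot_le

theorem dist_le_of_path {G : Digraph V} {n : ℕ} {x y : V} (h : HasPath G n x y) :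
    dist G x y ≤ n := iInf₂_le n h

theorem exists_path_of_reachable {G : Digraph V} {x y : V} (h : Reachable G x y) :
    ∃ n, HasPath G n x y ∧ dist G x y = n := by
  classical
  refine ⟨Nat.find h, Nat.find_spec h, le_antisymm (dist_le_of_path (Nat.find_spec h)) ?_⟩
  exact le_iInf₂ fun m hm => by exact_mod_cast Nat.find_min' h hm

theorem dist_eq_top {G : Digraph V} {x y : V} (h : ¬ Reachable G x y) : dist G x y = ⊤ :=
  top_le_iff.1 (le_iInf₂ fun n hn => absurd ⟨n, hn⟩ h)

theorem dist_triangle (G : Digraph V) (x y z : V) : dist G x z ≤ dist G x y + dist G y z := by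
  by_cases h : Reachable G x y
  · by_cases h' : Reachable G y z
    · obtain ⟨n, hn, e⟩ := exists_path_of_reachable h
      obtain ⟨m, hm, e'⟩ := exists_path_of_reachable h'
      rw [e, e']
      exact_mod_cast dist_le_of_path (hn.trans hm)
    · rw [dist_eq_top h', add_top]; exact le_top
  · rw [dist_eq_top h, top_add]; exact le_top

theorem HasPath.of_box {G : Digraph V} {H : Digraph W} {n : ℕ} {v w : V × W}
    (h : HasPath (box G H) n v w) :
    ∃ i j, i + j = n ∧ HasPath G i v.1 w.1 ∧ HasPath H j v.2 w.2 := by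
  induction h with
  | nil x => exact ⟨0, 0, rfl, .nil _, .nil _⟩
  | cons hxy _ ih =>
    obtain ⟨i, j, rfl, h₁, h₂⟩ := ih
    rcases hxy with ⟨e, h⟩ | ⟨e, h⟩
    · exact ⟨i, j + 1, by omega, e ▸ h₁, .cons h h₂⟩
    · exact ⟨i + 1, j, by omega, .cons h h₁, e ▸ h₂⟩

/-- Each edge of the box product moves one coordinate, so a path splits into a path in each factor.
This inequality is what makes Alexander–Whitney and the homotopy respect the length filtration. -/
theorem dist_add_dist_le_box (G : Digraph V) (H : Digraph W) (v w : V × W) :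
    dist G v.1 w.1 + dist H v.2 w.2 ≤ dist (box G H) v w := by
  refine le_iInf₂ fun n hn => ?_
  obtain ⟨i, j, rfl, h₁, h₂⟩ := hn.of_box
  push_cast
  exact add_le_add (dist_le_of_path h₁) (dist_le_of_path h₂)

/-- The projection of the box product to the first factor. -/
def fstMap (G : Digraph V) (H : Digraph W) : GraphMap (box G H) G :=
  ⟨Prod.fst, fun _ _ e => e.imp (·.1) (·.2)⟩

/-- The projection of the box product to the second factor. -/
def sndMap (G : Digraph V) (H : Digraph W) : GraphMap (box G H) H :=
  ⟨Prod.snd, fun _ _ e => e.symm.imp (·.1) (·.2)⟩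

/-- The second half begins at some `y` further along, so a shuffle of the halves starts at `(v.1,
y)` instead of `v`. The term `dist H v.2 y` reserves the length of the step from `v` to that vertex,
which the homotopy spends when it prepends `v`. -/
theorem aw_mem (G : Digraph V) (H : Digraph W) : ∀ (v : V × W) (l : List (V × W)),
    v :: l ∈ reachSet (box G H) →
    aw R (v :: l) ∈ Finsupp.supported R R {c | ∃ a y b, c = (v.1 :: a, y :: b) ∧
      c.1 ∈ reachSet G ∧ c.2 ∈ reachSet H ∧ Reachable H v.2 y ∧
      dist H v.2 y + (len G c.1 + len H c.2) ≤ len (box G H) (v :: l)}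
  | v, l, h => by
    rw [aw]
    refine Submodule.add_mem _ (Finsupp.single_mem_supported _ _
      ⟨[], v.2, l.map Prod.snd, rfl, .singleton _, map_mem_reachSet (sndMap G H) h,
        ⟨0, .nil _⟩, ?_⟩)
      ?_
    · rw [dist_self, len, zero_add, zero_add]
      exact len_map_le (sndMap G H) (v :: l)
    rcases l with _ | ⟨w, l⟩
    · simp [aw]
    refine mem_of_supported (fun c hc => ?_) (aw_mem G H w l (List.IsChain.tail h))
    obtain ⟨a, y, b, rfl, h₁, h₂, h₃, h₄⟩ := hc
    have hr := (List.isChain_cons_cons.1 h).1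
    rw [consFst_single]
    refine Finsupp.single_mem_supported _ _
      ⟨_, y, b, rfl, .cons_cons (hr.map (fstMap G H)) h₁, h₂, (hr.map (sndMap G H)).trans h₃, ?_⟩
    simp only [len.eq_3 G, len.eq_3 (box G H)]
    -- The reserve is extended through `w.2` by the triangle inequality; its new part and the new
    -- edge of the first half are paid for by the step from `v` to `w` in the box product.
    calc _ ≤ (dist H v.2 w.2 + dist H w.2 y) +
          (dist G v.1 w.1 + len G (w.1 :: a) + len H (y :: b)) := by
            gcongr; exact dist_triangle H _ _ _
      _ = (dist G v.1 w.1 + dist H v.2 w.2) +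
          (dist H w.2 y + (len G (w.1 :: a) + len H (y :: b))) := by ring
      _ ≤ _ := add_le_add (dist_add_dist_le_box G H v w) h₄

/-- The step from `v` to `(v.1, y)` moves only the second coordinate, so its length is at most the
reserve kept in `aw_mem`. -/
theorem consL_awShuf_mem (G : Digraph V) (H : Digraph W) (v : V × W) (l : List (V × W))
    (h : v :: l ∈ reachSet (box G H)) :
    consL v (awShuf R (v :: l)) ∈ Finsupp.supported R R {m | ∃ m', m = v :: m' ∧
      m ∈ reachSet (box G H) ∧ len (box G H) m ≤ len (box G H) (v :: l) ∧
      m.length = l.length + 2} := by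
  have hz : aw R (v :: l) ∈ Finsupp.supported R R _ ⊓ Finsupp.supported R R _ :=
    ⟨aw_mem G H v l h, aw_length (v :: l)⟩
  rw [← Finsupp.supported_inter] at hz
  refine mem_of_supported (f := (consL v).comp (shufL R)) (fun c hc => ?_) hz
  obtain ⟨⟨a, y, b, rfl, h₁, h₂, h₃, h₄⟩, h₅⟩ := hc
  have h₅ : (v.1 :: a).length + (y :: b).length = (v :: l).length + 1 := h₅
  rw [LinearMap.comp_apply, shufL_single]
  refine mem_of_supported (fun m hm => ?_) (shuffle_mem G H v.1 a y b h₁ h₂)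
  obtain ⟨m', rfl, g₁, g₂, g₃⟩ := hm
  rw [consL_single]
  refine Finsupp.single_mem_supported _ _ ⟨_, rfl, .cons_cons (h₃.map (inrMap G H v.1)) g₁, ?_, ?_⟩
  · rw [len]
    exact (add_le_add (dist_map_le (inrMap G H v.1) v.2 y) g₂).trans h₄
  · simp only [List.length_cons] at h₅ ⊢
    omega

theorem ezHtpy_mem (G : Digraph V) (H : Digraph W) : ∀ (v : V × W) (l : List (V × W)),
    v :: l ∈ reachSet (box G H) →
    ezHtpy R (v :: l) ∈ Finsupp.supported R R {m | ∃ m', m = v :: m' ∧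
      m ∈ reachSet (box G H) ∧ len (box G H) m ≤ len (box G H) (v :: l) ∧
      m.length = l.length + 2}
  | v, [], h => by
    have := consL_awShuf_mem (R := R) G H v [] h
    rwa [ezHtpy, ezHtpy, sub_zero]
  | v, w :: l, h => by
    rw [ezHtpy, map_sub]
    refine Submodule.sub_mem _ (consL_awShuf_mem G H v _ h) ?_
    refine mem_of_supported (fun m hm => ?_) (ezHtpy_mem G H w l (List.IsChain.tail h))
    obtain ⟨m', rfl, g₁, g₂, g₃⟩ := hm
    rw [consL_single]
    refine Finsupp.single_mem_supported _ _
      ⟨_, rfl, .cons_cons (List.isChain_cons_cons.1 h).1 g₁, add_le_add le_rfl g₂, ?_⟩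
    simp only [List.length_cons] at g₃ ⊢
    omega

end Lengths

/-! ### Flatness, and maps of direct sums along maps of index sets. -/

section Algebra

variable {R : Type*} [CommRing R]

section Lift

/-- The factorization of a linear map through a surjective one. -/
def liftSurj {M N P : Type*} [AddCommMonoid M] [Module R M] [AddCommMonoid N] [Module R N]
    [AddCommMonoid P] [Module R P] (g : M →ₗ[R] N) (hg : Function.Surjective g) (f : M →ₗ[R] P)
    (h : ∀ x y, g x = g y → f x = f y) : N →ₗ[R] P where
  toFun n := f (Function.surjInv hg n)
  map_add' a b := by
    rw [← map_add]
    exact h _ _ (by rw [map_add]; simp only [Function.surjInv_eq hg])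
  map_smul' c a := by
    rw [← map_smul]
    exact h _ _ (by rw [map_smul]; simp only [Function.surjInv_eq hg, RingHom.id_apply])

theorem liftSurj_apply {M N P : Type*} [AddCommMonoid M] [Module R M] [AddCommMonoid N]
    [Module R N] [AddCommMonoid P] [Module R P] (g : M →ₗ[R] N) (hg : Function.Surjective g)
    (f : M →ₗ[R] P) (h : ∀ x y, g x = g y → f x = f y) (x : M) :
    liftSurj g hg f h (g x) = f x :=
  h _ _ (Function.surjInv_eq hg _)

variable {M N P : Type*} [AddCommGroup M] [Module R M] [AddCommGroup N] [Module R N]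
  [AddCommGroup P] [Module R P]

theorem lTensor_rTensor_apply {Q : Type*} [AddCommGroup Q] [Module R Q] (a : M →ₗ[R] N)
    (b : P →ₗ[R] Q) (z : M ⊗[R] P) :
    b.lTensor N (a.rTensor P z) = a.rTensor Q (b.lTensor M z) := by
  rw [← LinearMap.comp_apply, ← LinearMap.comp_apply, LinearMap.lTensor_comp_rTensor,
    LinearMap.rTensor_comp_lTensor]

/-- This is the vanishing of Tor₁(P, Q) as a diagram chase. Let K be the kernel of F → Q. An element
of the kernel lifts to M ⊗ F, and its image in N ⊗ F comes from N ⊗ K. Flatness of P makes P ⊗ K → P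
⊗ F injective, so that element comes from M ⊗ K; flatness of F then identifies it with the lift,
which therefore dies in M ⊗ Q. -/
theorem rTensor_injective_of_flat_cover {Q F : Type*} [AddCommGroup Q] [Module R Q]
    [AddCommGroup F] [Module R F] [Module.Flat R F] [Module.Flat R P]
    (ψ : F →ₗ[R] Q) (hψ : Function.Surjective ψ)
    (f : M →ₗ[R] N) (g : N →ₗ[R] P) (hf : Function.Injective f) (hfg : Function.Exact f g)
    (hg : Function.Surjective g) : Function.Injective (f.rTensor Q) := by
  let κ : LinearMap.ker ψ →ₗ[R] F := (LinearMap.ker ψ).subtype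
  have hκ : Function.Exact κ ψ := LinearMap.exact_subtype_ker_map ψ
  rw [← LinearMap.ker_eq_bot, LinearMap.ker_eq_bot']
  intro x hx
  obtain ⟨x, rfl⟩ := LinearMap.lTensor_surjective M hψ x
  have h₁ : ψ.lTensor N (f.rTensor _ x) = 0 := by
    rw [lTensor_rTensor_apply, hx]
  obtain ⟨y, hy⟩ := (lTensor_exact N hκ hψ _).1 h₁
  have h₂ : κ.lTensor P (g.rTensor _ y) = 0 := by
    rw [lTensor_rTensor_apply, hy, ← LinearMap.comp_apply, ← LinearMap.rTensor_comp,
      hfg.linearMap_comp_eq_zero, LinearMap.rTensor_zero, LinearMap.zero_apply]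
  have h₃ : g.rTensor _ y = 0 := Module.Flat.lTensor_preserves_injective_linearMap (M := P) κ
    (Submodule.subtype_injective _) (h₂.trans (map_zero _).symm)
  obtain ⟨z, rfl⟩ := (rTensor_exact _ hfg hg _).1 h₃
  have h₄ : f.rTensor F (κ.lTensor M z) = f.rTensor _ x := by
    rw [← hy, lTensor_rTensor_apply]
  have h₅ := Module.Flat.rTensor_preserves_injective_linearMap (M := F) f hf h₄
  exact (lTensor_exact M hκ hψ _).2 ⟨z, h₅⟩

/-- Tensoring with any module preserves the injectivity of a map with flat cokernel. -/
theorem rTensor_injective_of_flat_coker {Q : Type*} [AddCommGroup Q] [Module R Q] [Module.Flat R P]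
    (f : M →ₗ[R] N) (g : N →ₗ[R] P) (hf : Function.Injective f) (hfg : Function.Exact f g)
    (hg : Function.Surjective g) : Function.Injective (f.rTensor Q) := by
  let ψ : (Q →₀ R) →ₗ[R] Q := Finsupp.linearCombination R id
  have hψ : Function.Surjective ψ := Finsupp.linearCombination_id_surjective R Q
  exact rTensor_injective_of_flat_cover ψ hψ f g hf hfg hg

/-- Flat means torsion-free here, and submodules inherit this. It is the point at which the
principal ideal domain is needed, to make cycles and boundaries flat. -/
theorem flat_submodule [IsDomain R] [IsPrincipalIdealRing R] [Module.Flat R M]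
    (N : Submodule R M) : Module.Flat R N := by
  rw [Module.Flat.flat_iff_torsion_eq_bot_of_isBezout, Submodule.eq_bot_iff]
  intro x hx
  obtain ⟨a, ha⟩ := (Submodule.mem_torsion_iff _).1 hx
  have : (x : M) ∈ Submodule.torsion R M :=
    (Submodule.mem_torsion_iff _).2 ⟨a, by rw [← Submodule.coe_zero (p := N), ← ha]; rfl⟩
  rw [Module.Flat.torsion_eq_bot] at this
  exact Subtype.ext this

theorem exact_smul_left {ε : R} (hε : ε * ε = 1) {f : M →ₗ[R] N} {g : N →ₗ[R] P}
    (h : Function.Exact f g) : Function.Exact (ε • f) g := fun y => by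
  rw [h y]
  constructor
  · rintro ⟨x, rfl⟩
    exact ⟨ε • x, by simp [smul_smul, hε]⟩
  · rintro ⟨x, rfl⟩
    exact ⟨ε • x, by simp⟩

theorem exact_smul_right {ε : R} (hε : ε * ε = 1) {f : M →ₗ[R] N} {g : N →ₗ[R] P}
    (h : Function.Exact f g) : Function.Exact f (ε • g) := fun y => by
  rw [← h y, LinearMap.smul_apply]
  refine ⟨fun e => ?_, fun e => by rw [e, smul_zero]⟩
  rw [← one_smul R (g y), ← hε, mul_smul, e, smul_zero]

end Lift

section Along

variable {ι κ μ : Type*} [DecidableEq ι] [DecidableEq κ] [DecidableEq μ]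
  {X : ι → Type*} [∀ i, AddCommGroup (X i)] [∀ i, Module R (X i)]
  {Y : κ → Type*} [∀ i, AddCommGroup (Y i)] [∀ i, Module R (Y i)]
  {T : μ → Type*} [∀ i, AddCommGroup (T i)] [∀ i, Module R (T i)]

/-- The map of direct sums given by a map of the index sets and a family of linear maps. -/
def lmapAlong (σ : ι → κ) (f : ∀ i, X i →ₗ[R] Y (σ i)) : (⨁ i, X i) →ₗ[R] ⨁ k, Y k :=
  DirectSum.toModule R ι _ fun i => DirectSum.lof R κ Y (σ i) ∘ₗ f i

@[simp] theorem lmapAlong_lof (σ : ι → κ) (f : ∀ i, X i →ₗ[R] Y (σ i)) (i : ι) (x : X i) :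
    lmapAlong σ f (DirectSum.lof R ι X i x) = DirectSum.lof R κ Y (σ i) (f i x) := by
  simp [lmapAlong]

/-- Injectivity of `σ` keeps distinct summands apart. Reindexing along `σ` lets maps shift bidegrees
without transport along equalities. -/
theorem lmapAlong_apply {σ : ι → κ} (hσ : Function.Injective σ) (f : ∀ i, X i →ₗ[R] Y (σ i))
    (x : ⨁ i, X i) (i : ι) : lmapAlong σ f x (σ i) = f i (x i) := by
  have : DirectSum.component R κ Y (σ i) ∘ₗ lmapAlong σ f = f i ∘ₗ DirectSum.component R ι X i := by
    refine DirectSum.linearMap_ext _ fun j => LinearMap.ext fun a => ?_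
    simp only [LinearMap.comp_apply, lmapAlong_lof]
    by_cases h : j = i
    · subst h
      rw [DirectSum.component.lof_self, DirectSum.component.lof_self]
    · rw [DirectSum.component.of, DirectSum.component.of, dif_neg (fun e => h (hσ e)), dif_neg h,
        map_zero]
  exact LinearMap.congr_fun this x

theorem mem_of_forall_lof_mem {N : Submodule R (⨁ k, Y k)} {x : ⨁ k, Y k}
    (h : ∀ k, DirectSum.lof R κ Y k (x k) ∈ N) : x ∈ N := by
  classical
  rw [← DirectSum.sum_support_of x]
  exact Submodule.sum_mem _ fun k _ => h k

theorem lmapAlong_injective {σ : ι → κ} (hσ : Function.Injective σ) {f : ∀ i, X i →ₗ[R] Y (σ i)}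
    (hf : ∀ i, Function.Injective (f i)) : Function.Injective (lmapAlong σ f) := by
  rw [← LinearMap.ker_eq_bot, LinearMap.ker_eq_bot']
  intro x hx
  refine DFinsupp.ext fun i => hf i ?_
  have := lmapAlong_apply hσ f x i
  rw [hx] at this
  exact this.symm.trans (map_zero _).symm

theorem lmapAlong_surjective {σ : ι → κ} (hσ : Function.Surjective σ)
    {f : ∀ i, X i →ₗ[R] Y (σ i)} (hf : ∀ i, Function.Surjective (f i)) :
    Function.Surjective (lmapAlong σ f) := fun y => by
  refine mem_of_forall_lof_mem (N := LinearMap.range (lmapAlong σ f)) fun k => ?_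
  obtain ⟨i, rfl⟩ := hσ k
  obtain ⟨x, hx⟩ := hf i (y (σ i))
  exact ⟨DirectSum.lof R ι X i x, by rw [lmapAlong_lof, hx]⟩

theorem lmapAlong_exact {σ : ι → κ} {τ : κ → μ} (hσ : Function.Surjective σ)
    (hτ : Function.Injective τ) {f : ∀ i, X i →ₗ[R] Y (σ i)} {g : ∀ k, Y k →ₗ[R] T (τ k)}
    (h : ∀ i, Function.Exact (f i) (g (σ i))) :
    Function.Exact (lmapAlong σ f) (lmapAlong τ g) := fun y => by
  constructor
  · intro hy
    refine mem_of_forall_lof_mem (N := LinearMap.range (lmapAlong σ f)) fun k => ?_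
    obtain ⟨i, rfl⟩ := hσ k
    have := lmapAlong_apply hτ g y (σ i)
    rw [hy] at this
    obtain ⟨x, hx⟩ := (h i _).1 this.symm
    exact ⟨DirectSum.lof R ι X i x, by rw [lmapAlong_lof, hx]⟩
  · rintro ⟨x, rfl⟩
    have : lmapAlong τ g ∘ₗ lmapAlong σ f = 0 := by
      refine DirectSum.linearMap_ext _ fun j => LinearMap.ext fun a => ?_
      simp [(h j).apply_apply_eq_zero]
    exact LinearMap.congr_fun this x

end Along

end Algebra

/-! ### Tensor products of bigraded modules and maps of bidegree (-r, r-1). -/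

section TensorSums

variable (R : Type*) [CommRing R]

/-- The sign `(-1)ᵏ`. -/
def sgn (k : ℤ) : R := ((k.negOnePow : ℤ) : R)

variable {R}

theorem sgn_mul_self (k : ℤ) : sgn R k * sgn R k = 1 := by
  rw [sgn, ← Int.cast_mul, ← Units.val_mul, Int.units_mul_self]
  simp

theorem sgn_eq_neg {k l : ℤ} (h : l = k - 1) : sgn R l = -sgn R k := by
  subst h
  simp [sgn, Int.negOnePow_sub]

theorem smul_eq_neg_neg_smul {M : Type*} [AddCommGroup M] [Module R M] (a : R) (x : M) :
    a • x = -(-a • x) := by simp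

variable {r p q : ℤ}

/-- Shifting the first bidegree by `(-r, r-1)`. -/
abbrev Split.left (r : ℤ) (i : Split p q) : Split (p - r) (q + r - 1) :=
  ⟨i.m - r, i.n + r - 1, i.u, i.v, by have := i.hp; omega, by have := i.hq; omega⟩

/-- Shifting the second bidegree by `(-r, r-1)`. -/
abbrev Split.right (r : ℤ) (i : Split p q) : Split (p - r) (q + r - 1) :=
  ⟨i.m, i.n, i.u - r, i.v + r - 1, by have := i.hp; omega, by have := i.hq; omega⟩

theorem Split.left_bijective : Function.Bijective (Split.left r : Split p q → _) := by
  constructor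
  · intro i j h
    simp only [Split.left, Split.mk.injEq] at h
    ext <;> omega
  · intro j
    refine ⟨⟨j.m + r, j.n - r + 1, j.u, j.v, by have := j.hp; omega, by have := j.hq; omega⟩, ?_⟩
    ext <;> simp only <;> omega

theorem Split.right_bijective : Function.Bijective (Split.right r : Split p q → _) := by
  constructor
  · intro i j h
    simp only [Split.right, Split.mk.injEq] at h
    ext <;> omega
  · intro j
    refine ⟨⟨j.m, j.n, j.u + r, j.v - r + 1, by have := j.hp; omega, by have := j.hq; omega⟩, ?_⟩
    ext <;> simp only <;> omega

variable (R) in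
/-- The bidegree `(p,q)` part of the tensor product of two bigraded modules. -/
abbrev TensorSum (X Y : ℤ → ℤ → Type*) [∀ m n, AddCommGroup (X m n)] [∀ m n, Module R (X m n)]
    [∀ m n, AddCommGroup (Y m n)] [∀ m n, Module R (Y m n)] (p q : ℤ) :=
  ⨁ i : Split p q, X i.m i.n ⊗[R] Y i.u i.v

variable {X X' X'' Y Y' Y'' : ℤ → ℤ → Type*}
  [∀ m n, AddCommGroup (X m n)] [∀ m n, Module R (X m n)]
  [∀ m n, AddCommGroup (X' m n)] [∀ m n, Module R (X' m n)]
  [∀ m n, AddCommGroup (X'' m n)] [∀ m n, Module R (X'' m n)]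
  [∀ m n, AddCommGroup (Y'' m n)] [∀ m n, Module R (Y'' m n)]
  [∀ m n, AddCommGroup (Y' m n)] [∀ m n, Module R (Y' m n)]
  [∀ m n, AddCommGroup (Y m n)] [∀ m n, Module R (Y m n)]

/-- The map induced by a map of the first factors. -/
def mapL (f : ∀ m n, X m n →ₗ[R] X' m n) : TensorSum R X Y p q →ₗ[R] TensorSum R X' Y p q :=
  lmapAlong id fun i => (f i.m i.n).rTensor _

/-- The map induced by a map of the second factors. -/
def mapR (g : ∀ u v, Y u v →ₗ[R] Y' u v) : TensorSum R X Y p q →ₗ[R] TensorSum R X Y' p q :=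
  lmapAlong id fun i => (g i.u i.v).lTensor _

/-- The map induced by a map of bidegree `(-r, r-1)` of the first factors. -/
def shiftL (f : ∀ m n, X m n →ₗ[R] X' (m - r) (n + r - 1)) :
    TensorSum R X Y p q →ₗ[R] TensorSum R X' Y (p - r) (q + r - 1) :=
  lmapAlong (Split.left r) fun i => (f i.m i.n).rTensor _

/-- The map induced by a map of bidegree `(-r, r-1)` of the second factors, with the Koszul
sign. -/
def shiftR (g : ∀ u v, Y u v →ₗ[R] Y' (u - r) (v + r - 1)) :
    TensorSum R X Y p q →ₗ[R] TensorSum R X Y' (p - r) (q + r - 1) :=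
  lmapAlong (Split.right r) fun i => sgn R (i.m + i.n) • (g i.u i.v).lTensor _

variable {m n u v : ℤ}

/-- The class of `x ⊗ y`. -/
def ten (hp : m + u = p) (hq : n + v = q) (x : X m n) (y : Y u v) : TensorSum R X Y p q :=
  DirectSum.lof R (Split p q) (fun i => X i.m i.n ⊗[R] Y i.u i.v) ⟨m, n, u, v, hp, hq⟩ (x ⊗ₜ y)

theorem tensorSum_ext {M : Type*} [AddCommGroup M] [Module R M]
    {f g : TensorSum R X Y p q →ₗ[R] M}
    (h : ∀ m n u v hp hq (x : X m n) (y : Y u v), f (ten hp hq x y) = g (ten hp hq x y)) : f = g :=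
  DirectSum.linearMap_ext _ fun i => TensorProduct.ext' fun x y => h _ _ _ _ i.hp i.hq x y

theorem ten_zero_left (hp : m + u = p) (hq : n + v = q) (y : Y u v) :
    ten (R := R) (X := X) hp hq 0 y = 0 := by simp [ten]

theorem ten_zero_right (hp : m + u = p) (hq : n + v = q) (x : X m n) :
    ten (R := R) (Y := Y) hp hq x 0 = 0 := by simp [ten]

@[simp] theorem mapL_ten (f : ∀ m n, X m n →ₗ[R] X' m n) (hp : m + u = p) (hq : n + v = q)
    (x : X m n) (y : Y u v) : mapL (R := R) f (ten hp hq x y) = ten hp hq (f _ _ x) y :=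
  lmapAlong_lof ..

@[simp] theorem mapR_ten (g : ∀ m n, Y m n →ₗ[R] Y' m n) (hp : m + u = p) (hq : n + v = q)
    (x : X m n) (y : Y u v) : mapR (R := R) g (ten hp hq x y) = ten hp hq x (g _ _ y) :=
  lmapAlong_lof ..

theorem shiftL_ten (f : ∀ m n, X m n →ₗ[R] X' (m - r) (n + r - 1)) (hp : m + u = p)
    (hq : n + v = q) (x : X m n) (y : Y u v) :
    shiftL (R := R) f (ten hp hq x y) =
      ten (m := m - r) (n := n + r - 1) (by omega) (by omega) (f _ _ x) y :=
  lmapAlong_lof ..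

theorem shiftR_ten (g : ∀ m n, Y m n →ₗ[R] Y' (m - r) (n + r - 1)) (hp : m + u = p)
    (hq : n + v = q) (x : X m n) (y : Y u v) :
    shiftR (R := R) g (ten hp hq x y) = sgn R (m + n) •
      ten (u := u - r) (v := v + r - 1) (by omega) (by omega) x (g _ _ y) := by
  refine (lmapAlong_lof ..).trans ?_
  rw [LinearMap.smul_apply, map_smul]
  rfl

theorem mapL_mapR (f : ∀ m n, X m n →ₗ[R] X' m n) (g : ∀ m n, Y m n →ₗ[R] Y' m n)
    (t : TensorSum R X Y p q) : mapL f (mapR g t) = mapR g (mapL f t) := by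
  have : mapL (R := R) (p := p) (q := q) f ∘ₗ mapR g = mapR g ∘ₗ mapL f :=
    tensorSum_ext fun m n u v hp hq x y => by simp
  exact LinearMap.congr_fun this t

theorem mapR_mapR {f : ∀ m n, Y m n →ₗ[R] Y' m n} {f' : ∀ m n, Y' m n →ₗ[R] Y'' m n}
    {f'' : ∀ m n, Y m n →ₗ[R] Y'' m n} (h : ∀ m n x, f' m n (f m n x) = f'' m n x)
    (t : TensorSum R X Y p q) : mapR f' (mapR f t) = mapR f'' t := by
  have : mapR (R := R) (p := p) (q := q) (X := X) f' ∘ₗ mapR f = mapR f'' :=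
    tensorSum_ext fun m n u v hp hq x y => by simp [h]
  exact LinearMap.congr_fun this t

theorem mapR_shiftL (f : ∀ m n, X m n →ₗ[R] X' (m - r) (n + r - 1))
    (g : ∀ m n, Y m n →ₗ[R] Y' m n) (t : TensorSum R X Y p q) :
    mapR g (shiftL f t) = shiftL f (mapR g t) := by
  have : mapR g ∘ₗ shiftL (R := R) (p := p) (q := q) f = shiftL f ∘ₗ mapR g :=
    tensorSum_ext fun m n u v hp hq x y => by
      simp only [LinearMap.comp_apply, mapR_ten, shiftL_ten]
  exact LinearMap.congr_fun this t

theorem mapL_shiftR (f : ∀ m n, X m n →ₗ[R] X' m n)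
    (g : ∀ m n, Y m n →ₗ[R] Y' (m - r) (n + r - 1)) (t : TensorSum R X Y p q) :
    mapL f (shiftR g t) = shiftR g (mapL f t) := by
  have : mapL f ∘ₗ shiftR (R := R) (p := p) (q := q) g = shiftR g ∘ₗ mapL f :=
    tensorSum_ext fun m n u v hp hq x y => by
      simp only [LinearMap.comp_apply, mapL_ten, shiftR_ten, map_smul]
  exact LinearMap.congr_fun this t

/-- A shift by (-r, r-1) lowers the total degree by one, so the Koszul sign changes once. -/
theorem shiftL_shiftR (f : ∀ m n, X m n →ₗ[R] X' (m - r) (n + r - 1))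
    (g : ∀ m n, Y m n →ₗ[R] Y' (m - r) (n + r - 1)) (t : TensorSum R X Y p q) :
    shiftL f (shiftR g t) = -shiftR g (shiftL f t) := by
  have : shiftL f ∘ₗ shiftR (R := R) (p := p) (q := q) g = -(shiftR g ∘ₗ shiftL f) :=
    tensorSum_ext fun m n u v hp hq x y => by
      simp only [LinearMap.comp_apply, LinearMap.neg_apply, shiftL_ten, shiftR_ten, map_smul]
      rw [sgn_eq_neg (R := R) (k := m + n) (l := m - r + (n + r - 1)) (by ring)]
      exact smul_eq_neg_neg_smul (M := TensorSum R X' Y' (p - r - r) (q + r - 1 + r - 1)) _ _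
  exact LinearMap.congr_fun this t

theorem mapL_shiftL {f : ∀ m n, X m n →ₗ[R] X' (m - r) (n + r - 1)}
    {f' : ∀ m n, X' m n →ₗ[R] X'' m n} {f'' : ∀ m n, X m n →ₗ[R] X'' (m - r) (n + r - 1)}
    (h : ∀ m n x, f' _ _ (f m n x) = f'' m n x)
    (t : TensorSum R X Y p q) : mapL f' (shiftL f t) = shiftL f'' t := by
  have : mapL f' ∘ₗ shiftL (R := R) (p := p) (q := q) (Y := Y) f = shiftL f'' :=
    tensorSum_ext fun m n u v hp hq x y => by
      simp only [LinearMap.comp_apply, mapL_ten, shiftL_ten, ← h]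
  exact LinearMap.congr_fun this t

theorem shiftL_mapL {f : ∀ m n, X m n →ₗ[R] X' m n}
    {f' : ∀ m n, X' m n →ₗ[R] X'' (m - r) (n + r - 1)}
    {f'' : ∀ m n, X m n →ₗ[R] X'' (m - r) (n + r - 1)}
    (h : ∀ m n x, f' m n (f m n x) = f'' m n x)
    (t : TensorSum R X Y p q) : shiftL f' (mapL f t) = shiftL f'' t := by
  have : shiftL f' ∘ₗ mapL (R := R) (p := p) (q := q) (Y := Y) f = shiftL f'' :=
    tensorSum_ext fun m n u v hp hq x y => by
      simp only [LinearMap.comp_apply, mapL_ten, shiftL_ten, ← h]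
  exact LinearMap.congr_fun this t

theorem mapR_shiftR {f : ∀ m n, Y m n →ₗ[R] Y' (m - r) (n + r - 1)}
    {f' : ∀ m n, Y' m n →ₗ[R] Y'' m n} {f'' : ∀ m n, Y m n →ₗ[R] Y'' (m - r) (n + r - 1)}
    (h : ∀ m n x, f' _ _ (f m n x) = f'' m n x)
    (t : TensorSum R X Y p q) : mapR f' (shiftR f t) = shiftR f'' t := by
  have : mapR f' ∘ₗ shiftR (R := R) (p := p) (q := q) (X := X) f = shiftR f'' :=
    tensorSum_ext fun m n u v hp hq x y => by
      simp only [LinearMap.comp_apply, mapR_ten, shiftR_ten, ← h, map_smul]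
  exact LinearMap.congr_fun this t

theorem shiftR_mapR {f : ∀ m n, Y m n →ₗ[R] Y' m n}
    {f' : ∀ m n, Y' m n →ₗ[R] Y'' (m - r) (n + r - 1)}
    {f'' : ∀ m n, Y m n →ₗ[R] Y'' (m - r) (n + r - 1)}
    (h : ∀ m n x, f' m n (f m n x) = f'' m n x)
    (t : TensorSum R X Y p q) : shiftR f' (mapR f t) = shiftR f'' t := by
  have : shiftR f' ∘ₗ mapR (R := R) (p := p) (q := q) (X := X) f = shiftR f'' :=
    tensorSum_ext fun m n u v hp hq x y => by
      simp only [LinearMap.comp_apply, mapR_ten, shiftR_ten, ← h]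
  exact LinearMap.congr_fun this t

theorem shiftL_shiftL {f : ∀ m n, X m n →ₗ[R] X' (m - r) (n + r - 1)}
    {f' : ∀ m n, X' m n →ₗ[R] X'' (m - r) (n + r - 1)} (h : ∀ m n x, f' _ _ (f m n x) = 0)
    (t : TensorSum R X Y p q) : shiftL f' (shiftL f t) = 0 := by
  have : shiftL f' ∘ₗ shiftL (R := R) (p := p) (q := q) (Y := Y) f = 0 :=
    tensorSum_ext fun m n u v hp hq x y => by
      simp only [LinearMap.comp_apply, shiftL_ten, LinearMap.zero_apply, h, ten_zero_left]
  exact LinearMap.congr_fun this t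

theorem shiftR_shiftR {f : ∀ m n, Y m n →ₗ[R] Y' (m - r) (n + r - 1)}
    {f' : ∀ m n, Y' m n →ₗ[R] Y'' (m - r) (n + r - 1)} (h : ∀ m n x, f' _ _ (f m n x) = 0)
    (t : TensorSum R X Y p q) : shiftR f' (shiftR f t) = 0 := by
  have : shiftR f' ∘ₗ shiftR (R := R) (p := p) (q := q) (X := X) f = 0 :=
    tensorSum_ext fun m n u v hp hq x y => by
      simp only [LinearMap.comp_apply, shiftR_ten, LinearMap.zero_apply, map_smul, h,
        ten_zero_right, smul_zero]
  exact LinearMap.congr_fun this t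

theorem shiftL_zero (t : TensorSum R X Y p q) :
    shiftL (R := R) (X := X) (X' := X') (r := r) (fun _ _ => 0) t = 0 := by
  have : shiftL (R := R) (X := X) (X' := X') (r := r) (Y := Y) (p := p) (q := q)
      (fun _ _ => 0) = 0 := tensorSum_ext fun m n u v hp hq x y => by
        simp [shiftL_ten, ten_zero_left]
  exact LinearMap.congr_fun this t

theorem shiftR_zero (t : TensorSum R X Y p q) :
    shiftR (R := R) (Y := Y) (Y' := Y') (r := r) (fun _ _ => 0) t = 0 := by
  have : shiftR (R := R) (Y := Y) (Y' := Y') (r := r) (X := X) (p := p) (q := q)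
      (fun _ _ => 0) = 0 := tensorSum_ext fun m n u v hp hq x y => by
        simp [shiftR_ten, ten_zero_right]
  exact LinearMap.congr_fun this t

theorem mapL_surjective {f : ∀ m n, X m n →ₗ[R] X' m n} (h : ∀ m n, Function.Surjective (f m n)) :
    Function.Surjective (mapL f : TensorSum R X Y p q →ₗ[R] _) :=
  lmapAlong_surjective Function.surjective_id fun _ => LinearMap.rTensor_surjective _ (h _ _)

theorem mapR_surjective {f : ∀ m n, Y m n →ₗ[R] Y' m n} (h : ∀ m n, Function.Surjective (f m n)) :
    Function.Surjective (mapR f : TensorSum R X Y p q →ₗ[R] _) :=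
  lmapAlong_surjective Function.surjective_id fun _ => LinearMap.lTensor_surjective _ (h _ _)

theorem shiftL_surjective {f : ∀ m n, X m n →ₗ[R] X' (m - r) (n + r - 1)}
    (h : ∀ m n, Function.Surjective (f m n)) :
    Function.Surjective (shiftL f : TensorSum R X Y p q →ₗ[R] _) :=
  lmapAlong_surjective Split.left_bijective.2 fun _ => LinearMap.rTensor_surjective _ (h _ _)

theorem mapR_injective {f : ∀ m n, Y m n →ₗ[R] Y' m n} (h : ∀ m n, Function.Injective (f m n))
    (hX : ∀ m n, Module.Flat R (X m n)) :
    Function.Injective (mapR f : TensorSum R X Y p q →ₗ[R] _) :=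
  lmapAlong_injective Function.injective_id fun i =>
    have := hX i.m i.n
    Module.Flat.lTensor_preserves_injective_linearMap _ (h _ _)

theorem mapL_injective {f : ∀ m n, X m n →ₗ[R] X' m n}
    (h : ∀ m n u v, Function.Injective ((f m n).rTensor (Y u v))) :
    Function.Injective (mapL f : TensorSum R X Y p q →ₗ[R] _) :=
  lmapAlong_injective Function.injective_id fun _ => h _ _ _ _

theorem mapL_exact {f : ∀ m n, X m n →ₗ[R] X' m n} {g : ∀ m n, X' m n →ₗ[R] X'' m n}
    (h : ∀ m n, Function.Exact (f m n) (g m n)) (hg : ∀ m n, Function.Surjective (g m n)) :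
    Function.Exact (mapL f : TensorSum R X Y p q →ₗ[R] _) (mapL g) :=
  lmapAlong_exact Function.surjective_id Function.injective_id fun _ =>
    rTensor_exact _ (h _ _) (hg _ _)

theorem mapL_shiftL_exact {f : ∀ m n, X m n →ₗ[R] X' m n}
    {g : ∀ m n, X' m n →ₗ[R] X'' (m - r) (n + r - 1)}
    (h : ∀ m n, Function.Exact (f m n) (g m n)) (hg : ∀ m n, Function.Surjective (g m n)) :
    Function.Exact (mapL f : TensorSum R X Y p q →ₗ[R] _) (shiftL g) :=
  lmapAlong_exact Function.surjective_id Split.left_bijective.1 fun _ =>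
    rTensor_exact _ (h _ _) (hg _ _)

theorem mapR_shiftR_exact {f : ∀ m n, Y m n →ₗ[R] Y' m n}
    {g : ∀ m n, Y' m n →ₗ[R] Y'' (m - r) (n + r - 1)}
    (h : ∀ m n, Function.Exact (f m n) (g m n)) (hX : ∀ m n, Module.Flat R (X m n)) :
    Function.Exact (mapR f : TensorSum R X Y p q →ₗ[R] _) (shiftR g) :=
  lmapAlong_exact Function.surjective_id Split.right_bijective.1 fun i =>
    have := hX i.m i.n
    exact_smul_right (sgn_mul_self _) (Module.Flat.lTensor_exact _ (h _ _))

theorem shiftR_mapR_exact {f : ∀ m n, Y m n →ₗ[R] Y' (m - r) (n + r - 1)}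
    {g : ∀ m n, Y' m n →ₗ[R] Y'' m n}
    (h : ∀ m n, Function.Exact (f m n) (g _ _)) (hg : ∀ m n, Function.Surjective (g m n)) :
    Function.Exact (shiftR f : TensorSum R X Y p q →ₗ[R] _) (mapR g) :=
  lmapAlong_exact Split.right_bijective.2 Function.injective_id fun _ =>
    exact_smul_left (sgn_mul_self _) (lTensor_exact _ (h _ _) (hg _ _))

end TensorSums

/-! ### Cycles and boundaries of the tensor product of two bigraded complexes. -/

section Homology

/-- A bigraded module `X` with a differential of bidegree `(-r, r-1)`, together with an
identification of its homology with a bigraded module `H`. -/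
structure PageHomology (R : Type*) [CommRing R] (r : ℤ) (X H : ℤ → ℤ → Type*)
    [∀ m n, AddCommGroup (X m n)] [∀ m n, Module R (X m n)]
    [∀ m n, AddCommGroup (H m n)] [∀ m n, Module R (H m n)] where
  d : ∀ m n, X m n →ₗ[R] X (m - r) (n + r - 1)
  d_d : ∀ m n x, d _ _ (d m n x) = 0
  π : ∀ m n, LinearMap.ker (d m n) →ₗ[R] H m n
  π_surjective : ∀ m n, Function.Surjective (π m n)
  π_eq_zero_iff : ∀ m n (z : LinearMap.ker (d (m - r) (n + r - 1))),
    π _ _ z = 0 ↔ ∃ x, d m n x = z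

variable {R : Type*} [CommRing R] {r : ℤ} {X HX Y HY : ℤ → ℤ → Type*}
  [∀ m n, AddCommGroup (X m n)] [∀ m n, Module R (X m n)]
  [∀ m n, AddCommGroup (HX m n)] [∀ m n, Module R (HX m n)]
  [∀ m n, AddCommGroup (Y m n)] [∀ m n, Module R (Y m n)]
  [∀ m n, AddCommGroup (HY m n)] [∀ m n, Module R (HY m n)]

namespace PageHomology

variable (C : PageHomology R r X HX)

/-- The cycles. -/
abbrev Z (m n : ℤ) : Submodule R (X m n) := LinearMap.ker (C.d m n)

/-- The boundaries, as a submodule of the cycles. -/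
abbrev B (m n : ℤ) : Submodule R (C.Z m n) := LinearMap.ker (C.π m n)

/-- The inclusion of the cycles. -/
abbrev iZ (m n : ℤ) : C.Z m n →ₗ[R] X m n := (C.Z m n).subtype

/-- The inclusion of the boundaries. -/
abbrev iB (m n : ℤ) : C.B m n →ₗ[R] C.Z m n := (C.B m n).subtype

/-- The differential, as a map to the cycles. -/
def dZ (m n : ℤ) : X m n →ₗ[R] C.Z (m - r) (n + r - 1) :=
  (C.d m n).codRestrict _ (C.d_d m n)

/-- The differential, as a map to the boundaries. -/
def dB (m n : ℤ) : X m n →ₗ[R] C.B (m - r) (n + r - 1) :=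
  (C.dZ m n).codRestrict _ fun x => (C.π_eq_zero_iff m n _).2 ⟨x, rfl⟩

theorem iZ_dZ (m n : ℤ) (x : X m n) : C.iZ _ _ (C.dZ m n x) = C.d m n x := rfl

theorem iB_dB (m n : ℤ) (x : X m n) : C.iB _ _ (C.dB m n x) = C.dZ m n x := rfl

theorem dZ_exact (m n : ℤ) : Function.Exact (C.dZ m n) (C.π _ _) := fun z =>
  (C.π_eq_zero_iff m n z).trans
    ⟨fun ⟨x, hx⟩ => ⟨x, Subtype.ext hx⟩, fun ⟨x, hx⟩ => ⟨x, congrArg Subtype.val hx⟩⟩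

theorem dB_surjective (m n : ℤ) : Function.Surjective (C.dB m n) := fun b => by
  obtain ⟨x, hx⟩ := (C.dZ_exact m n b).1 b.2
  exact ⟨x, Subtype.ext hx⟩

theorem iZ_exact (m n : ℤ) : Function.Exact (C.iZ m n) (C.d m n) :=
  LinearMap.exact_subtype_ker_map _

theorem iZ_dB_exact (m n : ℤ) : Function.Exact (C.iZ m n) (C.dB m n) := fun x => by
  rw [← C.iZ_exact m n x]
  exact ⟨fun h => congrArg Subtype.val (congrArg Subtype.val h),
    fun h => Subtype.ext (Subtype.ext h)⟩

theorem dB_iZ (m n : ℤ) (z : C.Z m n) : C.dB m n (C.iZ m n z) = 0 :=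
  (C.iZ_dB_exact m n _).2 ⟨z, rfl⟩

theorem dB_d (m n : ℤ) (x : X m n) : C.dB _ _ (C.d m n x) = 0 :=
  C.dB_iZ _ _ (C.dZ m n x)

theorem iB_exact (m n : ℤ) : Function.Exact (C.iB m n) (C.π m n) :=
  LinearMap.exact_subtype_ker_map _

theorem flat_Z [IsDomain R] [IsPrincipalIdealRing R] (hX : ∀ m n, Module.Flat R (X m n))
    (m n : ℤ) : Module.Flat R (C.Z m n) :=
  have := hX m n
  flat_submodule _

theorem flat_B [IsDomain R] [IsPrincipalIdealRing R] (hX : ∀ m n, Module.Flat R (X m n))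
    (m n : ℤ) : Module.Flat R (C.B m n) :=
  have := C.flat_Z hX m n
  flat_submodule _

end PageHomology

section Kunneth

/-- The map `d ⊗ 1` to the tensor product with the boundaries. -/
abbrev PageHomology.shiftB (C : PageHomology R r X HX) {p q : ℤ} : TensorSum R X Y p q →ₗ[R]
    TensorSum R (fun m n => C.B m n) Y (p - r) (q + r - 1) :=
  shiftL (X' := fun m n => C.B m n) C.dB

variable (C : PageHomology R r X HX) (D : PageHomology R r Y HY) {p q : ℤ}

/-- The differential of the tensor product. -/
def tensorD (p q : ℤ) : TensorSum R X Y p q →ₗ[R] TensorSum R X Y (p - r) (q + r - 1) :=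
  shiftL C.d + shiftR D.d

variable {C D}

theorem tensorD_apply (t : TensorSum R X Y p q) :
    tensorD C D p q t = shiftL C.d t + shiftR D.d t := rfl

/-- The part d ⊗ 1 of the differential is killed by a second d ⊗ 1, and the part 1 ⊗ d anticommutes
with it. -/
theorem shiftL_dB_tensorD (t : TensorSum R X Y p q) :
    C.shiftB (tensorD C D p q t) = -shiftR D.d (C.shiftB t) := by
  rw [tensorD_apply, map_add, shiftL_shiftL C.dB_d, zero_add, shiftL_shiftR]

theorem tensorD_mapL_iZ (v : TensorSum R (fun m n => C.Z m n) Y p q) :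
    tensorD C D p q (mapL C.iZ v) = mapL C.iZ (shiftR D.d v) := by
  rw [tensorD_apply, mapL_shiftR, shiftL_mapL (f'' := fun _ _ => 0) (fun _ _ z => z.2), shiftL_zero,
    zero_add]

theorem tensorD_mapR_iZ (c : TensorSum R X (fun m n => D.Z m n) p q) :
    tensorD C D p q (mapR D.iZ c) = mapL C.iZ (mapR D.iZ (mapL C.iB (C.shiftB c))) := by
  rw [tensorD_apply, shiftR_mapR (f'' := fun _ _ => 0) (fun _ _ z => z.2), shiftR_zero,
    add_zero, mapL_mapR, mapL_shiftL C.iB_dB, mapL_shiftL C.iZ_dZ, mapR_shiftL]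

theorem shiftL_dB_mapL_iZ (v : TensorSum R (fun m n => C.Z m n) Y p q) :
    C.shiftB (mapL C.iZ v) = 0 := by
  rw [shiftL_mapL (f'' := fun _ _ => 0) C.dB_iZ, shiftL_zero]

theorem mapR_iZ_shiftR_dZ {A : ℤ → ℤ → Type*} [∀ m n, AddCommGroup (A m n)]
    [∀ m n, Module R (A m n)] (v : TensorSum R A Y p q) :
    mapR D.iZ (shiftR D.dZ v) = shiftR D.d v := mapR_shiftR D.iZ_dZ v

theorem mapR_π_shiftR_dZ {A : ℤ → ℤ → Type*} [∀ m n, AddCommGroup (A m n)]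
    [∀ m n, Module R (A m n)] (v : TensorSum R A Y p q) :
    mapR D.π (shiftR D.dZ v) = 0 :=
  (shiftR_mapR_exact D.dZ_exact D.π_surjective _).2 ⟨v, rfl⟩

variable [IsDomain R] [IsPrincipalIdealRing R] (hX : ∀ m n, Module.Flat R (X m n))

include hX

/-- `Y` is arbitrary, so injectivity has to come from the flat cokernel in 0 → Z → X → B → 0. -/
theorem mapL_iZ_injective : Function.Injective
    (mapL C.iZ : TensorSum R (fun m n => C.Z m n) Y p q →ₗ[R] _) :=
  mapL_injective fun m n _ _ =>
    have := C.flat_B hX (m - r) (n + r - 1)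
    rTensor_injective_of_flat_coker _ (C.dB m n) (Submodule.subtype_injective _)
      (C.iZ_dB_exact m n) (C.dB_surjective m n)

theorem mapR_iZ_injective_Z : Function.Injective
    (mapR D.iZ : TensorSum R (fun m n => C.Z m n) (fun m n => D.Z m n) p q →ₗ[R] _) :=
  mapR_injective (fun _ _ => Submodule.subtype_injective _) (C.flat_Z hX)

theorem mapR_iZ_injective_B : Function.Injective
    (mapR D.iZ : TensorSum R (fun m n => C.B m n) (fun m n => D.Z m n) p q →ₗ[R] _) :=
  mapR_injective (fun _ _ => Submodule.subtype_injective _) (C.flat_B hX)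

/-- By anticommutation 1 ⊗ d kills (d ⊗ 1)t, and flatness of B gives exactness of B ⊗ Z(Y) → B ⊗ Y →
B ⊗ Y. The hypothesis is weaker than `t` being a cycle, because the injectivity of the Künneth map
needs the case where the differential of `t` lies in Z ⊗ Z(Y). -/
theorem exists_mapR_eq_shiftL_dB {t : TensorSum R X Y p q}
    (ht : C.shiftB (tensorD C D p q t) = 0) :
    ∃ y : TensorSum R (fun m n => C.B m n) (fun m n => D.Z m n) _ _,
      mapR D.iZ y = C.shiftB t := by
  rw [shiftL_dB_tensorD, neg_eq_zero] at ht
  exact (mapR_shiftR_exact D.iZ_exact (C.flat_B hX) _).1 ht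

-- A lift `c` of `y` along X ⊗ Z(Y) → B ⊗ Z(Y) accounts for all of (d ⊗ 1)t; the difference of `t`
-- and `c` is killed by X ⊗ Y → B ⊗ Y and comes from Z ⊗ Y by right exactness. The differential is
-- simple on both pieces, being d ⊗ 1 on the first and 1 ⊗ d on the second.
omit [IsDomain R] [IsPrincipalIdealRing R] hX in
theorem exists_eq_add {t : TensorSum R X Y p q}
    {y : TensorSum R (fun m n => C.B m n) (fun m n => D.Z m n) (p - r) (q + r - 1)}
    (h : mapR D.iZ y = C.shiftB t) :
    ∃ (c : TensorSum R X (fun m n => D.Z m n) p q) (v : TensorSum R (fun m n => C.Z m n) Y p q),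
      t = mapR D.iZ c + mapL C.iZ v ∧ C.shiftB c = y := by
  obtain ⟨c, rfl⟩ := shiftL_surjective C.dB_surjective y
  have : C.shiftB (t - mapR D.iZ c) = 0 := by
    rw [map_sub, ← h, mapR_shiftL, sub_self]
  obtain ⟨v, hv⟩ := (mapL_shiftL_exact C.iZ_dB_exact C.dB_surjective _).1 this
  exact ⟨c, v, by rw [hv]; abel, rfl⟩

/-- The differentials of both pieces lie in Z ⊗ Z(Y), which embeds in X ⊗ Y, so an equation in X ⊗ Y
can be read there. -/
theorem eq_of_tensorD_eq {x : TensorSum R (fun m n => C.Z m n) (fun m n => D.Z m n) _ _}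
    {c : TensorSum R X (fun m n => D.Z m n) p q} {v : TensorSum R (fun m n => C.Z m n) Y p q}
    (h : tensorD C D p q (mapR D.iZ c + mapL C.iZ v) = mapL C.iZ (mapR D.iZ x)) :
    mapL C.iB (C.shiftB c) + shiftR D.dZ v = x := by
  rw [map_add, tensorD_mapR_iZ, tensorD_mapL_iZ, ← map_add] at h
  refine mapR_iZ_injective_Z hX ?_
  rw [map_add, mapR_iZ_shiftR_dZ]
  exact mapL_iZ_injective hX h

variable (C D) in
/-- The map sending a cycle `t` to the `y` with `(1 ⊗ ι) y = (d ⊗ 1) t`. -/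
def cycleMap (p q : ℤ) : LinearMap.ker (tensorD C D p q) →ₗ[R]
    TensorSum R (fun m n => C.B m n) (fun m n => D.Z m n) (p - r) (q + r - 1) :=
  (LinearEquiv.ofInjective _ (mapR_iZ_injective_B (C := C) (D := D) hX)).symm.toLinearMap ∘ₗ
    (C.shiftB ∘ₗ (LinearMap.ker (tensorD C D p q)).subtype).codRestrict
      (LinearMap.range (mapR D.iZ)) fun t => exists_mapR_eq_shiftL_dB hX
        ((congrArg _ (LinearMap.mem_ker.1 t.2)).trans (map_zero _))

theorem mapR_cycleMap (t : LinearMap.ker (tensorD C D p q)) :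
    mapR D.iZ (cycleMap C D hX p q t) = C.shiftB t.1 :=
  congrArg Subtype.val ((LinearEquiv.ofInjective _
    (mapR_iZ_injective_B (C := C) (D := D) hX)).apply_symm_apply _)

theorem cycleMap_eq {t : LinearMap.ker (tensorD C D p q)}
    {y : TensorSum R (fun m n => C.B m n) (fun m n => D.Z m n) (p - r) (q + r - 1)}
    (h : mapR D.iZ y = C.shiftB t.1) : cycleMap C D hX p q t = y :=
  mapR_iZ_injective_B hX ((mapR_cycleMap hX t).trans h.symm)

end Kunneth

end Homology

/-! ### The Künneth exact sequence with third term in B ⊗ H(Y). -/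

section Connecting

variable {R : Type*} [CommRing R] {r : ℤ} {X HX Y HY HT : ℤ → ℤ → Type*}
  [∀ m n, AddCommGroup (X m n)] [∀ m n, Module R (X m n)]
  [∀ m n, AddCommGroup (HX m n)] [∀ m n, Module R (HX m n)]
  [∀ m n, AddCommGroup (Y m n)] [∀ m n, Module R (Y m n)]
  [∀ m n, AddCommGroup (HY m n)] [∀ m n, Module R (HY m n)]
  [∀ m n, AddCommGroup (HT m n)] [∀ m n, Module R (HT m n)]

theorem tensorD_tensorD {C : PageHomology R r X HX} {D : PageHomology R r Y HY} {p q : ℤ}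
    (t : TensorSum R X Y p q) : tensorD C D _ _ (tensorD C D p q t) = 0 := by
  rw [tensorD_apply, tensorD_apply, map_add, map_add, shiftL_shiftL C.d_d, shiftR_shiftR D.d_d,
    shiftL_shiftR]
  abel

/-- An identification of the homology of the tensor product of two bigraded complexes. -/
structure TensorHomology (C : PageHomology R r X HX) (D : PageHomology R r Y HY)
    (HT : ℤ → ℤ → Type*) [∀ m n, AddCommGroup (HT m n)] [∀ m n, Module R (HT m n)] where
  π : ∀ p q, LinearMap.ker (tensorD C D p q) →ₗ[R] HT p q
  π_surjective : ∀ p q, Function.Surjective (π p q)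
  π_eq_zero_iff : ∀ p q (t : LinearMap.ker (tensorD C D (p - r) (q + r - 1))),
    π _ _ t = 0 ↔ ∃ x, tensorD C D p q x = t
  ν : ∀ p q, TensorSum R HX HY p q →ₗ[R] HT p q
  ν_map : ∀ p q (z : TensorSum R (fun m n => C.Z m n) (fun m n => D.Z m n) p q)
    (h : mapL C.iZ (mapR D.iZ z) ∈ LinearMap.ker (tensorD C D p q)),
    ν p q (mapL C.π (mapR D.π z)) = π p q ⟨_, h⟩

variable {C : PageHomology R r X HX} {D : PageHomology R r Y HY} {p q : ℤ}

theorem mapL_mapR_iZ_mem (z : TensorSum R (fun m n => C.Z m n) (fun m n => D.Z m n) p q) :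
    mapL C.iZ (mapR D.iZ z) ∈ LinearMap.ker (tensorD C D p q) := by
  rw [LinearMap.mem_ker, tensorD_mapL_iZ, shiftR_mapR (f'' := fun _ _ => 0) (fun _ _ z => z.2),
    shiftR_zero, map_zero]

theorem exists_mapL_mapR_π (w : TensorSum R HX HY p q) :
    ∃ z : TensorSum R (fun m n => C.Z m n) (fun m n => D.Z m n) p q,
      mapL C.π (mapR D.π z) = w := by
  obtain ⟨w, rfl⟩ := mapL_surjective C.π_surjective w
  obtain ⟨z, rfl⟩ := mapR_surjective D.π_surjective w
  exact ⟨z, rfl⟩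

/-- Boundaries are described only in the target bidegrees of differentials; every bidegree has this
form. -/
theorem exists_eq_sub (p q r : ℤ) : ∃ p' q', p = p' - r ∧ q = q' + r - 1 :=
  ⟨p + r, q - r + 1, by ring, by ring⟩

variable [IsDomain R] [IsPrincipalIdealRing R] (hX : ∀ m n, Module.Flat R (X m n))
  (P : TensorHomology C D HT)

include hX

/-- If `z` in Z ⊗ Z(Y) bounds, splitting the bounding element as in `exists_eq_add` writes `z` as an
element of B ⊗ Z(Y) plus an image of 1 ⊗ d. The first dies in the left homology factor and the
second in the right one. -/
theorem TensorHomology.ν_injective (p q : ℤ) : Function.Injective (P.ν p q) := by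
  rw [← LinearMap.ker_eq_bot, LinearMap.ker_eq_bot']
  intro w hw
  obtain ⟨p, q, rfl, rfl⟩ := exists_eq_sub p q r
  obtain ⟨z, rfl⟩ := exists_mapL_mapR_π (C := C) (D := D) w
  rw [P.ν_map _ _ z (mapL_mapR_iZ_mem z), P.π_eq_zero_iff] at hw
  obtain ⟨t, ht⟩ := hw
  have ht : tensorD C D p q t = mapL C.iZ (mapR D.iZ z) := ht
  obtain ⟨y, hy⟩ := exists_mapR_eq_shiftL_dB hX (t := t) (D := D)
    (by rw [ht, shiftL_dB_mapL_iZ])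
  obtain ⟨c, v, rfl, rfl⟩ := exists_eq_add hy
  rw [← eq_of_tensorD_eq hX ht, map_add, map_add, mapR_π_shiftR_dZ, map_zero, add_zero, mapL_mapR,
    (mapL_exact C.iB_exact C.π_surjective).apply_apply_eq_zero, map_zero]

/-- For a boundary, anticommutation shows that `cycleMap` is itself an image of 1 ⊗ d, hence zero in
B ⊗ H(Y). -/
theorem mapR_π_cycleMap_eq_zero {p q : ℤ} {t : LinearMap.ker (tensorD C D p q)}
    (h : P.π p q t = 0) : mapR D.π (cycleMap C D hX p q t) = 0 := by
  obtain ⟨p, q, rfl, rfl⟩ := exists_eq_sub p q r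
  rw [P.π_eq_zero_iff] at h
  obtain ⟨x, hx⟩ := h
  rw [cycleMap_eq hX (y := -shiftR (Y' := fun m n => D.Z m n) D.dZ
      (C.shiftB x)), map_neg, mapR_π_shiftR_dZ, neg_zero]
  rw [← hx, shiftL_dB_tensorD, map_neg, mapR_iZ_shiftR_dZ]

variable (C D) in
/-- The class of `cycleMap` in the tensor product of the boundaries and the homology. -/
def cycleClass (p q : ℤ) : LinearMap.ker (tensorD C D p q) →ₗ[R]
    TensorSum R (fun m n => C.B m n) HY (p - r) (q + r - 1) :=
  mapR D.π ∘ₗ cycleMap C D hX p q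

theorem cycleClass_eq {p q : ℤ} {t t' : LinearMap.ker (tensorD C D p q)}
    (h : P.π p q t = P.π p q t') : cycleClass C D hX p q t = cycleClass C D hX p q t' := by
  rw [← sub_eq_zero, ← map_sub] at h ⊢
  exact mapR_π_cycleMap_eq_zero hX P h

/-- The map from the homology of the tensor product to the tensor product of the boundaries and
the homology. -/
def TensorHomology.connect (p q : ℤ) : HT p q →ₗ[R]
    TensorSum R (fun m n => C.B m n) HY (p - r) (q + r - 1) :=
  liftSurj (P.π p q) (P.π_surjective p q) (cycleClass C D hX p q)
    fun _ _ h => cycleClass_eq hX P h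

theorem TensorHomology.connect_π (t : LinearMap.ker (tensorD C D p q)) :
    P.connect hX p q (P.π p q t) = mapR D.π (cycleMap C D hX p q t) :=
  liftSurj_apply (P.π p q) (P.π_surjective p q) (cycleClass C D hX p q) _ t

theorem TensorHomology.exact_connect (p q : ℤ) :
    Function.Exact (P.ν p q) (P.connect hX p q) := by
  intro x
  obtain ⟨t, rfl⟩ := P.π_surjective p q x
  rw [P.connect_π]
  constructor
  · intro h
    obtain ⟨b, hb⟩ := (shiftR_mapR_exact D.dZ_exact D.π_surjective _).1 h
    obtain ⟨p, q, rfl, rfl⟩ := exists_eq_sub p q r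
    obtain ⟨c, rfl⟩ := shiftL_surjective C.dB_surjective b
    -- The plus sign matches the anticommutation: adding the boundary of `c` cancels (d ⊗ 1)t, so
    -- the sum comes from Z ⊗ Y. Being a cycle, it then comes from Z ⊗ Z(Y) because Z is flat.
    have h₁ : C.shiftB (t.1 + tensorD C D _ _ c) = 0 := by
      rw [map_add, ← mapR_cycleMap hX, ← hb, mapR_iZ_shiftR_dZ, shiftL_dB_tensorD, add_neg_cancel]
    obtain ⟨v, hv⟩ := (mapL_shiftL_exact C.iZ_dB_exact C.dB_surjective _).1 h₁
    have h₂ : shiftR D.d v = 0 := by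
      refine mapL_iZ_injective (C := C) hX ?_
      rw [← tensorD_mapL_iZ, hv, map_add, tensorD_tensorD, LinearMap.mem_ker.1 t.2, map_zero,
        add_zero]
    obtain ⟨z, rfl⟩ := (mapR_shiftR_exact D.iZ_exact (C.flat_Z hX) _).1 h₂
    refine ⟨mapL C.π (mapR D.π z), ?_⟩
    rw [P.ν_map _ _ z (mapL_mapR_iZ_mem z), ← sub_eq_zero, ← map_sub, P.π_eq_zero_iff]
    exact ⟨c, by simp [hv]⟩
  · rintro ⟨w, hw⟩
    obtain ⟨z, rfl⟩ := exists_mapL_mapR_π (C := C) (D := D) w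
    rw [P.ν_map _ _ z (mapL_mapR_iZ_mem z)] at hw
    rw [← P.connect_π, ← hw, P.connect_π, cycleMap_eq hX (y := 0), map_zero]
    rw [map_zero, shiftL_dB_mapL_iZ]

theorem TensorHomology.connect_exact (p q : ℤ) :
    Function.Exact (P.connect hX p q) (mapL C.iB) := by
  intro k
  constructor
  · intro hk
    obtain ⟨y, rfl⟩ := mapR_surjective D.π_surjective k
    rw [mapL_mapR] at hk
    obtain ⟨v, hv⟩ := (shiftR_mapR_exact D.dZ_exact D.π_surjective _).1 hk
    obtain ⟨c, rfl⟩ := shiftL_surjective C.dB_surjective y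
    -- `c` lifts the element of B ⊗ Z(Y), and `v` shows that its image in Z ⊗ Z(Y) is in the image
    -- of 1 ⊗ d. The two differentials agree, so the difference is the required cycle.
    have h : tensorD C D p q (mapR D.iZ c - mapL C.iZ v) = 0 := by
      rw [map_sub, tensorD_mapR_iZ, tensorD_mapL_iZ, ← map_sub, ← hv, mapR_iZ_shiftR_dZ, sub_self,
        map_zero]
    refine ⟨P.π p q ⟨_, h⟩, ?_⟩
    rw [P.connect_π, cycleMap_eq hX]
    rw [map_sub, shiftL_dB_mapL_iZ, sub_zero, mapR_shiftL]
  · rintro ⟨x, rfl⟩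
    obtain ⟨t, rfl⟩ := P.π_surjective p q x
    rw [P.connect_π]
    obtain ⟨c, v, e, h⟩ := exists_eq_add (mapR_cycleMap hX t)
    -- The two pieces of a cycle have opposite differentials, so the image in Z ⊗ Z(Y) is in the
    -- image of 1 ⊗ d.
    have := eq_of_tensorD_eq hX (c := c) (v := v) (x := 0) (by
      rw [← e, LinearMap.mem_ker.1 t.2, map_zero, map_zero])
    rw [← h, mapL_mapR, eq_neg_of_add_eq_zero_left this, map_neg, mapR_π_shiftR_dZ, neg_zero]

/-- If the homology of the first factor is flat, the Künneth map is bijective. -/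
theorem TensorHomology.ν_bijective (hH : ∀ m n, Module.Flat R (HX m n)) (p q : ℤ) :
    Function.Bijective (P.ν p q) := by
  refine ⟨P.ν_injective hX p q, fun x => (P.exact_connect hX p q x).1 ?_⟩
  -- Flat homology makes B ⊗ H(Y) → Z ⊗ H(Y) injective, so the connecting map vanishes.
  refine mapL_injective (f := C.iB) (fun m n u v => ?_) ?_
  · have := hH m n
    exact rTensor_injective_of_flat_coker _ (C.π m n) (Submodule.subtype_injective _)
      (C.iB_exact m n) (C.π_surjective m n)
  · rw [map_zero]
    exact (P.connect_exact hX p q _).2 ⟨x, rfl⟩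

end Connecting

/-! ### Naturality of the connecting map in both complexes. -/

section Naturality

variable {R : Type*} [CommRing R] {r : ℤ} {X HX Y HY HT X' HX' Y' HY' HT' : ℤ → ℤ → Type*}
  [∀ m n, AddCommGroup (X m n)] [∀ m n, Module R (X m n)]
  [∀ m n, AddCommGroup (HX m n)] [∀ m n, Module R (HX m n)]
  [∀ m n, AddCommGroup (Y m n)] [∀ m n, Module R (Y m n)]
  [∀ m n, AddCommGroup (HY m n)] [∀ m n, Module R (HY m n)]
  [∀ m n, AddCommGroup (X' m n)] [∀ m n, Module R (X' m n)]
  [∀ m n, AddCommGroup (HX' m n)] [∀ m n, Module R (HX' m n)]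
  [∀ m n, AddCommGroup (Y' m n)] [∀ m n, Module R (Y' m n)]
  [∀ m n, AddCommGroup (HY' m n)] [∀ m n, Module R (HY' m n)]
  [∀ m n, AddCommGroup (HT' m n)] [∀ m n, Module R (HT' m n)]
  [∀ m n, AddCommGroup (HT m n)] [∀ m n, Module R (HT m n)]

/-- A map of bigraded complexes, together with the induced map of homology. -/
structure PageHom (C : PageHomology R r X HX) (C' : PageHomology R r X' HX') where
  f : ∀ m n, X m n →ₗ[R] X' m n
  fH : ∀ m n, HX m n →ₗ[R] HX' m n
  comm : ∀ m n x, C'.d m n (f m n x) = f _ _ (C.d m n x)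
  comm_π : ∀ m n (z : C.Z m n) (h : f m n z ∈ C'.Z m n), fH m n (C.π m n z) = C'.π m n ⟨f m n z, h⟩

namespace PageHom

variable {C : PageHomology R r X HX} {C' : PageHomology R r X' HX'} (φ : PageHom C C')

theorem f_mem_Z {m n : ℤ} {z : X m n} (hz : z ∈ C.Z m n) : φ.f m n z ∈ C'.Z m n := by
  rw [LinearMap.mem_ker] at hz ⊢
  rw [φ.comm, hz, map_zero]

/-- The induced map of cycles. -/
def fZ (m n : ℤ) : C.Z m n →ₗ[R] C'.Z m n :=
  (φ.f m n).restrict fun _ => φ.f_mem_Z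

theorem iZ_fZ (m n : ℤ) (z : C.Z m n) : C'.iZ m n (φ.fZ m n z) = φ.f m n (C.iZ m n z) := rfl

theorem π_fZ (m n : ℤ) (z : C.Z m n) : C'.π m n (φ.fZ m n z) = φ.fH m n (C.π m n z) :=
  (φ.comm_π m n z (φ.fZ m n z).2).symm

/-- The induced map of boundaries. -/
def fB (m n : ℤ) : C.B m n →ₗ[R] C'.B m n :=
  (φ.fZ m n).restrict fun z hz => by
    rw [LinearMap.mem_ker] at hz ⊢
    rw [φ.π_fZ, hz, map_zero]

theorem dB_f (m n : ℤ) (x : X m n) : C'.dB m n (φ.f m n x) = φ.fB _ _ (C.dB m n x) :=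
  Subtype.ext (Subtype.ext (φ.comm m n x))

end PageHom

variable {C : PageHomology R r X HX} {C' : PageHomology R r X' HX'} {D : PageHomology R r Y HY}
  {D' : PageHomology R r Y' HY'} {p q : ℤ}

theorem tensorD_mapL_mapR (φ : PageHom C C') (ψ : PageHom D D') (t : TensorSum R X Y p q) :
    tensorD C' D' p q (mapL φ.f (mapR ψ.f t)) = mapL φ.f (mapR ψ.f (tensorD C D p q t)) := by
  have : tensorD C' D' p q ∘ₗ mapL φ.f ∘ₗ mapR ψ.f =
      mapL φ.f ∘ₗ mapR ψ.f ∘ₗ tensorD C D p q :=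
    tensorSum_ext fun m n u v hp hq x y => by
      simp only [LinearMap.comp_apply, mapL_ten, mapR_ten, tensorD_apply, shiftL_ten, shiftR_ten,
        map_add, map_smul, φ.comm, ψ.comm]
  exact LinearMap.congr_fun this t

variable [IsDomain R] [IsPrincipalIdealRing R]

/-- The value of `cycleMap` is determined by its image in B ⊗ Y, so it suffices that the
pushed-forward value has the right image there. -/
theorem connect_naturality (hX : ∀ m n, Module.Flat R (X m n))
    (hX' : ∀ m n, Module.Flat R (X' m n)) (P : TensorHomology C D HT)
    (P' : TensorHomology C' D' HT')
    (φ : PageHom C C') (ψ : PageHom D D') (θ : HT p q →ₗ[R] HT' p q)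
    (hθ : ∀ t h, θ (P.π p q t) = P'.π p q ⟨mapL φ.f (mapR ψ.f t.1), h⟩) (x : HT p q) :
    P'.connect hX' p q (θ x) = mapL φ.fB (mapR ψ.fH (P.connect hX p q x)) := by
  obtain ⟨t, rfl⟩ := P.π_surjective p q x
  have h : mapL φ.f (mapR ψ.f t.1) ∈ LinearMap.ker (tensorD C' D' p q) := by
    rw [LinearMap.mem_ker, tensorD_mapL_mapR, LinearMap.mem_ker.1 t.2, map_zero, map_zero]
  rw [hθ t h, P'.connect_π, P.connect_π,
    cycleMap_eq hX' (y := mapL φ.fB (mapR ψ.fZ (cycleMap C D hX p q t))), ← mapL_mapR,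
    mapR_mapR (f'' := fun m n => ψ.fH m n ∘ₗ D.π m n) ψ.π_fZ,
    ← mapR_mapR (f := D.π) (f' := ψ.fH) (fun _ _ _ => rfl)]
  rw [← mapL_mapR, mapR_mapR (f'' := fun m n => ψ.f m n ∘ₗ D.iZ m n) ψ.iZ_fZ,
    ← mapR_mapR (f := D.iZ) (f' := ψ.f) (fun _ _ _ => rfl),
    mapR_cycleMap, mapR_shiftL,
    mapL_shiftL (f'' := fun m n => φ.fB _ _ ∘ₗ C.dB m n) (fun _ _ _ => rfl),
    shiftL_mapL (f'' := fun m n => φ.fB _ _ ∘ₗ C.dB m n) φ.dB_f]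

end Naturality

/-! ### Tor₁ as the kernel of the map A ⊗ N → B ⊗ N. -/

section TorOne

variable {R : Type u} [CommRing R]

open MonoidalCategory

/-- Tensoring a short complex of modules with a chain complex of modules. -/
def tensorChains (S : ShortComplex (ModuleCat.{u} R)) (P : ChainComplex (ModuleCat.{u} R) ℕ) :
    ShortComplex (ChainComplex (ModuleCat.{u} R) ℕ) where
  X₁ := (((tensoringLeft _).obj S.X₁).mapHomologicalComplex _).obj P
  X₂ := (((tensoringLeft _).obj S.X₂).mapHomologicalComplex _).obj P
  X₃ := (((tensoringLeft _).obj S.X₃).mapHomologicalComplex _).obj P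
  f := (NatTrans.mapHomologicalComplex ((tensoringLeft _).map S.f) _).app P
  g := (NatTrans.mapHomologicalComplex ((tensoringLeft _).map S.g) _).app P
  zero := by
    ext1 i
    change S.f ▷ P.X i ≫ S.g ▷ P.X i = 0
    rw [← comp_whiskerRight, S.zero, MonoidalPreadditive.zero_whiskerRight]

/-- `tensorChains` is functorial in the short complex. -/
def tensorChainsMap {S S' : ShortComplex (ModuleCat.{u} R)} (φ : S ⟶ S')
    {P P' : ChainComplex (ModuleCat.{u} R) ℕ} (ψ : P ⟶ P') :
    tensorChains S P ⟶ tensorChains S' P' where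
  τ₁ := (NatTrans.mapHomologicalComplex ((tensoringLeft _).map φ.τ₁) _).app P ≫
    (((tensoringLeft _).obj S'.X₁).mapHomologicalComplex _).map ψ
  τ₂ := (NatTrans.mapHomologicalComplex ((tensoringLeft _).map φ.τ₂) _).app P ≫
    (((tensoringLeft _).obj S'.X₂).mapHomologicalComplex _).map ψ
  τ₃ := (NatTrans.mapHomologicalComplex ((tensoringLeft _).map φ.τ₃) _).app P ≫
    (((tensoringLeft _).obj S'.X₃).mapHomologicalComplex _).map ψ
  comm₁₂ := by
    ext1 i
    change (φ.τ₁ ▷ P.X i ≫ S'.X₁ ◁ ψ.f i) ≫ S'.f ▷ P'.X i =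
      S.f ▷ P.X i ≫ (φ.τ₂ ▷ P.X i ≫ S'.X₂ ◁ ψ.f i)
    rw [← comp_whiskerRight_assoc, ← φ.comm₁₂, comp_whiskerRight, Category.assoc, Category.assoc,
      whisker_exchange]
  comm₂₃ := by
    ext1 i
    change (φ.τ₂ ▷ P.X i ≫ S'.X₂ ◁ ψ.f i) ≫ S'.g ▷ P'.X i =
      S.g ▷ P.X i ≫ (φ.τ₃ ▷ P.X i ≫ S'.X₃ ◁ ψ.f i)
    rw [← comp_whiskerRight_assoc, ← φ.comm₂₃, comp_whiskerRight, Category.assoc, Category.assoc,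
      whisker_exchange]

/-- `Tor` is derived in its second variable, so the long exact sequence in the first variable comes
from tensoring a short exact sequence with a resolution, whose terms are flat. -/
theorem tensorChains_shortExact {S : ShortComplex (ModuleCat.{u} R)} (hS : S.ShortExact)
    {P : ChainComplex (ModuleCat.{u} R) ℕ} (hP : ∀ i, Module.Flat R (P.X i)) :
    (tensorChains S P).ShortExact := by
  refine HomologicalComplex.shortExact_of_degreewise_shortExact _ fun i => ?_
  have := hP i
  have h := Module.Flat.rTensor_shortComplex_exact (P.X i) S hS.exact
  have h₁ : Mono (S.f ▷ P.X i) := by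
    rw [ModuleCat.mono_iff_injective, ModuleCat.MonoidalCategory.whiskerRight_def]
    exact Module.Flat.rTensor_preserves_injective_linearMap _ hS.moduleCat_injective_f
  have h₂ : Epi (S.g ▷ P.X i) := by
    rw [ModuleCat.epi_iff_surjective, ModuleCat.MonoidalCategory.whiskerRight_def]
    exact LinearMap.rTensor_surjective _ hS.moduleCat_surjective_g
  exact @ShortComplex.ShortExact.mk _ _ _ _ h h₁ h₂

variable {N N' : ModuleCat.{u} R}

theorem flat_projectiveResolution (P : ProjectiveResolution N) (i : ℕ) :
    Module.Flat R (P.complex.X i) := by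
  have := (IsProjective.iff_projective (R := R) (P.complex.X i)).2 (P.projective i)
  infer_instance

theorem isZero_homology_of_flat (P : ProjectiveResolution N) (Z : ModuleCat.{u} R)
    (hZ : Module.Flat R Z) (i : ℕ) :
    Limits.IsZero (((((tensoringLeft _).obj Z).mapHomologicalComplex _).obj
      P.complex).homology (i + 1)) := by
  have h := P.complex_exactAt_succ i
  rw [HomologicalComplex.exactAt_iff' _ (i + 2) (i + 1) i (by simp) (by simp)] at h
  rw [← HomologicalComplex.exactAt_iff_isZero_homology,
    HomologicalComplex.exactAt_iff' _ (i + 2) (i + 1) i (by simp) (by simp)]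
  exact Module.Flat.lTensor_shortComplex_exact Z (P.complex.sc' (i + 2) (i + 1) i) h

/-- The zeroth homology of `F P` for a projective resolution `P` of `N` is `F N`. -/
def zerothHomology (F : ModuleCat.{u} R ⥤ ModuleCat.{u} R) [F.Additive]
    (P : ProjectiveResolution N) :
    ((F.mapHomologicalComplex _).obj P.complex).homology 0 ⟶ F.obj N :=
  (ChainComplex.isoHomologyι₀ _).hom ≫ P.fromLeftDerivedZero' F

instance (F : ModuleCat.{u} R ⥤ ModuleCat.{u} R) [F.Additive]
    [Limits.PreservesFiniteColimits F] (P : ProjectiveResolution N) :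
    IsIso (zerothHomology F P) := by
  unfold zerothHomology
  infer_instance

/-- Functor and module vary together: exactness uses a change of functor alone, naturality uses
both. -/
theorem zerothHomology_naturality {F F' : ModuleCat.{u} R ⥤ ModuleCat.{u} R} [F.Additive]
    [F'.Additive] (α : F ⟶ F') {P : ProjectiveResolution N} {P' : ProjectiveResolution N'}
    (g : N ⟶ N') (φ : P.complex ⟶ P'.complex) (hφ : φ.f 0 ≫ P'.π.f 0 = P.π.f 0 ≫ g) :
    HomologicalComplex.homologyMap ((NatTrans.mapHomologicalComplex α _).app P.complex ≫
      (F'.mapHomologicalComplex _).map φ) 0 ≫ zerothHomology F' P' =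
      zerothHomology F P ≫ α.app N ≫ F'.map g := by
  have h : HomologicalComplex.opcyclesMap ((NatTrans.mapHomologicalComplex α _).app P.complex) 0 ≫
      P.fromLeftDerivedZero' F' = P.fromLeftDerivedZero' F ≫ α.app N := by
    rw [← cancel_epi (HomologicalComplex.pOpcycles _ _), HomologicalComplex.p_opcyclesMap_assoc,
      P.pOpcycles_comp_fromLeftDerivedZero', P.pOpcycles_comp_fromLeftDerivedZero'_assoc]
    exact (α.naturality _).symm
  unfold zerothHomology
  rw [ChainComplex.isoHomologyι₀, ChainComplex.isoHomologyι₀]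
  simp only [HomologicalComplex.isoHomologyι_hom]
  rw [HomologicalComplex.homologyι_naturality_assoc, HomologicalComplex.opcyclesMap_comp,
    Category.assoc, ProjectiveResolution.fromLeftDerivedZero'_naturality g P P' φ hφ, reassoc_of% h,
    Category.assoc]

/-- `Tor₁(X, N)` is computed by a projective resolution of `N`. -/
def torIso (X : ModuleCat.{u} R) (P : ProjectiveResolution N) :
    ((Tor (ModuleCat.{u} R) 1).obj X).obj N ≅
      ((((tensoringLeft _).obj X).mapHomologicalComplex _).obj P.complex).homology 1 :=
  P.isoLeftDerivedObj ((tensoringLeft _).obj X) 1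

theorem torIso_naturality {X X' : ModuleCat.{u} R} (f : X ⟶ X') {P : ProjectiveResolution N}
    {P' : ProjectiveResolution N'} (g : N ⟶ N') (φ : P.complex ⟶ P'.complex)
    (hφ : φ.f 0 ≫ P'.π.f 0 = P.π.f 0 ≫ g) :
    (((Tor (ModuleCat.{u} R) 1).map f).app N ≫ ((Tor (ModuleCat.{u} R) 1).obj X').map g) ≫
      (torIso X' P').hom = (torIso X P).hom ≫ HomologicalComplex.homologyMap
        ((NatTrans.mapHomologicalComplex ((tensoringLeft _).map f) _).app P.complex ≫
          (((tensoringLeft _).obj X').mapHomologicalComplex _).map φ) 1 := by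
  have e₁ : ((Tor (ModuleCat.{u} R) 1).obj X').map g ≫ (torIso X' P').hom =
      (torIso X' P).hom ≫ HomologicalComplex.homologyMap
        ((((tensoringLeft _).obj X').mapHomologicalComplex _).map φ) 1 :=
    ProjectiveResolution.isoLeftDerivedObj_hom_naturality g P P' φ hφ
      ((tensoringLeft (ModuleCat.{u} R)).obj X') 1
  have e₂ : ((Tor (ModuleCat.{u} R) 1).map f).app N =
      (torIso X P).hom ≫ HomologicalComplex.homologyMap
        ((NatTrans.mapHomologicalComplex ((tensoringLeft _).map f) _).app P.complex) 1 ≫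
          (torIso X' P).inv :=
    ProjectiveResolution.leftDerived_app_eq ((tensoringLeft (ModuleCat.{u} R)).map f) P 1
  rw [Category.assoc, e₁, e₂, HomologicalComplex.homologyMap_comp]
  simp only [Category.assoc, Iso.inv_hom_id_assoc]

theorem comp_comp_naturality {C : Type*} [Category C] {A₀ A₁ A₂ A₃ B₀ B₁ B₂ B₃ : C}
    {a : A₀ ⟶ A₁} {a' : A₁ ⟶ A₂} {a'' : A₂ ⟶ A₃} {b : B₀ ⟶ B₁} {b' : B₁ ⟶ B₂} {b'' : B₂ ⟶ B₃}
    {x₀ : A₀ ⟶ B₀} {x₁ : A₁ ⟶ B₁} {x₂ : A₂ ⟶ B₂} {x₃ : A₃ ⟶ B₃} (h : x₀ ≫ b = a ≫ x₁)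
    (h' : a' ≫ x₂ = x₁ ≫ b') (h'' : x₂ ≫ b'' = a'' ≫ x₃) :
    x₀ ≫ b ≫ b' ≫ b'' = (a ≫ a' ≫ a'') ≫ x₃ := by
  rw [reassoc_of% h, ← reassoc_of% h', h'']
  simp only [Category.assoc]

/-- The map `Tor₁(C, N) → A ⊗ N` for a short exact sequence `0 → A → B → C → 0`. -/
def torConnect {S : ShortComplex (ModuleCat.{u} R)} (hS : S.ShortExact) (N : ModuleCat.{u} R) :
    ((Tor (ModuleCat.{u} R) 1).obj S.X₃).obj N ⟶ ((tensoringLeft _).obj S.X₁).obj N :=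
  (torIso S.X₃ (projectiveResolution N)).hom ≫
    (tensorChains_shortExact hS (flat_projectiveResolution (projectiveResolution N))).δ 1 0
      (by simp) ≫ zerothHomology ((tensoringLeft _).obj S.X₁) (projectiveResolution N)

theorem injective_of_isIso {X Y : ModuleCat.{u} R} (f : X ⟶ Y) [IsIso f] :
    Function.Injective f.hom :=
  (ModuleCat.mono_iff_injective f).1 inferInstance

theorem surjective_of_isIso {X Y : ModuleCat.{u} R} (f : X ⟶ Y) [IsIso f] :
    Function.Surjective f.hom :=
  (ModuleCat.epi_iff_surjective f).1 inferInstance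

/-- The preceding term of the long exact sequence is the first homology of the resolution tensored
with the flat module `S.X₂`, which is zero. -/
theorem torConnect_injective {S : ShortComplex (ModuleCat.{u} R)} (hS : S.ShortExact)
    (hZ : Module.Flat R S.X₂) (N : ModuleCat.{u} R) :
    Function.Injective (torConnect hS N).hom := by
  have h := (ModuleCat.mono_iff_injective _).1 ((tensorChains_shortExact hS
    (flat_projectiveResolution (projectiveResolution N))).mono_δ 1 0 (by simp)
      (isZero_homology_of_flat _ _ hZ 0))
  exact (injective_of_isIso
    (zerothHomology ((tensoringLeft _).obj S.X₁) (projectiveResolution N))).comp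
      (h.comp (injective_of_isIso (torIso S.X₃ (projectiveResolution N)).hom))

theorem exact_of_conj {A₀ A₁ A₂ B₀ B₁ B₂ : Type*} [AddCommGroup A₂] [AddCommGroup B₂]
    {f : A₀ → A₁} {g : A₁ → A₂} {f' : B₀ → B₁} {g' : B₁ → B₂} (h : Function.Exact f g)
    {a : B₀ → A₀} {b : A₁ → B₁} {c : A₂ →+ B₂} (ha : Function.Surjective a)
    (hb : Function.Bijective b) (hc : Function.Injective c)
    (hf : ∀ x, f' x = b (f (a x))) (hg : ∀ x, g' (b x) = c (g x)) : Function.Exact f' g' := by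
  intro y
  obtain ⟨y, rfl⟩ := hb.2 y
  rw [hg, map_eq_zero_iff c hc, h y]
  constructor
  · rintro ⟨x, rfl⟩
    obtain ⟨x, rfl⟩ := ha x
    exact ⟨x, hf x⟩
  · rintro ⟨x, hx⟩
    exact ⟨a x, hb.1 ((hf x).symm.trans hx)⟩

/-- This is the part H₁(X₃ ⊗ P) → H₀(X₁ ⊗ P) → H₀(X₂ ⊗ P) of the long exact sequence, moved along
the identifications with Tor₁ and with the tensor products. -/
theorem torConnect_exact {S : ShortComplex (ModuleCat.{u} R)} (hS : S.ShortExact)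
    (N : ModuleCat.{u} R) :
    Function.Exact (torConnect hS N).hom (S.f ▷ N).hom := by
  have h := (ShortComplex.ShortExact.moduleCat_exact_iff_function_exact _).1
    ((tensorChains_shortExact hS
      (flat_projectiveResolution (projectiveResolution N))).homology_exact₁ 1 0 (by simp))
  have e := zerothHomology_naturality ((tensoringLeft _).map S.f) (P := projectiveResolution N)
    (P' := projectiveResolution N) (𝟙 N) (𝟙 _)
    ((Category.id_comp _).trans (Category.comp_id _).symm)
  simp only [CategoryTheory.Functor.map_id, Category.comp_id] at e
  refine exact_of_conj (c := (zerothHomology ((tensoringLeft _).obj S.X₂)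
    (projectiveResolution N)).hom.toAddMonoidHom) h
    (surjective_of_isIso (torIso S.X₃ (projectiveResolution N)).hom)
    ⟨injective_of_isIso (zerothHomology ((tensoringLeft _).obj S.X₁) (projectiveResolution N)),
      surjective_of_isIso (zerothHomology ((tensoringLeft _).obj S.X₁) (projectiveResolution N))⟩
    (injective_of_isIso (zerothHomology ((tensoringLeft _).obj S.X₂) (projectiveResolution N)))
    (fun x => rfl) fun x => ?_
  exact (LinearMap.congr_fun (congrArg ModuleCat.Hom.hom e) x).symm

theorem torConnect_naturality {S S' : ShortComplex (ModuleCat.{u} R)} (hS : S.ShortExact)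
    (hS' : S'.ShortExact) (φ : S ⟶ S') (g : N ⟶ N') :
    (((Tor (ModuleCat.{u} R) 1).map φ.τ₃).app N ≫ ((Tor (ModuleCat.{u} R) 1).obj S'.X₃).map g) ≫
      torConnect hS' N' = torConnect hS N ≫ φ.τ₁ ▷ N ≫ S'.X₁ ◁ g :=
  comp_comp_naturality
    (torIso_naturality φ.τ₃ g (ProjectiveResolution.lift g (projectiveResolution N)
      (projectiveResolution N')) (ProjectiveResolution.lift_commutes_zero ..))
    (HomologicalComplex.HomologySequence.δ_naturality
      (tensorChainsMap φ (ProjectiveResolution.lift g (projectiveResolution N)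
        (projectiveResolution N')))
      (tensorChains_shortExact hS (flat_projectiveResolution (projectiveResolution N)))
      (tensorChains_shortExact hS' (flat_projectiveResolution (projectiveResolution N')))
      1 0 (by simp))
    (zerothHomology_naturality ((tensoringLeft _).map φ.τ₁) (P := projectiveResolution N)
      (P' := projectiveResolution N') g (ProjectiveResolution.lift g _ _)
      (ProjectiveResolution.lift_commutes_zero ..))

section Linear

variable {Z H Z' H' : Type u} [AddCommGroup Z'] [Module R Z'] [AddCommGroup H'] [Module R H']
  [AddCommGroup Z] [Module R Z] [AddCommGroup H] [Module R H]

/-- The short complex `0 → ker π → Z → H → 0`. -/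
abbrev kerComplex (π : Z →ₗ[R] H) : ShortComplex (ModuleCat.{u} R) :=
  .mk (ModuleCat.ofHom (LinearMap.ker π).subtype) (ModuleCat.ofHom π)
    (ModuleCat.hom_ext (LinearMap.ext fun x => x.2))

theorem kerComplex_shortExact {π : Z →ₗ[R] H} (hπ : Function.Surjective π) :
    (kerComplex π).ShortExact :=
  @ShortComplex.ShortExact.mk _ _ _ _
    ((ShortComplex.ShortExact.moduleCat_exact_iff_function_exact _).2
      (LinearMap.exact_subtype_ker_map π))
    ((ModuleCat.mono_iff_injective _).2 (Submodule.subtype_injective _))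
    ((ModuleCat.epi_iff_surjective _).2 hπ)

variable {M M' : Type u} [AddCommGroup M] [Module R M] [AddCommGroup M'] [Module R M']

variable (M) in
/-- The map `Tor₁(H, M) → ker π ⊗ M` for a surjection `π : Z → H`. -/
def torToTensor (π : Z →ₗ[R] H) (hπ : Function.Surjective π) :
    ((Tor (ModuleCat.{u} R) 1).obj (ModuleCat.of R H)).obj (ModuleCat.of R M) →ₗ[R]
      LinearMap.ker π ⊗[R] M :=
  (torConnect (kerComplex_shortExact hπ) (ModuleCat.of R M)).hom

theorem torToTensor_injective [Module.Flat R Z] (π : Z →ₗ[R] H) (hπ : Function.Surjective π) :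
    Function.Injective (torToTensor M π hπ) :=
  torConnect_injective (kerComplex_shortExact hπ) ‹_› _

theorem torToTensor_exact (π : Z →ₗ[R] H) (hπ : Function.Surjective π) :
    Function.Exact (torToTensor M π hπ) ((LinearMap.ker π).subtype.rTensor M) := by
  have h := torConnect_exact (kerComplex_shortExact hπ) (ModuleCat.of R M)
  rw [ModuleCat.MonoidalCategory.whiskerRight_def] at h
  exact h

theorem torToTensor_naturality {π : Z →ₗ[R] H} (hπ : Function.Surjective π) {π' : Z' →ₗ[R] H'}
    (hπ' : Function.Surjective π') (b : LinearMap.ker π →ₗ[R] LinearMap.ker π') (z : Z →ₗ[R] Z')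
    (h : H →ₗ[R] H') (g : M →ₗ[R] M') (hb : ∀ x, (b x : Z') = z x)
    (hh : ∀ x, π' (z x) = h (π x))
    (t : ((Tor (ModuleCat.{u} R) 1).obj (ModuleCat.of R H)).obj (ModuleCat.of R M)) :
    torToTensor M' π' hπ' ((((Tor (ModuleCat.{u} R) 1).map (ModuleCat.ofHom h)).app _ ≫
      ((Tor (ModuleCat.{u} R) 1).obj _).map (ModuleCat.ofHom g)).hom t) =
      g.lTensor _ (b.rTensor _ (torToTensor M π hπ t)) := by
  have e := torConnect_naturality (kerComplex_shortExact hπ) (kerComplex_shortExact hπ')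
    { τ₁ := ModuleCat.ofHom b
      τ₂ := ModuleCat.ofHom z
      τ₃ := ModuleCat.ofHom h
      comm₁₂ := ModuleCat.hom_ext (LinearMap.ext hb)
      comm₂₃ := ModuleCat.hom_ext (LinearMap.ext hh) } (ModuleCat.ofHom g)
  rw [ModuleCat.MonoidalCategory.whiskerRight_def, ModuleCat.MonoidalCategory.whiskerLeft_def] at e
  exact LinearMap.congr_fun (congrArg ModuleCat.Hom.hom e) t

end Linear

end TorOne

/-! ### The pages of the spectral sequence: E^{r+1} is the homology of E^r. -/

section Pages

section

variable {R M : Type*} [CommRing R] [AddCommGroup M] [Module R M]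

theorem Subquot.mk_surjective (A B : Submodule R M) : Function.Surjective (Subquot.mk A B) :=
  Submodule.mkQ_surjective _

theorem Subquot.mk_eq_zero {A B : Submodule R M} {a : A} : Subquot.mk A B a = 0 ↔ (a : M) ∈ B :=
  Submodule.Quotient.mk_eq_zero _

theorem Subquot.mk_eq_mk {A B : Submodule R M} {a b : A} :
    Subquot.mk A B a = Subquot.mk A B b ↔ (a - b : M) ∈ B :=
  Submodule.Quotient.eq _

end

variable {R : Type*} [CommRing R] {V W : Type*} {G : Digraph V} {H : Digraph W}

theorem mem_A_mono {r r' p p' q q' : ℤ} {c : RC R G} (h : c ∈ A R G r p q) (hp : p ≤ p')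
    (hq : p + q = p' + q') (hr : p - r ≤ p' - r') : c ∈ A R G r' p' q' :=
  ⟨⟨filt_mono G hp h.1.1, hq ▸ h.1.2⟩, filt_mono G hr h.2⟩

theorem mem_B {r p q : ℤ} {c : RC R G} : c ∈ B R G r p q ↔
    ∃ x ∈ A R G (r - 1) (p - 1) (q + 1), ∃ y ∈ A R G (r - 1) (p + r - 1) (q - r + 2),
      c = x + bd R G y := by
  rw [B, Submodule.mem_sup]
  constructor
  · rintro ⟨x, hx, _, ⟨y, hy, rfl⟩, rfl⟩
    exact ⟨x, hx, y, hy, rfl⟩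
  · rintro ⟨x, hx, y, hy, rfl⟩
    exact ⟨x, hx, _, ⟨y, hy, rfl⟩, rfl⟩

theorem mem_B_of_mem_A {r p q : ℤ} {c : RC R G} (h : c ∈ A R G (r - 1) (p - 1) (q + 1)) :
    c ∈ B R G r p q := mem_B.2 ⟨c, h, 0, Submodule.zero_mem _, by simp⟩

theorem bd_mem_B {r p q : ℤ} {c : RC R G} (h : c ∈ A R G (r - 1) (p + r - 1) (q - r + 2)) :
    bd R G c ∈ B R G r p q := mem_B.2 ⟨0, Submodule.zero_mem _, c, h, by simp⟩

theorem bd_mem_B_of_mem_B {r m n : ℤ} {b : RC R G} (h : b ∈ B R G r m n) :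
    bd R G b ∈ B R G r (m - r) (n + r - 1) := by
  obtain ⟨x, hx, y, hy, rfl⟩ := mem_B.1 h
  rw [map_add, bd_bd, add_zero]
  exact bd_mem_B (mem_A_mono hx (by omega) (by omega) (by omega))

/-- In c = x + ∂y the chains x and c have the same boundary, so x inherits the deeper boundary of c
and rises from A^{r-1} to A^r. -/
theorem mem_B_succ {r r' p q : ℤ} (hr : r' = r + 1) {c : RC R G} (h : c ∈ A R G r' p q)
    (h' : c ∈ B R G r p q) : c ∈ B R G r' p q := by
  subst hr
  obtain ⟨x, hx, y, hy, rfl⟩ := mem_B.1 h'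
  refine mem_B.2 ⟨x, ⟨⟨hx.1.1, hx.1.2⟩, ?_⟩, y,
    mem_A_mono hy (by omega) (by omega) (by omega), rfl⟩
  have := h.2
  change bd R G (x + bd R G y) ∈ filt R G _ at this
  rw [map_add, bd_bd, add_zero] at this
  exact filt_mono G (by omega) this

theorem exists_mem_A_succ {r p q : ℤ} {a : RC R G} (h : a ∈ A R G r p q)
    (h' : bd R G a ∈ B R G r (p - r) (q + r - 1)) :
    ∃ a' ∈ A R G (r + 1) p q, a' - a ∈ B R G r p q := by
  obtain ⟨x, hx, y, hy, e⟩ := mem_B.1 h'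
  have hy : y ∈ A R G (r - 1) (p - 1) (q + 1) := mem_A_mono hy (by omega) (by omega) (by omega)
  -- Here ∂(a - y) = x lies one filtration step deeper, while y lies in F_{p-1} and does not change
  -- the class of a.
  refine ⟨a - y, ⟨⟨Submodule.sub_mem _ h.1.1 (filt_mono G (by omega) hy.1.1),
    Submodule.sub_mem _ h.1.2 ?_⟩, ?_⟩, ?_⟩
  · have := hy.1.2
    rwa [show p - 1 + (q + 1) = p + q by ring] at this
  · change bd R G (a - y) ∈ filt R G _
    rw [map_sub, e, add_sub_cancel_right]
    exact filt_mono G (by omega) hx.1.1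
  · rw [sub_sub_cancel_left]
    exact Submodule.neg_mem _ (mem_B_of_mem_A hy)

variable (R G) in
/-- The differential `d^r` of the magnitude-path spectral sequence. -/
def pageD (r : ℕ) (p q : ℤ) : E R G r p q →ₗ[R] E R G r (p - r) (q + r - 1) :=
  Subquot.map (bd R G) (fun _ h => bd_mem_A _ h) fun _ h => bd_mem_B_of_mem_B h

theorem pageD_mk {r : ℕ} {p q : ℤ} (a : A R G r p q) : pageD R G r p q (Subquot.mk _ _ a) =
    Subquot.mk _ _ ⟨bd R G a, bd_mem_A _ a.2⟩ := rfl

theorem mem_A_of_mem_A_succ {r : ℕ} {p q : ℤ} {a : RC R G} (h : a ∈ A R G (r + 1 : ℕ) p q) :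
    a ∈ A R G r p q := mem_A_mono h le_rfl rfl (by push_cast; omega)

theorem mk_mem_ker {r : ℕ} {p q : ℤ} {a : RC R G} (h : a ∈ A R G (r + 1 : ℕ) p q) :
    Subquot.mk _ _ ⟨a, mem_A_of_mem_A_succ h⟩ ∈ LinearMap.ker (pageD R G r p q) := by
  rw [LinearMap.mem_ker, pageD_mk, Subquot.mk_eq_zero]
  exact mem_B_of_mem_A (mem_A_mono (bd_mem_A r h) (by push_cast; omega) (by push_cast; omega)
    (by push_cast; omega))

variable (R G) in
/-- The cycle of `E^r` given by an element of `A^{r+1}`. -/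
def pageCycle (r : ℕ) (p q : ℤ) : A R G (r + 1 : ℕ) p q →ₗ[R] LinearMap.ker (pageD R G r p q) where
  toFun a := ⟨Subquot.mk _ _ ⟨a, mem_A_of_mem_A_succ a.2⟩, mk_mem_ker a.2⟩
  map_add' _ _ := rfl
  map_smul' _ _ := rfl

theorem pageCycle_surjective (r : ℕ) (p q : ℤ) : Function.Surjective (pageCycle R G r p q) := by
  rintro ⟨z, hz⟩
  obtain ⟨a, rfl⟩ := Subquot.mk_surjective _ _ z
  rw [LinearMap.mem_ker, pageD_mk, Subquot.mk_eq_zero] at hz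
  obtain ⟨a', ha', h⟩ := exists_mem_A_succ a.2 hz
  exact ⟨⟨a', mem_A_mono ha' le_rfl rfl (by push_cast; omega)⟩,
    Subtype.ext (Subquot.mk_eq_mk.2 h)⟩

theorem mk_eq_mk_of_pageCycle_eq {r : ℕ} {p q : ℤ} {a b : A R G (r + 1 : ℕ) p q}
    (h : pageCycle R G r p q a = pageCycle R G r p q b) :
    Subquot.mk _ (B R G (r + 1 : ℕ) p q) a = Subquot.mk _ _ b := by
  have h' : (a - b : RC R G) ∈ B R G r p q :=
    (Subquot.mk_eq_mk (A := A R G r p q) (B := B R G r p q)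
      (a := ⟨a, mem_A_of_mem_A_succ a.2⟩) (b := ⟨b, mem_A_of_mem_A_succ b.2⟩)).1
      (congrArg Subtype.val h)
  rw [Subquot.mk_eq_mk]
  exact mem_B_succ (Nat.cast_succ r) (Submodule.sub_mem _ a.2 b.2) h'

variable (R G) in
/-- The homology class map from the cycles of `E^r` to `E^{r+1}`. -/
def pageπ (r : ℕ) (p q : ℤ) : LinearMap.ker (pageD R G r p q) →ₗ[R] E R G (r + 1) p q :=
  liftSurj (pageCycle R G r p q) (pageCycle_surjective r p q) (Subquot.mk _ _)
    fun _ _ => mk_eq_mk_of_pageCycle_eq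

theorem pageπ_pageCycle {r : ℕ} {p q : ℤ} (a : A R G (r + 1 : ℕ) p q) :
    pageπ R G r p q (pageCycle R G r p q a) = Subquot.mk _ _ a :=
  liftSurj_apply ..

theorem pageπ_eq_zero_iff (r : ℕ) (m n : ℤ) (z : LinearMap.ker (pageD R G r (m - r) (n + r - 1))) :
    pageπ R G r _ _ z = 0 ↔ ∃ x, pageD R G r m n x = z := by
  constructor
  · obtain ⟨a, rfl⟩ := pageCycle_surjective _ _ _ z
    rw [pageπ_pageCycle, Subquot.mk_eq_zero]
    intro h
    obtain ⟨x, hx, y, hy, e⟩ := mem_B.1 h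
    refine ⟨Subquot.mk _ _ ⟨y, mem_A_mono hy (by push_cast; omega) (by push_cast; omega)
      (by push_cast; omega)⟩, ?_⟩
    rw [pageD_mk]
    refine Subquot.mk_eq_mk.2 ?_
    change bd R G y - a.1 ∈ _
    rw [e, sub_add_cancel_right]
    exact Submodule.neg_mem _ (mem_B_of_mem_A (mem_A_mono hx le_rfl (by omega)
      (by push_cast; omega)))
  · rintro ⟨x, hx⟩
    obtain ⟨y, rfl⟩ := Subquot.mk_surjective _ _ x
    -- A boundary ∂y is a cycle on the nose, so it can serve as its own representative in A^{r+1}.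
    have : z = pageCycle R G r _ _ ⟨bd R G y, bd_mem_A _ y.2⟩ := Subtype.ext hx.symm
    rw [this, pageπ_pageCycle, Subquot.mk_eq_zero]
    exact bd_mem_B (mem_A_mono y.2 (by push_cast; omega) (by push_cast; omega)
      (by push_cast; omega))

variable (R G) in
/-- The homology of `E^r` is `E^{r+1}`. -/
def pageHomology (r : ℕ) : PageHomology R (r : ℤ) (E R G r) (E R G (r + 1)) where
  d := pageD R G r
  d_d m n x := by
    obtain ⟨a, rfl⟩ := Subquot.mk_surjective _ _ x
    rw [pageD_mk, pageD_mk, Subquot.mk_eq_zero]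
    change bd R G (bd R G a) ∈ _
    rw [bd_bd]
    exact Submodule.zero_mem _
  π := pageπ R G r
  π_surjective m n x := by
    obtain ⟨a, rfl⟩ := Subquot.mk_surjective _ _ x
    exact ⟨_, pageπ_pageCycle a⟩
  π_eq_zero_iff := pageπ_eq_zero_iff r

theorem page_mk (f : GraphMap G H) {r : ℕ} {p q : ℤ} (a : A R G r p q) :
    f.page R r p q (Subquot.mk _ _ a) = Subquot.mk _ _ ⟨f.chain R a, chain_mem_A f a.2⟩ := rfl

variable (R) in
/-- The map of pages induced by a map of graphs. -/
def pageHom (f : GraphMap G H) (r : ℕ) : PageHom (pageHomology R G r) (pageHomology R H r) where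
  f := f.page R r
  fH := f.page R (r + 1)
  comm m n x := by
    obtain ⟨a, rfl⟩ := Subquot.mk_surjective _ _ x
    exact congrArg (Subquot.mk _ _) (Subtype.ext (bd_chain f a.1))
  comm_π m n z h := by
    obtain ⟨a, rfl⟩ := pageCycle_surjective _ _ _ z
    exact (congrArg _ (pageπ_pageCycle a)).trans
      (pageπ_pageCycle ⟨f.chain R a, chain_mem_A f a.2⟩).symm

end Pages

/-! ### ∇^r as a natural chain map, and its effect on homology. -/

section Nabla

variable {R : Type*} [CommRing R] {V W V' W' : Type*} {G : Digraph V} {H : Digraph W}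
  {G' : Digraph V'} {H' : Digraph W'}

theorem sgn_natCast (k : ℕ) : sgn R k = (-1) ^ k := by
  simp [sgn, Int.negOnePow]

theorem sgn_eq_pow_length {l : List V} {n : ℤ} (h : (l.length : ℤ) = n + 1) :
    sgn R n = (-1) ^ (l.length + 1) := by
  rw [← sgn_natCast, sgn_eq_neg (R := R) (k := n + 1) (l := n) (by ring),
    sgn_eq_neg (R := R) (k := (l.length + 1 : ℕ)) (l := n + 1) (by omega), neg_neg]

/-- `bd_cross` only provides some sign; the comparison with the tensor differential needs the Koszul
sign itself, in integer degrees. -/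
theorem bd_cross_sgn (G : Digraph V) (H : Digraph W) {n : ℤ} {a : RC R G} (ha : a ∈ degPart R G n)
    (b : RC R H) : bd R (box G H) (cross R G H a b) =
      cross R G H (bd R G a) b + sgn R n • cross R G H a (bd R H b) := by
  refine eq_of_supported (f := (bd R (box G H)).comp ((cross R G H).flip b))
    (g := ((cross R G H).flip b).comp (bd R G) + sgn R n • (cross R G H).flip (bd R H b))
    (fun x hx => ?_) ha
  refine eq_of_supported (S := Set.univ)
    (f := (bd R (box G H)).comp (cross R G H (Finsupp.single x 1)))
    (g := cross R G H (bd R G (Finsupp.single x 1)) +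
      sgn R n • (cross R G H (Finsupp.single x 1)).comp (bd R H))
    (fun y _ => ?_) (by simp)
  rw [sgn_eq_pow_length hx]
  exact bd_cross_single G H x y

/-- The class of `x ⊗ y` in a tensor product of pages. -/
abbrev tenE {r : ℕ} {m n u v p q : ℤ} (hp : m + u = p) (hq : n + v = q) (x : E R G r m n)
    (y : E R H r u v) : TensorPage R G H r p q :=
  ten (R := R) (X := E R G r) (Y := E R H r) hp hq x y

theorem nabla_ten {r : ℕ} {m n u v p q : ℤ} (hp : m + u = p) (hq : n + v = q) (a : A R G r m n)
    (b : A R H r u v) : nabla R G H r p q (tenE hp hq (Subquot.mk _ _ a) (Subquot.mk _ _ b)) =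
      Subquot.mk _ _ ⟨cross R G H a b, cross_mem_A a.2 b.2 hp hq le_rfl le_rfl⟩ := by
  rw [tenE, ten, nabla, DirectSum.toModule_lof]
  rfl

/-- Linear maps out of a tensor product of pages agree if they agree on classes. -/
theorem tensorPage_ext {r : ℕ} {p q : ℤ} {M : Type*} [AddCommGroup M] [Module R M]
    {f g : TensorPage R G H r p q →ₗ[R] M}
    (h : ∀ m n u v hp hq (a : A R G r m n) (b : A R H r u v),
      f (tenE hp hq (Subquot.mk _ _ a) (Subquot.mk _ _ b)) =
        g (tenE hp hq (Subquot.mk _ _ a) (Subquot.mk _ _ b))) : f = g :=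
  tensorSum_ext (R := R) (X := E R G r) (Y := E R H r) fun m n u v hp hq x y => by
    obtain ⟨a, rfl⟩ := Subquot.mk_surjective _ _ x
    obtain ⟨b, rfl⟩ := Subquot.mk_surjective _ _ y
    exact h m n u v hp hq a b

theorem pageD_nabla {r : ℕ} {p q : ℤ} (t : TensorPage R G H r p q) :
    pageD R (box G H) r p q (nabla R G H r p q t) =
      nabla R G H r _ _ (tensorD (pageHomology R G r) (pageHomology R H r) p q t) := by
  have : pageD R (box G H) r p q ∘ₗ nabla R G H r p q =
      nabla R G H r _ _ ∘ₗ tensorD (pageHomology R G r) (pageHomology R H r) p q :=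
    tensorPage_ext fun m n u v hp hq a b => by
      simp only [LinearMap.comp_apply, tensorD_apply, shiftL_ten, shiftR_ten, map_add, map_smul]
      change _ = nabla R G H r _ _ (tenE _ _ (Subquot.mk _ _ ⟨bd R G a, bd_mem_A _ a.2⟩) _) +
        sgn R (m + n) •
          nabla R G H r _ _ (tenE _ _ _ (Subquot.mk _ _ ⟨bd R H b, bd_mem_A _ b.2⟩))
      rw [nabla_ten, nabla_ten, nabla_ten, pageD_mk, ← map_smul, ← map_add]
      exact congrArg _ (Subtype.ext (bd_cross_sgn G H a.2.1.2 b.1))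
  exact LinearMap.congr_fun this t

theorem shuffle_map (f : V → V') (g : W → W') : ∀ (a : List V) (b : List W),
    shuffle R (a.map f) (b.map g) =
      Finsupp.lmapDomain R R (List.map (Prod.map f g)) (shuffle R a b)
  | [], b => by simp [nil_shuffle]
  | a, [] => by simp [shuffle_nil]
  | x :: a, y :: b => by
    have h (z : List (V × W) →₀ R) : Finsupp.lmapDomain R R (List.map (Prod.map f g))
        (consL (x, y) z) =
        consL (f x, g y) (Finsupp.lmapDomain R R (List.map (Prod.map f g)) z) := by
      refine eq_of_supported (R := R) (S := Set.univ)
        (f := (Finsupp.lmapDomain R R (List.map (Prod.map f g))).comp (consL (x, y)))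
        (g := (consL (f x, g y)).comp (Finsupp.lmapDomain R R (List.map (Prod.map f g))))
        (fun b _ => ?_) (by simp)
      simp [Finsupp.mapDomain_single]
    have ih := shuffle_map f g a (y :: b)
    have ih' := shuffle_map f g (x :: a) b
    rw [List.map_cons, List.map_cons, shuffle_cons, shuffle_cons, h,
      map_add (Finsupp.lmapDomain _ _ _), map_add (Finsupp.lmapDomain _ _ _),
      map_smul (Finsupp.lmapDomain _ _ _),
      ← ih, ← ih', List.map_cons, List.map_cons, List.length_map]
    congr 2
    simp only [List.map_eq_nil_iff]
    split_ifs
    · simp [Finsupp.mapDomain_single]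
    · simp
termination_by a b => a.length + b.length

theorem chain_cross (f : GraphMap G G') (g : GraphMap H H') (a : RC R G) (b : RC R H) :
    (f.box g).chain R (cross R G H a b) = cross R G' H' (f.chain R a) (g.chain R b) := by
  refine eq_of_supported (S := Set.univ) (f := ((f.box g).chain R).comp ((cross R G H).flip b))
    (g := ((cross R G' H').flip (g.chain R b)).comp (f.chain R)) (fun x _ => ?_) (by simp)
  refine eq_of_supported (S := Set.univ)
    (f := ((f.box g).chain R).comp (cross R G H (Finsupp.single x 1)))
    (g := (cross R G' H' (f.chain R (Finsupp.single x 1))).comp (g.chain R))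
    (fun y _ => ?_) (by simp)
  simp only [LinearMap.comp_apply, cross_single, chain_single]
  rw [chain_proj, ← proj_single, ← proj_single, cross_proj, shuffleL_single, shuffle_map]
  · rfl
  · exact Finsupp.single_mem_supported _ _ (map_mem_reachSet f x.mem_reachSet)
  · exact Finsupp.single_mem_supported _ _ (map_mem_reachSet g y.mem_reachSet)
  · exact Finsupp.supported_mono (fun _ h => h.1) (shuffle_mem_reach x.mem_reachSet y.mem_reachSet)

theorem tensorPageMap_ten (f : GraphMap G G') (g : GraphMap H H') {r : ℕ} {m n u v p q : ℤ}
    (hp : m + u = p) (hq : n + v = q) (x : E R G r m n) (y : E R H r u v) :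
    tensorPageMap R f g r p q (tenE hp hq x y) =
      tenE hp hq (f.page R r m n x) (g.page R r u v y) := by
  rw [tenE, ten, tensorPageMap, DirectSum.lmap_lof]
  rfl

theorem tensorPageMap_eq (f : GraphMap G G') (g : GraphMap H H') {r : ℕ} {p q : ℤ}
    (t : TensorPage R G H r p q) :
    tensorPageMap R f g r p q t = mapL (f.page R r) (mapR (g.page R r) t) := by
  have : tensorPageMap R f g r p q = mapL (f.page R r) ∘ₗ mapR (g.page R r) :=
    tensorSum_ext (R := R) (X := E R G r) (Y := E R H r) fun m n u v hp hq x y => by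
      rw [tensorPageMap_ten, LinearMap.comp_apply, mapR_ten, mapL_ten]
  exact LinearMap.congr_fun this t

theorem page_nabla (f : GraphMap G G') (g : GraphMap H H') {r : ℕ} {p q : ℤ}
    (t : TensorPage R G H r p q) : (f.box g).page R r p q (nabla R G H r p q t) =
      nabla R G' H' r p q (tensorPageMap R f g r p q t) := by
  have : (f.box g).page R r p q ∘ₗ nabla R G H r p q =
      nabla R G' H' r p q ∘ₗ tensorPageMap R f g r p q :=
    tensorPage_ext fun m n u v hp hq a b => by
      rw [LinearMap.comp_apply, LinearMap.comp_apply, tensorPageMap_ten, nabla_ten, page_mk,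
        page_mk, page_mk, nabla_ten]
      exact congrArg _ (Subtype.ext (chain_cross f g a.1 b.1))
  exact LinearMap.congr_fun this t

variable (R G H) in
/-- The map from the cycles of `E^r(G) ⊗ E^r(H)` to `E^{r+1}(G □ H)`. -/
def nablaπ (r : ℕ) (p q : ℤ) :
    LinearMap.ker (tensorD (pageHomology R G r) (pageHomology R H r) p q) →ₗ[R]
      E R (box G H) (r + 1) p q :=
  pageπ R (box G H) r p q ∘ₗ (nabla R G H r p q).restrict fun t ht => by
    rw [LinearMap.mem_ker] at ht ⊢
    rw [pageD_nabla, ht, map_zero]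

theorem nablaπ_apply {r : ℕ} {p q : ℤ}
    (t : LinearMap.ker (tensorD (pageHomology R G r) (pageHomology R H r) p q))
    (h : nabla R G H r p q t.1 ∈ LinearMap.ker (pageD R (box G H) r p q)) :
    nablaπ R G H r p q t = pageπ R (box G H) r p q ⟨nabla R G H r p q t.1, h⟩ := rfl

/-- Representatives in A^{r+1} of cycles of E^r also represent their classes in E^{r+1}, so both
sides are the class of the same chain ∇(a ⊗ b). -/
theorem nabla_succ_mapL_mapR {r : ℕ} {p q : ℤ}
    (z : TensorSum R (fun m n => (pageHomology R G r).Z m n)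
      (fun m n => (pageHomology R H r).Z m n) p q) :
    nabla R G H (r + 1) p q (mapL (pageHomology R G r).π (mapR (pageHomology R H r).π z)) =
      nablaπ R G H r p q ⟨mapL (pageHomology R G r).iZ (mapR (pageHomology R H r).iZ z),
        mapL_mapR_iZ_mem z⟩ := by
  have : nabla R G H (r + 1) p q ∘ₗ mapL (pageHomology R G r).π ∘ₗ mapR (pageHomology R H r).π =
      nablaπ R G H r p q ∘ₗ (mapL (pageHomology R G r).iZ ∘ₗ
        mapR (pageHomology R H r).iZ).codRestrict _ mapL_mapR_iZ_mem :=
    tensorSum_ext fun m n u v hp hq x y => by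
      obtain ⟨a, ha⟩ := pageCycle_surjective _ _ _ x
      obtain ⟨b, hb⟩ := pageCycle_surjective _ _ _ y
      simp only [LinearMap.comp_apply, mapL_ten, mapR_ten]
      have e₁ : (pageHomology R G r).π m n x = Subquot.mk _ _ a :=
        (congrArg _ ha.symm).trans (pageπ_pageCycle a)
      have e₂ : (pageHomology R H r).π u v y = Subquot.mk _ _ b :=
        (congrArg _ hb.symm).trans (pageπ_pageCycle b)
      rw [e₁, e₂, nabla_ten, ← pageπ_pageCycle]
      refine congrArg (pageπ R (box G H) r p q) (Subtype.ext ?_)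
      have e₃ : (pageHomology R G r).iZ m n x = Subquot.mk (A R G r m n) (B R G r m n)
          ⟨a, mem_A_of_mem_A_succ a.2⟩ :=
        congrArg Subtype.val ha.symm
      have e₄ : (pageHomology R H r).iZ u v y = Subquot.mk (A R H r u v) (B R H r u v)
          ⟨b, mem_A_of_mem_A_succ b.2⟩ :=
        congrArg Subtype.val hb.symm
      have e₅ : nabla R G H r p q (mapL (pageHomology R G r).iZ
          (mapR (pageHomology R H r).iZ (ten hp hq x y))) = Subquot.mk _ _ ⟨cross R G H a b,
            cross_mem_A (mem_A_of_mem_A_succ a.2) (mem_A_of_mem_A_succ b.2) hp hq le_rfl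
              le_rfl⟩ := by
        rw [mapR_ten, mapL_ten, e₃, e₄, nabla_ten]
      exact e₅.symm
  exact LinearMap.congr_fun this z

theorem page_nablaπ (f : GraphMap G G') (g : GraphMap H H') {r : ℕ} {p q : ℤ}
    (t : LinearMap.ker (tensorD (pageHomology R G r) (pageHomology R H r) p q))
    (h : mapL (pageHom R f r).f (mapR (pageHom R g r).f t.1) ∈
      LinearMap.ker (tensorD (pageHomology R G' r) (pageHomology R H' r) p q)) :
    (f.box g).page R (r + 1) p q (nablaπ R G H r p q t) = nablaπ R G' H' r p q ⟨_, h⟩ := by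
  have e : (f.box g).page R r p q (nabla R G H r p q t.1) = nabla R G' H' r p q
      (mapL (pageHom R f r).f (mapR (pageHom R g r).f t.1)) :=
    (page_nabla f g t.1).trans (congrArg _ (tensorPageMap_eq f g t.1))
  refine ((pageHom R (f.box g) r).π_fZ p q _).symm.trans ?_
  exact congrArg (pageπ R (box G' H') r p q) (Subtype.ext e)

/-- If `∇^r` is bijective, it identifies the homology of `E^r(G) ⊗ E^r(H)`. -/
def tensorHomologyOfBijective (r : ℕ) (h : ∀ p q, Function.Bijective (nabla R G H r p q)) :
    TensorHomology (pageHomology R G r) (pageHomology R H r) (E R (box G H) (r + 1)) where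
  π := nablaπ R G H r
  π_surjective p q x := by
    obtain ⟨z, rfl⟩ := (pageHomology R (box G H) r).π_surjective p q x
    obtain ⟨t, ht⟩ := (h p q).2 z.1
    refine ⟨⟨t, (h _ _).1 ?_⟩, congrArg (pageπ R (box G H) r p q) (Subtype.ext ht)⟩
    rw [← pageD_nabla, ht, map_zero]
    exact z.2
  π_eq_zero_iff p q t := by
    refine (pageπ_eq_zero_iff r p q _).trans ⟨?_, ?_⟩
    · rintro ⟨x, hx⟩
      obtain ⟨x, rfl⟩ := (h p q).2 x
      exact ⟨x, (h _ _).1 ((pageD_nabla x).symm.trans hx)⟩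
    · rintro ⟨x, hx⟩
      exact ⟨nabla R G H r p q x, (pageD_nabla x).trans (congrArg _ hx)⟩
  ν := nabla R G H (r + 1)
  ν_map p q z h := nabla_succ_mapL_mapR z

end Nabla

/-! ### The zeroth page: classes of generators and of pairs of tuples. -/

section ZerothPage

variable {R : Type*} [CommRing R] {V W : Type*} {G : Digraph V} {H : Digraph W}

theorem len_cons_le_add (G : Digraph V) (v w : V) : ∀ l : List V,
    len G (v :: l) ≤ dist G v w + len G (w :: l)
  | [] => by simp [len]
  | x :: l => by
    rw [len, len, ← add_assoc]
    exact add_le_add_left (dist_triangle G v w x) _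

theorem len_cons_eraseIdx_le (G : Digraph V) : ∀ (v : V) (l : List V) (i : ℕ),
    len G (v :: l.eraseIdx i) ≤ len G (v :: l)
  | v, [], i => by simp
  | v, w :: l, 0 => len_cons_le_add G v w l
  | v, w :: l, i + 1 => by
    rw [List.eraseIdx_cons_succ, len, len]
    exact add_le_add_right (len_cons_eraseIdx_le G w l i) _

theorem len_le_len_cons (G : Digraph V) (v : V) : ∀ l : List V, len G l ≤ len G (v :: l)
  | [] => le_rfl
  | x :: l => by rw [len.eq_3]; exact le_add_self

/-- An inner vertex is removed by the triangle inequality, an end vertex by dropping a summand.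
Hence the differential preserves the length filtration. -/
theorem len_eraseIdx_le (G : Digraph V) : ∀ (l : List V) (i : ℕ), len G (l.eraseIdx i) ≤ len G l
  | [], i => by simp
  | v :: l, 0 => len_le_len_cons G v l
  | v :: l, i + 1 => len_cons_eraseIdx_le G v l i

theorem faces_mem {G : Digraph V} {l : List V} (h : l ∈ reachSet G) :
    faces R l ∈ Finsupp.supported R R
      {l' | l' ∈ reachSet G ∧ len G l' ≤ len G l ∧ l'.length + 1 = l.length} := by
  have h₁ := faces_mem_reach (R := R) h
  have h₂ := faces_mem_length (R := R) l
  have h₃ : faces R l ∈ Finsupp.supported R R {l' | len G l' ≤ len G l} :=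
    Submodule.sum_mem _ fun i _ => Submodule.smul_mem _ _
      (Finsupp.single_mem_supported _ _ (len_eraseIdx_le G l i))
  exact fun x hx => ⟨h₁ hx, h₃ hx, h₂ hx⟩

theorem bd_mem_filt {p : ℤ} {c : RC R G} (hc : c ∈ filt R G p) : bd R G c ∈ filt R G p :=
  mem_of_supported (fun x hx => by
    obtain ⟨k, hk, hk'⟩ := hx
    rw [bd_single]
    refine mem_of_supported (fun l hl => ?_) (faces_mem x.mem_reachSet)
    rw [proj_single]
    exact gen_mem_filt (hl.2.1.trans hk) hk') hc

/-- For nonpositive `r` the boundary condition is automatic; this covers the index -1 in the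
denominator of E^0. -/
theorem mem_A_of_nonpos {r p q : ℤ} (hr : r ≤ 0) {c : RC R G} (h : c ∈ filt R G p)
    (h' : c ∈ degPart R G (p + q)) : c ∈ A R G r p q :=
  ⟨⟨h, h'⟩, filt_mono G (by omega) (bd_mem_filt h)⟩

theorem mem_filt_of_mem_B_zero {p q : ℤ} {c : RC R G} (h : c ∈ B R G (0 : ℕ) p q) :
    c ∈ filt R G (p - 1) := by
  obtain ⟨x, hx, y, hy, rfl⟩ := mem_B.1 h
  exact Submodule.add_mem _ hx.1.1 (filt_mono G (by push_cast; omega) (bd_mem_filt hy.1.1))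

theorem mem_B_zero_of_mem_filt {p q : ℤ} {c : RC R G} (h : c ∈ filt R G (p - 1))
    (h' : c ∈ degPart R G (p + q)) : c ∈ B R G (0 : ℕ) p q :=
  mem_B_of_mem_A (mem_A_of_nonpos (by simp) h
    (by rwa [show p - 1 + (q + 1) = p + q by ring]))

/-- The generators that span `F_p RC_{p+q}`. -/
def filtSet (G : Digraph V) (p q : ℤ) : Set (Gen G) :=
  {x | (∃ k : ℕ, len G x.1 ≤ k ∧ (k : ℤ) ≤ p) ∧ (x.1.length : ℤ) = p + q + 1}

theorem supported_filtSet_le (p q : ℤ) :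
    Finsupp.supported R R (filtSet G p q) ≤ A R G (0 : ℕ) p q := fun _ hc =>
  mem_A_of_nonpos (by simp) (Finsupp.supported_mono (fun _ h => h.1) hc)
    (Finsupp.supported_mono (fun _ h => h.2) hc)

theorem mem_supported_filtSet {r p q : ℤ} {c : RC R G} (h : c ∈ A R G r p q) :
    c ∈ Finsupp.supported R R (filtSet G p q) := fun _ hx => ⟨h.1.1 hx, h.1.2 hx⟩

open Classical in
variable (R G) in
/-- The class in `E^0_{pq}` of the part of a chain in `F_p RC_{p+q}`. -/
def cls (p q : ℤ) : RC R G →ₗ[R] E R G 0 p q :=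
  Subquot.mk _ _ ∘ₗ Submodule.inclusion (supported_filtSet_le p q) ∘ₗ
    Finsupp.restrictDom R R (filtSet G p q)

theorem cls_of_mem {p q : ℤ} {c : RC R G} (h : c ∈ A R G (0 : ℕ) p q) :
    cls R G p q c = Subquot.mk _ _ ⟨c, h⟩ := by
  classical
  refine congrArg (Subquot.mk _ _) (Subtype.ext ?_)
  simp only [LinearMap.comp_apply, Submodule.coe_inclusion, Finsupp.restrictDom_apply]
  exact Finsupp.filter_eq_self_iff _ _ |>.2 fun x hx =>
    mem_supported_filtSet h (Finsupp.mem_support_iff.2 hx)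

theorem mk_eq_cls {p q : ℤ} (c : A R G (0 : ℕ) p q) : Subquot.mk _ _ c = cls R G p q c :=
  (cls_of_mem c.2).symm

theorem cls_eq_zero {p q : ℤ} {c : RC R G} (h : c ∈ filt R G (p - 1)) : cls R G p q c = 0 := by
  classical
  refine Subquot.mk_eq_zero.2 (mem_B_zero_of_mem_filt ?_ ?_)
  · simp only [LinearMap.comp_apply, Submodule.coe_inclusion, Finsupp.restrictDom_apply]
    intro x hx
    have hx := Finset.mem_coe.1 hx
    rw [Finsupp.support_filter, Finset.mem_filter] at hx
    exact h hx.1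
  · exact (supported_filtSet_le p q (Finsupp.restrictDom R R (filtSet G p q) c).2).1.2

theorem pageD_cls {p q : ℤ} {c : RC R G} (h : c ∈ A R G (0 : ℕ) p q) :
    pageD R G 0 p q (cls R G p q c) = cls R G _ _ (bd R G c) := by
  rw [cls_of_mem h, pageD_mk, cls_of_mem (bd_mem_A _ h)]

theorem gen_mem_A_zero {m n : ℤ} {K : ℕ} {a : List V} (ha : len G a ≤ K) (hm : (K : ℤ) ≤ m)
    (hn : (a.length : ℤ) = m + n + 1) : gen R G a ∈ A R G (0 : ℕ) m n :=
  mem_A_of_nonpos (by simp) (gen_mem_filt ha hm) (gen_mem_degPart hn)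

theorem exists_len_eq {a : List V} (h : a ∈ reachSet G) : ∃ k : ℕ, len G a = k := by
  induction a with
  | nil => exact ⟨0, rfl⟩
  | cons v a ih =>
    obtain ⟨k, hk⟩ := ih h.tail
    rcases a with _ | ⟨w, a⟩
    · exact ⟨0, rfl⟩
    · obtain ⟨n, -, hn⟩ := exists_path_of_reachable (List.isChain_cons_cons.1 h).1
      exact ⟨n + k, by rw [len, hn, hk]; push_cast; rfl⟩

variable (R G H) in
open Classical in
/-- The class of a pair of tuples in `(E^0(G) ⊗ E^0(H))_{pq}`. -/
def pairClass (p q : ℤ) (c : List V × List W) : TensorPage R G H 0 p q :=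
  if h : ((len G c.1).toNat : ℤ) + (len H c.2).toNat = p ∧
      (c.1.length : ℤ) - 1 - (len G c.1).toNat + (c.2.length - 1 - (len H c.2).toNat) = q then
    tenE h.1 h.2 (cls R G _ _ (gen R G c.1)) (cls R H _ _ (gen R H c.2))
  else 0

/-- The bidegrees are arbitrary integers tied to lengths by equations, so the class can be used at
any expressions for them, without transport. -/
theorem pairClass_eq {m n u v p q : ℤ} (hp : m + u = p) (hq : n + v = q) {K L : ℕ} {a : List V}
    {b : List W} (ha : len G a = K) (hb : len H b = L) (hm : (K : ℤ) = m) (hu : (L : ℤ) = u)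
    (hn : (a.length : ℤ) = m + n + 1) (hv : (b.length : ℤ) = u + v + 1) :
    pairClass R G H p q (a, b) =
      tenE hp hq (cls R G m n (gen R G a)) (cls R H u v (gen R H b)) := by
  have hk : (len G a).toNat = K := by rw [ha]; rfl
  have hl : (len H b).toNat = L := by rw [hb]; rfl
  obtain rfl : ((len G a).toNat : ℤ) = m := by omega
  obtain rfl : ((len H b).toNat : ℤ) = u := by omega
  obtain rfl : (a.length : ℤ) - 1 - (len G a).toNat = n := by omega
  obtain rfl : (b.length : ℤ) - 1 - (len H b).toNat = v := by omega
  exact dif_pos ⟨hp, hq⟩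

theorem pairClass_eq_zero {p q : ℤ} {K L : ℕ} {a : List V} {b : List W} (ha : len G a = K)
    (hb : len H b = L)
    (h : (K : ℤ) + L ≠ p ∨ (a.length : ℤ) + b.length ≠ p + q + 2) :
    pairClass R G H p q (a, b) = 0 := by
  have hk : (len G a).toNat = K := by rw [ha]; rfl
  have hl : (len H b).toNat = L := by rw [hb]; rfl
  refine dif_neg fun h' => ?_
  simp only [hk, hl] at h'
  omega

theorem pairClass_of_gen_eq_zero {p q : ℤ} {a : List V} {b : List W}
    (h : gen R G a = 0 ∨ gen R H b = 0) : pairClass R G H p q (a, b) = 0 := by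
  rw [pairClass]
  split_ifs
  · rcases h with h | h
    · rw [h, map_zero]; exact ten_zero_left ..
    · rw [h, map_zero]; exact ten_zero_right ..
  · rfl

variable (R G H) in
/-- `pairClass`, extended linearly. -/
def pairClassL (p q : ℤ) : (List V × List W →₀ R) →ₗ[R] TensorPage R G H 0 p q :=
  Finsupp.linearCombination R (pairClass R G H p q)

@[simp] theorem pairClassL_single (p q : ℤ) (c : List V × List W) :
    pairClassL R G H p q (Finsupp.single c 1) = pairClass R G H p q c := by simp [pairClassL]

theorem pairClassL_degenerate {p q : ℤ} {z : List V × List W →₀ R} (hz : z ∈ degenPair R V W) :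
    pairClassL R G H p q z = 0 :=
  eq_of_supported (g := 0) (fun c hc => by
    rw [pairClassL_single]
    exact pairClass_of_gen_eq_zero (hc.imp (gen_degenerate G) (gen_degenerate H))) hz

variable (R G H) in
/-- `tenE` as a bilinear map. -/
def tenL {r : ℕ} {m n u v p q : ℤ} (hp : m + u = p) (hq : n + v = q) :
    E R G r m n →ₗ[R] E R H r u v →ₗ[R] TensorPage R G H r p q :=
  (TensorProduct.mk R _ _).compr₂ (DirectSum.lof R (Split p q)
    (fun i => E R G r i.m i.n ⊗[R] E R H r i.u i.v) ⟨m, n, u, v, hp, hq⟩)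

theorem tenL_apply {r : ℕ} {m n u v p q : ℤ} (hp : m + u = p) (hq : n + v = q)
    (x : E R G r m n) (y : E R H r u v) : tenL R G H hp hq x y = tenE hp hq x y := rfl

end ZerothPage

/-! ### The tensor product differential on classes of pairs. -/

section AlexanderWhitney

variable {R : Type*} [CommRing R] {V W : Type*} {G : Digraph V} {H : Digraph W}

theorem supported_of_forall {α : Type*} {S T : Set α} {z : α →₀ R}
    (hz : z ∈ Finsupp.supported R R S) (h : ∀ a ∈ S, a ∈ T) : z ∈ Finsupp.supported R R T :=
  Finsupp.supported_mono h hz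

/-- Linear maps out of `E^0_{mn}` agree if they agree on generators of length `m`. -/
theorem page_zero_ext {m n : ℤ} {M : Type*} [AddCommGroup M] [Module R M]
    {f g : E R G 0 m n →ₗ[R] M}
    (h : ∀ (x : Gen G) (K : ℕ), len G x.1 = K → (K : ℤ) = m → (x.1.length : ℤ) = m + n + 1 →
      f (cls R G m n (gen R G x.1)) = g (cls R G m n (gen R G x.1))) : f = g := by
  refine LinearMap.ext fun z => ?_
  obtain ⟨a, rfl⟩ := Subquot.mk_surjective _ _ z
  rw [mk_eq_cls]
  refine eq_of_supported (f := f ∘ₗ cls R G m n) (g := g ∘ₗ cls R G m n) (fun x hx => ?_)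
    (mem_supported_filtSet a.2)
  obtain ⟨⟨k, hk, hk'⟩, hd⟩ := hx
  obtain ⟨K, hK⟩ := exists_len_eq x.mem_reachSet
  rw [LinearMap.comp_apply, LinearMap.comp_apply, ← gen_coe]
  by_cases hm : (K : ℤ) = m
  · exact h x K hK hm hd
  -- A generator of length below `m` lies in F_{m-1} and has class zero.
  · rw [cls_eq_zero, map_zero, map_zero]
    have : K ≤ k := by rw [hK] at hk; exact_mod_cast hk
    exact gen_mem_filt hK.le (by omega)

/-- Linear maps out of `(E^0(G) ⊗ E^0(H))_{pq}` agree if they agree on pairs of generators. -/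
theorem tensorPage_zero_ext {p q : ℤ} {M : Type*} [AddCommGroup M] [Module R M]
    {f g : TensorPage R G H 0 p q →ₗ[R] M}
    (h : ∀ (x : Gen G) (y : Gen H) (K L : ℕ), len G x.1 = K → len H y.1 = L → (K : ℤ) + L = p →
      (x.1.length : ℤ) + y.1.length = p + q + 2 →
      f (pairClass R G H p q (x.1, y.1)) = g (pairClass R G H p q (x.1, y.1))) : f = g := by
  refine tensorSum_ext (R := R) (X := E R G 0) (Y := E R H 0) fun m n u v hp hq x y => ?_
  have : (tenL R G H hp hq).compr₂ f = (tenL R G H hp hq).compr₂ g :=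
    page_zero_ext fun x K hK hm hx => page_zero_ext fun y L hL hu hy => by
      rw [LinearMap.compr₂_apply, LinearMap.compr₂_apply, tenL_apply,
        ← pairClass_eq hp hq hK hL hm hu hx hy]
      exact h x y K L hK hL (by omega) (by omega)
  exact LinearMap.congr_fun (LinearMap.congr_fun this x) y

theorem pairClassL_pairL {m n u v p q : ℤ} (hp : m + u = p) (hq : n + v = q) {K L : ℕ}
    {b : List W} (hb : len H b = L) (hm : (K : ℤ) = m) (hu : (L : ℤ) = u)
    (hv : (b.length : ℤ) = u + v + 1) {z : List V →₀ R}
    (hz : z ∈ Finsupp.supported R R {a | a ∈ reachSet G ∧ len G a ≤ K ∧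
      (a.length : ℤ) = m + n + 1}) :
    pairClassL R G H p q (pairL b z) =
      tenE hp hq (cls R G m n (proj R G z)) (cls R H u v (gen R H b)) := by
  refine eq_of_supported (f := pairClassL R G H p q ∘ₗ pairL b)
    (g := (tenL R G H hp hq).flip (cls R H u v (gen R H b)) ∘ₗ cls R G m n ∘ₗ proj R G)
    (fun a ha => ?_) hz
  obtain ⟨h₁, h₂, h₃⟩ := ha
  obtain ⟨k, hk⟩ := exists_len_eq h₁
  simp only [LinearMap.comp_apply, pairL_single, pairClassL_single, proj_single,
    LinearMap.flip_apply, tenL_apply]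
  have h₄ : k ≤ K := by rw [hk] at h₂; exact_mod_cast h₂
  by_cases h : k = K
  · exact pairClass_eq hp hq hk hb (by omega) hu h₃ hv
  · rw [pairClass_eq_zero hk hb (.inl (by omega)), cls_eq_zero (gen_mem_filt hk.le (by omega))]
    exact (ten_zero_left (R := R) (X := E R G 0) (Y := E R H 0) hp hq _).symm

theorem pairClassL_pairR {m n u v p q : ℤ} (hp : m + u = p) (hq : n + v = q) {K L : ℕ}
    {a : List V} (ha : len G a = K) (hm : (K : ℤ) = m) (hu : (L : ℤ) = u)
    (hn : (a.length : ℤ) = m + n + 1) {z : List W →₀ R}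
    (hz : z ∈ Finsupp.supported R R {b | b ∈ reachSet H ∧ len H b ≤ L ∧
      (b.length : ℤ) = u + v + 1}) :
    pairClassL R G H p q (pairR a z) =
      tenE hp hq (cls R G m n (gen R G a)) (cls R H u v (proj R H z)) := by
  refine eq_of_supported (f := pairClassL R G H p q ∘ₗ pairR a)
    (g := tenL R G H hp hq (cls R G m n (gen R G a)) ∘ₗ cls R H u v ∘ₗ proj R H)
    (fun b hb => ?_) hz
  obtain ⟨h₁, h₂, h₃⟩ := hb
  obtain ⟨l, hl⟩ := exists_len_eq h₁
  simp only [LinearMap.comp_apply, pairR_single, pairClassL_single, proj_single, tenL_apply]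
  have h₄ : l ≤ L := by rw [hl] at h₂; exact_mod_cast h₂
  by_cases h : l = L
  · exact pairClass_eq hp hq ha hl hm (by omega) hn h₃
  · rw [pairClass_eq_zero ha hl (.inl (by omega)), cls_eq_zero (gen_mem_filt hl.le (by omega))]
    exact (ten_zero_right (R := R) (X := E R G 0) (Y := E R H 0) hp hq _).symm

theorem bd_gen {a : List V} (h : a ∈ reachSet G) : bd R G (gen R G a) = proj R G (faces R a) := by
  rw [← proj_single, bd_proj G (Finsupp.single_mem_supported _ _ h), facesL_single]

theorem pairClassL_eq_zero {p q : ℤ} {z : List V × List W →₀ R}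
    (hz : z ∈ Finsupp.supported R R {c | c.1 ∈ reachSet G ∧ c.2 ∈ reachSet H ∧
      ((∃ k : ℕ, len G c.1 + len H c.2 ≤ k ∧ (k : ℤ) < p) ∨
        (c.1.length : ℤ) + c.2.length ≠ p + q + 2)}) :
    pairClassL R G H p q z = 0 := by
  refine eq_of_supported (g := 0) (fun c hc => ?_) hz
  obtain ⟨h₁, h₂, h₃⟩ := hc
  obtain ⟨k, hk⟩ := exists_len_eq h₁
  obtain ⟨l, hl⟩ := exists_len_eq h₂
  rw [pairClassL_single]
  refine pairClass_eq_zero hk hl (h₃.imp_left ?_)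
  rintro ⟨j, hj, hj'⟩
  rw [hk, hl] at hj
  have : k + l ≤ j := by exact_mod_cast hj
  omega

theorem pairBd_mem {K L : ℕ} {a : List V} {b : List W} (ha : a ∈ reachSet G) (hb : b ∈ reachSet H)
    (hK : len G a = K) (hL : len H b = L) :
    pairBd R (Finsupp.single (a, b) 1) ∈ Finsupp.supported R R {c | c.1 ∈ reachSet G ∧
      c.2 ∈ reachSet H ∧ len G c.1 + len H c.2 ≤ (K + L : ℕ) ∧
        c.1.length + c.2.length + 1 = a.length + b.length} := by
  rw [pairBd_single]
  refine Submodule.add_mem _ ?_ (Submodule.smul_mem _ _ ?_)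
  · refine mem_of_supported (fun c hc => ?_) (faces_mem ha)
    rw [pairL_single]
    refine Finsupp.single_mem_supported _ _ ⟨hc.1, hb, ?_, ?_⟩
    · push_cast
      exact add_le_add (hc.2.1.trans hK.le) hL.le
    · have : c.length + 1 = a.length := hc.2.2
      change c.length + b.length + 1 = _
      omega
  · refine mem_of_supported (fun c hc => ?_) (faces_mem hb)
    rw [pairR_single]
    refine Finsupp.single_mem_supported _ _ ⟨ha, hc.1, ?_, ?_⟩
    · push_cast
      exact add_le_add hK.le (hc.2.1.trans hL.le)
    · have : c.length + 1 = b.length := hc.2.2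
      change a.length + c.length + 1 = _
      omega

/-- The cast of the page index 0 stays in the bidegrees because the types of the summands depend on
it. -/
theorem tensorD_tenE_cls {m n u v p q : ℤ} (hp : m + u = p) (hq : n + v = q) {x : RC R G}
    {y : RC R H} (hx : x ∈ A R G (0 : ℕ) m n) (hy : y ∈ A R H (0 : ℕ) u v)
    (hp₁ : m - (0 : ℕ) + u = p - (0 : ℕ)) (hq₁ : n + (0 : ℕ) - 1 + v = q + (0 : ℕ) - 1)
    (hp₂ : m + (u - (0 : ℕ)) = p - (0 : ℕ)) (hq₂ : n + (v + (0 : ℕ) - 1) = q + (0 : ℕ) - 1) :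
    tensorD (pageHomology R G 0) (pageHomology R H 0) p q
      (tenE hp hq (cls R G m n x) (cls R H u v y)) =
      tenE hp₁ hq₁ (cls R G _ _ (bd R G x)) (cls R H u v y) +
        sgn R (m + n) • tenE hp₂ hq₂ (cls R G m n x) (cls R H _ _ (bd R H y)) := by
  rw [tensorD_apply, shiftL_ten, shiftR_ten, ← pageD_cls hx, ← pageD_cls hy]
  rfl

/-- The length bound is essential: above length p the class is zero, but faces could drop to length
p exactly and contribute. Below length p, or in the wrong degree, both sides vanish. -/
theorem tensorD_pairClass {p q : ℤ} {a : List V} {b : List W} {k : ℕ} (ha : a ∈ reachSet G)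
    (hb : b ∈ reachSet H) (hl : len G a + len H b ≤ k) (hk : (k : ℤ) ≤ p) :
    tensorD (pageHomology R G 0) (pageHomology R H 0) p q (pairClass R G H p q (a, b)) =
      pairClassL R G H _ _ (pairBd R (Finsupp.single (a, b) 1)) := by
  obtain ⟨K, hK⟩ := exists_len_eq ha
  obtain ⟨L, hL⟩ := exists_len_eq hb
  have hKL : K + L ≤ k := by rw [hK, hL] at hl; exact_mod_cast hl
  by_cases h : (K : ℤ) + L = p ∧ (a.length : ℤ) + b.length = p + q + 2
  · have hn : (a.length : ℤ) = K + (a.length - 1 - K) + 1 := by ring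
    have hv : (b.length : ℤ) = L + (b.length - 1 - L) + 1 := by ring
    have hq : (a.length : ℤ) - 1 - K + (b.length - 1 - L) = q := by omega
    have hp₁ : (K : ℤ) - (0 : ℕ) + L = p - (0 : ℕ) := by push_cast; omega
    have hq₁ : (a.length : ℤ) - 1 - K + (0 : ℕ) - 1 + (b.length - 1 - L) = q + (0 : ℕ) - 1 := by
      push_cast; omega
    have hp₂ : (K : ℤ) + (L - (0 : ℕ)) = p - (0 : ℕ) := by push_cast; omega
    have hq₂ : (a.length : ℤ) - 1 - K + (b.length - 1 - L + (0 : ℕ) - 1) = q + (0 : ℕ) - 1 := by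
      push_cast; omega
    have ha' : faces R a ∈ Finsupp.supported R R {c | c ∈ reachSet G ∧ len G c ≤ K ∧
        (c.length : ℤ) = K - (0 : ℕ) + (a.length - 1 - K + (0 : ℕ) - 1) + 1} :=
      supported_of_forall (faces_mem ha) fun c hc =>
        ⟨hc.1, hc.2.1.trans hK.le, by have := hc.2.2; push_cast; omega⟩
    have hb' : faces R b ∈ Finsupp.supported R R {c | c ∈ reachSet H ∧ len H c ≤ L ∧
        (c.length : ℤ) = L - (0 : ℕ) + (b.length - 1 - L + (0 : ℕ) - 1) + 1} :=
      supported_of_forall (faces_mem hb) fun c hc =>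
        ⟨hc.1, hc.2.1.trans hL.le, by have := hc.2.2; push_cast; omega⟩
    rw [pairClass_eq h.1 hq hK hL rfl rfl hn hv,
      tensorD_tenE_cls h.1 hq (gen_mem_A_zero hK.le le_rfl hn) (gen_mem_A_zero hL.le le_rfl hv)
        hp₁ hq₁ hp₂ hq₂, pairBd_single, map_add, map_smul, bd_gen ha, bd_gen hb,
      pairClassL_pairL hp₁ hq₁ hL (by simp) rfl hv ha',
      pairClassL_pairR hp₂ hq₂ hK rfl (by simp) hn hb', sgn_eq_pow_length (l := a) hn]
  · rw [pairClass_eq_zero hK hL (not_and_or.1 h), map_zero, pairClassL_eq_zero]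
    refine supported_of_forall (pairBd_mem ha hb hK hL) fun c hc => ⟨hc.1, hc.2.1, ?_⟩
    have := hc.2.2.2
    rcases not_and_or.1 h with h | h
    · exact .inl ⟨K + L, hc.2.2.1, by push_cast; omega⟩
    · exact .inr (by push_cast; omega)

end AlexanderWhitney

/-! ### The Eilenberg–Zilber theorem for E^0, giving E^1 of the box product. -/

section EilenbergZilber

variable {R : Type*} [CommRing R] {V W : Type*} {G : Digraph V} {H : Digraph W}

theorem aw_mem_pairs {l : List (V × W)} (h : l ∈ reachSet (box G H)) :
    aw R l ∈ Finsupp.supported R R {c | c.1 ∈ reachSet G ∧ c.2 ∈ reachSet H ∧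
      len G c.1 + len H c.2 ≤ len (box G H) l ∧ c.1.length + c.2.length = l.length + 1} := by
  rcases l with _ | ⟨v, l⟩
  · exact Submodule.zero_mem _
  · have h₁ := aw_mem (R := R) G H v l h
    have h₂ := aw_length (R := R) (v :: l)
    intro c hc
    obtain ⟨a, y, b, -, h₃, h₄, -, h₅⟩ := h₁ hc
    exact ⟨h₃, h₄, le_add_self.trans h₅, h₂ hc⟩

variable (R G H) in
/-- The Alexander–Whitney map on chains, with values in `(E^0(G) ⊗ E^0(H))_{pq}`. -/
def awChain (p q : ℤ) : RC R (box G H) →ₗ[R] TensorPage R G H 0 p q :=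
  Finsupp.linearCombination R fun l => pairClassL R G H p q (aw R l.1)

theorem awChain_single (p q : ℤ) (l : Gen (box G H)) :
    awChain R G H p q (Finsupp.single l 1) = pairClassL R G H p q (aw R l.1) := by simp [awChain]

theorem awChain_proj {p q : ℤ} {x : List (V × W) →₀ R}
    (hx : x ∈ Finsupp.supported R R (reachSet (box G H))) :
    awChain R G H p q (proj R (box G H) x) = pairClassL R G H p q (awL R x) := by
  refine eq_of_supported (f := awChain R G H p q ∘ₗ proj R (box G H))
    (g := pairClassL R G H p q ∘ₗ awL R) (fun l hl => ?_) hx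
  simp only [LinearMap.comp_apply, proj_single, awL_single]
  rcases isGen_or hl with h | rfl | h
  · rw [gen_of h, awChain_single]
  · simp [gen_nil, aw]
  · rw [gen_degenerate _ h, map_zero, pairClassL_degenerate (aw_degenerate l h)]

theorem awChain_eq_zero {p q : ℤ} {c : RC R (box G H)} (hc : c ∈ filt R (box G H) (p - 1)) :
    awChain R G H p q c = 0 := by
  refine eq_of_supported (g := 0) (fun l hl => ?_) hc
  obtain ⟨k, hk, hk'⟩ := hl
  rw [awChain_single]
  exact pairClassL_eq_zero (supported_of_forall (aw_mem_pairs l.mem_reachSet) fun c hc =>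
    ⟨hc.1, hc.2.1, .inl ⟨k, hc.2.2.1.trans hk, by omega⟩⟩)

variable (R G H) in
/-- The Alexander–Whitney map on `E^0`. -/
def awPage (p q : ℤ) : E R (box G H) 0 p q →ₗ[R] TensorPage R G H 0 p q :=
  liftSurj (Subquot.mk _ _) (Subquot.mk_surjective _ _) (awChain R G H p q ∘ₗ Submodule.subtype _)
    fun x y h => by
      rw [← sub_eq_zero, ← map_sub]
      exact awChain_eq_zero (mem_filt_of_mem_B_zero (Subquot.mk_eq_mk.1 h))

theorem awPage_mk {p q : ℤ} (c : A R (box G H) (0 : ℕ) p q) :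
    awPage R G H p q (Subquot.mk _ _ c) = awChain R G H p q c :=
  liftSurj_apply ..

/-- The identity is strict because the error in `awL_shuffle` is degenerate and has class zero. -/
theorem awPage_nabla {p q : ℤ} (t : TensorPage R G H 0 p q) :
    awPage R G H p q (nabla R G H 0 p q t) = t := by
  have : awPage R G H p q ∘ₗ nabla R G H 0 p q = LinearMap.id :=
    tensorPage_zero_ext fun x y K L hK hL hp hd => by
      have hn : (x.1.length : ℤ) = K + (x.1.length - 1 - K) + 1 := by ring
      have hv : (y.1.length : ℤ) = L + (y.1.length - 1 - L) + 1 := by ring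
      have hq : (x.1.length : ℤ) - 1 - K + (y.1.length - 1 - L) = q := by omega
      have hx := Finsupp.single_mem_supported R (1 : R) x.mem_reachSet
      have hy := Finsupp.single_mem_supported R (1 : R) y.mem_reachSet
      rw [LinearMap.comp_apply, LinearMap.id_apply]
      conv_lhs => rw [pairClass_eq hp hq hK hL rfl rfl hn hv,
        cls_of_mem (gen_mem_A_zero hK.le le_rfl hn), cls_of_mem (gen_mem_A_zero hL.le le_rfl hv),
        nabla_ten, awPage_mk]
      change awChain R G H p q (cross R G H (gen R G x.1) (gen R H y.1)) = _
      rw [← proj_single, ← proj_single, cross_proj G H hx hy, shuffleL_single, awChain_proj,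
        ← sub_eq_zero, ← pairClassL_single, ← map_sub]
      · exact pairClassL_degenerate (awL_shuffle _ _ x.2.1 y.2.1)
      · exact supported_of_forall (shuffle_mem_reach x.mem_reachSet y.mem_reachSet)
          fun _ h => h.1
  exact LinearMap.congr_fun this t

theorem awPage_pageD {p q : ℤ} (x : E R (box G H) 0 p q) :
    awPage R G H _ _ (pageD R (box G H) 0 p q x) =
      tensorD (pageHomology R G 0) (pageHomology R H 0) p q (awPage R G H p q x) := by
  obtain ⟨c, rfl⟩ := Subquot.mk_surjective _ _ x
  rw [pageD_mk, awPage_mk, awPage_mk]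
  refine eq_of_supported (f := awChain R G H _ _ ∘ₗ bd R (box G H))
    (g := tensorD (pageHomology R G 0) (pageHomology R H 0) p q ∘ₗ awChain R G H p q)
    (fun l hl => ?_) c.2.1.1
  obtain ⟨k, hk, hk'⟩ := hl
  rw [LinearMap.comp_apply, LinearMap.comp_apply, bd_single, awChain_single,
    awChain_proj (faces_mem_reach l.mem_reachSet)]
  have e : tensorD (pageHomology R G 0) (pageHomology R H 0) p q
      (pairClassL R G H p q (aw R l.1)) = pairClassL R G H _ _ (pairBd R (aw R l.1)) := by
    refine eq_of_supported
      (f := tensorD (pageHomology R G 0) (pageHomology R H 0) p q ∘ₗ pairClassL R G H p q)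
      (g := pairClassL R G H _ _ ∘ₗ pairBd R) (fun c hc => ?_) (aw_mem_pairs l.mem_reachSet)
    rw [LinearMap.comp_apply, LinearMap.comp_apply, pairClassL_single]
    exact tensorD_pairClass hc.1 hc.2.1 (hc.2.2.1.trans hk) hk'
  -- The end terms of `pairBd_aw` contain an empty tuple, which is not a generator.
  rw [e, pairBd_aw _ l.2.1, map_add, map_add, map_smul, pairClassL_single, pairClassL_single,
    pairClass_of_gen_eq_zero (.inl (gen_nil G)), pairClass_of_gen_eq_zero (.inr (gen_nil H)),
    smul_zero, add_zero, add_zero]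

variable (R G H) in
/-- The composite of the Alexander–Whitney map and the Eilenberg–Zilber map, on chains. -/
def awEz : RC R (box G H) →ₗ[R] RC R (box G H) :=
  Finsupp.linearCombination R fun l => proj R (box G H) (awShuf R l.1)

theorem awEz_single (l : Gen (box G H)) :
    awEz R G H (Finsupp.single l 1) = proj R (box G H) (awShuf R l.1) := by simp [awEz]

variable (R G H) in
/-- The chain homotopy between `awEz` and the identity. -/
def ezChainHtpy : RC R (box G H) →ₗ[R] RC R (box G H) :=
  Finsupp.linearCombination R fun l => proj R (box G H) (ezHtpy R l.1)

theorem ezChainHtpy_single (l : Gen (box G H)) :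
    ezChainHtpy R G H (Finsupp.single l 1) = proj R (box G H) (ezHtpy R l.1) := by
  simp [ezChainHtpy]

theorem ezChainHtpy_proj {x : List (V × W) →₀ R}
    (hx : x ∈ Finsupp.supported R R (reachSet (box G H))) :
    ezChainHtpy R G H (proj R (box G H) x) = proj R (box G H) (ezHtpyL R x) := by
  refine eq_of_supported (f := ezChainHtpy R G H ∘ₗ proj R (box G H))
    (g := proj R (box G H) ∘ₗ ezHtpyL R) (fun l hl => ?_) hx
  simp only [LinearMap.comp_apply, proj_single, ezHtpyL_single]
  rcases isGen_or hl with h | rfl | h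
  · rw [gen_of h, ezChainHtpy_single]
  · simp [gen_nil, ezHtpy]
  · rw [gen_degenerate _ h, map_zero, proj_degenerate _ (ezHtpy_degenerate l h)]

theorem ezHtpy_mem_reach {l : List (V × W)} (h : l ∈ reachSet (box G H)) :
    ezHtpy R l ∈ Finsupp.supported R R {m | m ∈ reachSet (box G H) ∧
      len (box G H) m ≤ len (box G H) l ∧ m.length = l.length + 1} := by
  rcases l with _ | ⟨v, l⟩
  · exact Submodule.zero_mem _
  · refine supported_of_forall (ezHtpy_mem G H v l h) ?_
    rintro _ ⟨m, rfl, h₁, h₂, h₃⟩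
    exact ⟨h₁, h₂, h₃⟩

theorem bd_ezChainHtpy (c : RC R (box G H)) :
    awEz R G H c = c + (bd R (box G H) (ezChainHtpy R G H c) +
      ezChainHtpy R G H (bd R (box G H) c)) := by
  refine eq_of_supported (S := Set.univ) (f := awEz R G H)
    (g := LinearMap.id + (bd R (box G H) ∘ₗ ezChainHtpy R G H +
      ezChainHtpy R G H ∘ₗ bd R (box G H))) (fun l _ => ?_) (by simp)
  have h := proj_degenerate (box G H) (ezHtpy_faces (R := R) l.1 l.2.1)
  rw [map_sub, map_sub, map_add, proj_single, gen_coe, sub_eq_zero] at h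
  simp only [LinearMap.add_apply, LinearMap.comp_apply, LinearMap.id_apply, awEz_single,
    ezChainHtpy_single, bd_single]
  rw [bd_proj, ezChainHtpy_proj (faces_mem_reach l.mem_reachSet), h, add_sub_cancel]
  exact supported_of_forall (ezHtpy_mem_reach l.mem_reachSet) fun _ h => h.1

theorem ezChainHtpy_mem_filt {p : ℤ} {c : RC R (box G H)} (hc : c ∈ filt R (box G H) p) :
    ezChainHtpy R G H c ∈ filt R (box G H) p :=
  mem_of_supported (fun l hl => by
    obtain ⟨k, hk, hk'⟩ := hl
    rw [ezChainHtpy_single]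
    refine mem_of_supported (fun m hm => ?_) (ezHtpy_mem_reach l.mem_reachSet)
    rw [proj_single]
    exact gen_mem_filt (hm.2.1.trans hk) hk') hc

theorem ezChainHtpy_mem_degPart {n : ℤ} {c : RC R (box G H)} (hc : c ∈ degPart R (box G H) n) :
    ezChainHtpy R G H c ∈ degPart R (box G H) (n + 1) :=
  mem_of_supported (fun l hl => by
    have hl : (l.1.length : ℤ) = n + 1 := hl
    rw [ezChainHtpy_single]
    refine mem_of_supported (fun m hm => ?_) (ezHtpy_mem_reach l.mem_reachSet)
    rw [proj_single]
    have := hm.2.2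
    exact gen_mem_degPart (by omega)) hc

theorem mem_A_of_mem_B {r p q : ℤ} {c : RC R G} (h : c ∈ B R G r p q) : c ∈ A R G r p q := by
  obtain ⟨x, hx, y, hy, rfl⟩ := mem_B.1 h
  exact Submodule.add_mem _ (mem_A_mono hx (by omega) (by omega) (by omega))
    (mem_A_mono (bd_mem_A r hy) (by omega) (by omega) (by omega))

/-- The difference is h∂c + ∂hc with h preserving the filtration. As ∂c lies in F_{p-1}, so does
h∂c, while hc lies in F_p: these are the two parts of the denominator of E^1. -/
theorem awEz_sub_mem_B {p q : ℤ} {c : RC R (box G H)} (hc : c ∈ A R (box G H) (1 : ℕ) p q) :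
    awEz R G H c - c ∈ B R (box G H) (1 : ℕ) p q := by
  rw [bd_ezChainHtpy, add_sub_cancel_left, add_comm]
  have hd := ezChainHtpy_mem_degPart (bd_mem_degPart hc.1.2)
  have hd' := ezChainHtpy_mem_degPart hc.1.2
  refine mem_B.2 ⟨_, mem_A_of_nonpos (by simp) (ezChainHtpy_mem_filt hc.2) ?_, _,
    mem_A_of_nonpos (by simp) (filt_mono _ (by simp) (ezChainHtpy_mem_filt hc.1.1)) ?_, rfl⟩
  · rwa [show p - 1 + (q + 1) = p + q - 1 + 1 by ring]
  · rwa [show p + ((1 : ℕ) : ℤ) - 1 + (q - ((1 : ℕ) : ℤ) + 2) = p + q + 1 by push_cast; ring]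

theorem awEz_mem_A {p q : ℤ} {c : RC R (box G H)} (hc : c ∈ A R (box G H) (1 : ℕ) p q) :
    awEz R G H c ∈ A R (box G H) (1 : ℕ) p q := by
  rw [← sub_add_cancel (awEz R G H c) c]
  exact Submodule.add_mem _ (mem_A_of_mem_B (awEz_sub_mem_B hc)) hc

theorem nabla_pairClass {p q : ℤ} {a : List V} {b : List W} {k : ℕ} (ha : a ∈ reachSet G)
    (hb : b ∈ reachSet H) (hl : len G a + len H b ≤ k) (hk : (k : ℤ) ≤ p)
    (hd : (a.length : ℤ) + b.length = p + q + 2) :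
    nabla R G H 0 p q (pairClass R G H p q (a, b)) =
      cls R (box G H) p q (proj R (box G H) (shuffle R a b)) := by
  obtain ⟨K, hK⟩ := exists_len_eq ha
  obtain ⟨L, hL⟩ := exists_len_eq hb
  have hKL : K + L ≤ k := by rw [hK, hL] at hl; exact_mod_cast hl
  have e := cross_proj G H (Finsupp.single_mem_supported R (1 : R) ha)
    (Finsupp.single_mem_supported R (1 : R) hb)
  rw [proj_single, proj_single, shuffleL_single] at e
  rw [← e]
  by_cases h : (K : ℤ) + L = p
  · have hn : (a.length : ℤ) = K + (a.length - 1 - K) + 1 := by ring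
    have hv : (b.length : ℤ) = L + (b.length - 1 - L) + 1 := by ring
    have hq : (a.length : ℤ) - 1 - K + (b.length - 1 - L) = q := by omega
    rw [pairClass_eq h hq hK hL rfl rfl hn hv, cls_of_mem (gen_mem_A_zero hK.le le_rfl hn),
      cls_of_mem (gen_mem_A_zero hL.le le_rfl hv), nabla_ten, mk_eq_cls]
  · rw [pairClass_eq_zero hK hL (.inl h), map_zero, cls_eq_zero]
    exact filt_mono _ (by omega)
      (cross_mem_filt (gen_mem_filt hK.le le_rfl) (gen_mem_filt hL.le le_rfl))

theorem nabla_awChain {p q : ℤ} {c : RC R (box G H)} (hc : c ∈ A R (box G H) (0 : ℕ) p q) :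
    nabla R G H 0 p q (awChain R G H p q c) = cls R (box G H) p q (awEz R G H c) := by
  refine eq_of_supported (f := nabla R G H 0 p q ∘ₗ awChain R G H p q)
    (g := cls R (box G H) p q ∘ₗ awEz R G H) (fun l hl => ?_) (mem_supported_filtSet hc)
  obtain ⟨⟨k, hk, hk'⟩, hd⟩ := hl
  rw [LinearMap.comp_apply, LinearMap.comp_apply, awChain_single, awEz_single, awShuf]
  refine eq_of_supported (f := nabla R G H 0 p q ∘ₗ pairClassL R G H p q)
    (g := cls R (box G H) p q ∘ₗ proj R (box G H) ∘ₗ shufL R) (fun x hx => ?_)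
    (aw_mem_pairs l.mem_reachSet)
  simp only [LinearMap.comp_apply, pairClassL_single, shufL_single]
  have := hx.2.2.2
  exact nabla_pairClass hx.1 hx.2.1 (hx.2.2.1.trans hk) hk' (by omega)

theorem nabla_awPage_pageCycle {p q : ℤ} (c : A R (box G H) (0 + 1 : ℕ) p q) :
    nabla R G H 0 p q (awPage R G H p q (pageCycle R (box G H) 0 p q c).1) =
      (pageCycle R (box G H) 0 p q ⟨awEz R G H c, awEz_mem_A c.2⟩).1 := by
  have h₁ : awPage R G H p q (pageCycle R (box G H) 0 p q c).1 = awChain R G H p q c :=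
    awPage_mk ⟨c.1, mem_A_of_mem_A_succ c.2⟩
  rw [h₁, nabla_awChain (mem_A_of_mem_A_succ c.2)]
  exact cls_of_mem (mem_A_of_mem_A_succ (awEz_mem_A c.2))

theorem mk_awEz {p q : ℤ} (c : A R (box G H) (0 + 1 : ℕ) p q) :
    Subquot.mk _ (B R (box G H) (0 + 1 : ℕ) p q) ⟨awEz R G H c, awEz_mem_A c.2⟩ =
      Subquot.mk _ _ c :=
  Subquot.mk_eq_mk.2 (awEz_sub_mem_B c.2)

/-- The Alexander–Whitney image of a cycle is a cycle, and ∇ sends it to the class of `awEz` of a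
representative, which agrees with the original class in E^1. -/
theorem nablaπ_zero_surjective (p q : ℤ) : Function.Surjective (nablaπ R G H 0 p q) := by
  intro x
  obtain ⟨c, rfl⟩ := Subquot.mk_surjective _ _ x
  have h : awPage R G H p q (pageCycle R (box G H) 0 p q c).1 ∈
      LinearMap.ker (tensorD (pageHomology R G 0) (pageHomology R H 0) p q) := by
    rw [LinearMap.mem_ker, ← awPage_pageD, LinearMap.mem_ker.1 (pageCycle R _ 0 p q c).2, map_zero]
  have h' : nabla R G H 0 p q (awPage R G H p q (pageCycle R (box G H) 0 p q c).1) ∈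
      LinearMap.ker (pageD R (box G H) 0 p q) := by
    rw [nabla_awPage_pageCycle]
    exact Subtype.prop _
  refine ⟨⟨_, h⟩, ?_⟩
  rw [nablaπ_apply _ h', ← mk_awEz, ← pageπ_pageCycle]
  exact congrArg (pageπ R (box G H) 0 p q) (Subtype.ext (nabla_awPage_pageCycle c))

variable (R G H) in
/-- The homology of `E^0(G) ⊗ E^0(H)` is `E^1(G □ H)`. -/
def tensorHomologyZero :
    TensorHomology (pageHomology R G 0) (pageHomology R H 0) (E R (box G H) (0 + 1)) where
  π := nablaπ R G H 0
  π_surjective := nablaπ_zero_surjective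
  π_eq_zero_iff p q t := by
    refine (pageπ_eq_zero_iff 0 p q _).trans ⟨?_, ?_⟩
    · rintro ⟨x, hx⟩
      -- If ∇t bounds x, then t bounds the Alexander–Whitney image of x, since that map commutes
      -- with differentials and is a left inverse of ∇.
      refine ⟨awPage R G H p q x, ?_⟩
      rw [← awPage_pageD]
      exact (congrArg _ hx).trans (awPage_nabla t.1)
    · rintro ⟨x, hx⟩
      exact ⟨nabla R G H 0 p q x, (pageD_nabla x).trans (congrArg _ hx)⟩
  ν := nabla R G H (0 + 1)
  ν_map p q z h := nabla_succ_mapL_mapR z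

end EilenbergZilber

/-! ### Induction over the pages and the Künneth sequence with Tor terms. -/

section Assembly

section

variable {R : Type*} [CommRing R] {V W : Type*} (G : Digraph V) (H : Digraph W)

/-- The homology of `E^r(G) ⊗ E^r(H)` is `E^{r+1}(G □ H)` if `r = 0` or `∇^r` is bijective. -/
def tensorHomology (r : ℕ) (h : r = 0 ∨ ∀ p q, Function.Bijective (nabla R G H r p q)) :
    TensorHomology (pageHomology R G r) (pageHomology R H r) (E R (box G H) (r + 1)) where
  π := nablaπ R G H r
  -- The case distinction stays inside proofs, so that the maps of this structure do not depend on
  -- which case holds.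
  π_surjective := by
    rcases h with rfl | h
    · exact (tensorHomologyZero R G H).π_surjective
    · exact (tensorHomologyOfBijective r h).π_surjective
  π_eq_zero_iff := by
    rcases h with rfl | h
    · exact (tensorHomologyZero R G H).π_eq_zero_iff
    · exact (tensorHomologyOfBijective r h).π_eq_zero_iff
  ν := nabla R G H (r + 1)
  ν_map p q z h := nabla_succ_mapL_mapR z

/-- Flatness of E^r(G) allows the Künneth sequence and flatness of E^{r+1}(G) kills its last term.
Page 0 is a separate alternative, as ∇^0 is only a homotopy equivalence. -/
theorem FlatBelow.nabla_bijective [IsDomain R] [IsPrincipalIdealRing R] {G : Digraph V} {s : ℕ}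
    (hG : FlatBelow R G s) : ∀ r < s, r = 0 ∨ ∀ p q, Function.Bijective (nabla R G H r p q)
  | 0, _ => .inl rfl
  | r + 1, h => .inr ((tensorHomology G H r
      (hG.nabla_bijective r (by omega))).ν_bijective (hG r (by omega)) (hG (r + 1) h))

end

variable {R : Type u} [CommRing R] {V W V' W' : Type u} {G : Digraph V} {H : Digraph W}
  {G' : Digraph V'} {H' : Digraph W'} {r : ℕ} {p q : ℤ}

variable (r) in
/-- The shift of the second bidegree in the `Tor` terms. -/
abbrev Split.tor (i : Split p q) : Split (p - r) (q + r - 1) :=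
  ⟨i.m, i.n, i.u - (r + 1 : ℕ) + 1, i.v + (r + 1 : ℕ) - 2, by have := i.hp; push_cast; omega,
    by have := i.hq; push_cast; omega⟩

theorem Split.tor_bijective : Function.Bijective (Split.tor r : Split p q → _) := by
  constructor
  · intro i j h
    simp only [Split.tor, Split.mk.injEq] at h
    ext <;> omega
  · intro j
    refine ⟨⟨j.m, j.n, j.u + r, j.v - r + 1, by have := j.hp; omega, by have := j.hq; omega⟩, ?_⟩
    ext <;> simp only <;> push_cast <;> omega

variable (R G H r p q) in
/-- The inclusion of the `Tor` terms in the tensor product of the boundaries of `E^r(G)` and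
`E^{r+1}(H)`. -/
def torInclusion : TorPage R G H (r + 1) p q →ₗ[R]
    TensorSum R (fun m n => (pageHomology R G r).B m n) (E R H (r + 1)) (p - r) (q + r - 1) :=
  lmapAlong (Split.tor r) fun i =>
    torToTensor _ ((pageHomology R G r).π i.m i.n) ((pageHomology R G r).π_surjective i.m i.n)

theorem torInclusion_injective (hZ : ∀ m n, Module.Flat R ((pageHomology R G r).Z m n)) :
    Function.Injective (torInclusion R G H r p q) :=
  lmapAlong_injective Split.tor_bijective.1 fun i =>
    have := hZ i.m i.n
    torToTensor_injective _ _

/-- With s = r + 1 the index (u-s+1, v+s-2) is the shift (u-r, v+r-1), so the Tor terms sit in the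
bidegrees of the boundaries. -/
theorem torInclusion_exact : Function.Exact (torInclusion R G H r p q)
    (mapL (pageHomology R G r).iB) :=
  lmapAlong_exact Split.tor_bijective.2 Function.injective_id fun _ => torToTensor_exact _ _

theorem torInclusion_lof (i : Split p q) (x) :
    torInclusion R G H r p q (DirectSum.lof R (Split p q) _ i x) =
      DirectSum.lof R (Split (p - r) (q + r - 1))
        (fun j => (pageHomology R G r).B j.m j.n ⊗[R] E R H (r + 1) j.u j.v) (Split.tor r i)
        (torToTensor _ ((pageHomology R G r).π i.m i.n)
          ((pageHomology R G r).π_surjective i.m i.n) x) :=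
  lmapAlong_lof ..

theorem torPageMap_lof (f : GraphMap G G') (g : GraphMap H H') (i : Split p q) (x) :
    torPageMap R f g (r + 1) p q (DirectSum.lof R (Split p q) _ i x) =
      DirectSum.lof R (Split p q) _ i ((((Tor (ModuleCat.{u} R) 1).map
        (ModuleCat.ofHom (f.page R (r + 1) i.m i.n))).app _ ≫
          ((Tor (ModuleCat.{u} R) 1).obj _).map (ModuleCat.ofHom
            (g.page R (r + 1) (i.u - (r + 1 : ℕ) + 1) (i.v + (r + 1 : ℕ) - 2)))).hom x) :=
  DirectSum.lmap_lof ..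

theorem mapL_mapR_lof {R : Type*} [CommRing R] {X X' Y Y' : ℤ → ℤ → Type*}
    [∀ m n, AddCommGroup (X m n)] [∀ m n, Module R (X m n)]
    [∀ m n, AddCommGroup (X' m n)] [∀ m n, Module R (X' m n)]
    [∀ m n, AddCommGroup (Y m n)] [∀ m n, Module R (Y m n)]
    [∀ m n, AddCommGroup (Y' m n)] [∀ m n, Module R (Y' m n)]
    (f : ∀ m n, X m n →ₗ[R] X' m n) (g : ∀ m n, Y m n →ₗ[R] Y' m n) {p q : ℤ} (i : Split p q)
    (x : X i.m i.n ⊗[R] Y i.u i.v) :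
    mapL f (mapR g (DirectSum.lof R (Split p q) (fun i => X i.m i.n ⊗[R] Y i.u i.v) i x)) =
      DirectSum.lof R (Split p q) (fun i => X' i.m i.n ⊗[R] Y' i.u i.v) i
        ((g i.u i.v).lTensor _ ((f i.m i.n).rTensor _ x)) := by
  rw [lTensor_rTensor_apply]
  refine (congrArg _ (lmapAlong_lof ..)).trans ?_
  exact lmapAlong_lof ..

theorem torInclusion_naturality_lof (f : GraphMap G G') (g : GraphMap H H') (i : Split p q) (x) :
    torInclusion R G' H' r p q
      (torPageMap R f g (r + 1) p q (DirectSum.lof R (Split p q) _ i x)) =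
      mapL (pageHom R f r).fB (mapR (pageHom R g r).fH
        (torInclusion R G H r p q (DirectSum.lof R (Split p q) _ i x))) := by
  rw [torPageMap_lof, torInclusion_lof, torInclusion_lof, mapL_mapR_lof]
  exact congrArg _ (torToTensor_naturality ((pageHomology R G r).π_surjective i.m i.n)
    ((pageHomology R G' r).π_surjective i.m i.n) ((pageHom R f r).fB i.m i.n)
    ((pageHom R f r).fZ i.m i.n) (f.page R (r + 1) i.m i.n) _ (fun _ => rfl)
    ((pageHom R f r).π_fZ i.m i.n) x)

theorem torInclusion_naturality (f : GraphMap G G') (g : GraphMap H H')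
    (t : TorPage R G H (r + 1) p q) :
    torInclusion R G' H' r p q (torPageMap R f g (r + 1) p q t) =
      mapL (pageHom R f r).fB (mapR (pageHom R g r).fH (torInclusion R G H r p q t)) := by
  have : torInclusion R G' H' r p q ∘ₗ torPageMap R f g (r + 1) p q =
      mapL (pageHom R f r).fB ∘ₗ mapR (pageHom R g r).fH ∘ₗ torInclusion R G H r p q :=
    DirectSum.linearMap_ext _ fun i => LinearMap.ext fun x => torInclusion_naturality_lof f g i x
  exact LinearMap.congr_fun this t

variable [IsDomain R] [IsPrincipalIdealRing R]

variable (H p q) in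
/-- The connecting map of the Künneth sequence, with values in the tensor product of the boundaries
of `E^r(G)` and `E^{r+1}(H)`. -/
def kunnethConnect (hG : FlatBelow R G (r + 1)) : E R (box G H) (r + 1) p q →ₗ[R]
    TensorSum R (fun m n => (pageHomology R G r).B m n) (E R H (r + 1)) (p - r) (q + r - 1) :=
  (tensorHomology G H r (hG.nabla_bijective H r (by omega))).connect (hG r (by omega)) p q

variable (hG : FlatBelow R G (r + 1)) (hG' : FlatBelow R G' (r + 1))

include hG in
theorem FlatBelow.flat_Z (m n : ℤ) : Module.Flat R ((pageHomology R G r).Z m n) :=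
  (pageHomology R G r).flat_Z (hG r (by omega)) m n

theorem nabla_kunnethConnect_exact :
    Function.Exact (nabla R G H (r + 1) p q) (kunnethConnect H p q hG) :=
  (tensorHomology G H r (hG.nabla_bijective H r (by omega))).exact_connect (hG r (by omega)) p q

theorem kunnethConnect_exact :
    Function.Exact (kunnethConnect H p q hG) (mapL (pageHomology R G r).iB) :=
  (tensorHomology G H r (hG.nabla_bijective H r (by omega))).connect_exact (hG r (by omega)) p q

theorem kunnethConnect_naturality (f : GraphMap G G') (g : GraphMap H H')
    (x : E R (box G H) (r + 1) p q) :
    kunnethConnect H' p q hG' ((f.box g).page R (r + 1) p q x) =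
      mapL (pageHom R f r).fB (mapR (pageHom R g r).fH (kunnethConnect H p q hG x)) :=
  connect_naturality (hG r (by omega)) (hG' r (by omega))
    (tensorHomology G H r (hG.nabla_bijective H r (by omega)))
    (tensorHomology G' H' r (hG'.nabla_bijective H' r (by omega)))
    (pageHom R f r) (pageHom R g r) _ (page_nablaπ f g) x

/-- The connecting map and the Tor inclusion have the same image, the kernel of B ⊗ H → Z ⊗ H. Hence
the former factors through the latter, and onto it. -/
theorem kunnethConnect_mem_range (x : E R (box G H) (r + 1) p q) :
    kunnethConnect H p q hG x ∈ LinearMap.range (torInclusion R G H r p q) :=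
  (torInclusion_exact _).1 ((kunnethConnect_exact hG _).2 ⟨x, rfl⟩)

variable (H p q) in
/-- The map to the `Tor` terms in the Künneth sequence. -/
def kunnethδ : E R (box G H) (r + 1) p q →ₗ[R] TorPage R G H (r + 1) p q :=
  (LinearEquiv.ofInjective _
    (torInclusion_injective (H := H) (p := p) (q := q) hG.flat_Z)).symm.toLinearMap ∘ₗ
      (kunnethConnect H p q hG).codRestrict _ (kunnethConnect_mem_range hG)

theorem torInclusion_kunnethδ (x : E R (box G H) (r + 1) p q) :
    torInclusion R G H r p q (kunnethδ H p q hG x) = kunnethConnect H p q hG x :=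
  congrArg Subtype.val ((LinearEquiv.ofInjective _
    (torInclusion_injective (H := H) (p := p) (q := q) hG.flat_Z)).apply_symm_apply _)

include hG in
theorem nabla_injective : Function.Injective (nabla R G H (r + 1) p q) :=
  (tensorHomology G H r (hG.nabla_bijective H r (by omega))).ν_injective (hG r (by omega)) p q

theorem nabla_kunnethδ_exact :
    Function.Exact (nabla R G H (r + 1) p q) (kunnethδ H p q hG) := fun x => by
  rw [← nabla_kunnethConnect_exact hG x, ← torInclusion_kunnethδ hG,
    map_eq_zero_iff _ (torInclusion_injective hG.flat_Z)]

theorem kunnethδ_surjective : Function.Surjective (kunnethδ H p q hG) := fun t => by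
  obtain ⟨x, hx⟩ := (kunnethConnect_exact hG _).1 ((torInclusion_exact _).2 ⟨t, rfl⟩)
  exact ⟨x, torInclusion_injective hG.flat_Z ((torInclusion_kunnethδ hG x).trans hx)⟩

/-- The inclusion of the Tor terms is injective and natural, which reduces the claim to naturality
of the connecting map. -/
theorem kunnethδ_naturality (f : GraphMap G G') (g : GraphMap H H')
    (x : E R (box G H) (r + 1) p q) :
    kunnethδ H' p q hG' ((f.box g).page R (r + 1) p q x) =
      torPageMap R f g (r + 1) p q (kunnethδ H p q hG x) := by
  refine torInclusion_injective hG'.flat_Z ?_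
  rw [torInclusion_kunnethδ, torInclusion_naturality, torInclusion_kunnethδ,
    kunnethConnect_naturality hG hG']

end Assembly

end

end MPSS

theorem mainTheorem2 (R : Type u) [CommRing R] [IsDomain R] [IsPrincipalIdealRing R]
    (s : ℕ) (hs : 1 ≤ s) :
    (∀ {V W : Type u} (G : Digraph V) (H : Digraph W), MPSS.FlatBelow R G s →
      ∀ r : ℕ, 1 ≤ r → r < s → ∀ p q : ℤ, Function.Bijective (MPSS.nabla R G H r p q)) ∧
    ∃ δ : ∀ {V W : Type u} (G : Digraph V) (H : Digraph W), MPSS.FlatBelow R G s →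
        ∀ p q : ℤ, MPSS.E R (MPSS.box G H) s p q →ₗ[R] MPSS.TorPage R G H s p q,
      (∀ {V W : Type u} (G : Digraph V) (H : Digraph W) (hG : MPSS.FlatBelow R G s) (p q : ℤ),
        Function.Injective (MPSS.nabla R G H s p q) ∧
        Function.Exact (MPSS.nabla R G H s p q) (δ G H hG p q) ∧
        Function.Surjective (δ G H hG p q)) ∧
      (∀ {V W V' W' : Type u} (G : Digraph V) (G' : Digraph V') (H : Digraph W) (H' : Digraph W')
        (hG : MPSS.FlatBelow R G s) (hG' : MPSS.FlatBelow R G' s)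
        (f : MPSS.GraphMap G G') (g : MPSS.GraphMap H H') (p q : ℤ),
        (f.box g).page R s p q ∘ₗ MPSS.nabla R G H s p q =
          MPSS.nabla R G' H' s p q ∘ₗ MPSS.tensorPageMap R f g s p q ∧
        δ G' H' hG' p q ∘ₗ (f.box g).page R s p q =
          MPSS.torPageMap R f g s p q ∘ₗ δ G H hG p q) := by
  -- As s ≥ 1, the page E^s is the homology of E^{s-1}, to which the Künneth sequence applies.
  obtain ⟨r, rfl⟩ : ∃ r, s = r + 1 := ⟨s - 1, by omega⟩
  refine ⟨fun G H hG r' h₁ h₂ => (hG.nabla_bijective H r' h₂).resolve_left (by omega),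
    fun G H hG p q => MPSS.kunnethδ H p q hG, fun G H hG p q => ?_,
    fun G G' H H' hG hG' f g p q => ⟨?_, ?_⟩⟩
  · exact ⟨MPSS.nabla_injective hG, MPSS.nabla_kunnethδ_exact hG, MPSS.kunnethδ_surjective hG⟩
  · exact LinearMap.ext fun t => MPSS.page_nabla f g t
  · exact LinearMap.ext fun x => MPSS.kunnethδ_naturality hG hG' f g x
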